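/- **Setting.** Let $\mathbb C[a]=\mathbb C[a_1,a_2,\dots]$. A strict partition is $\lambda=(\lambda_1>\dots>\lambda_\ell>0)$, $\ell(\lambda)=\ell$; let $r'$ be the least even number $\ge\ell(\lambda)$ and put $\lambda_{r'}=0$ if $\ell(\lambda)$ is odd. Let $p_m(x)=\sum_i x_i^m$, $\Gamma(x)=\mathbb C[p_1(x),p_3(x),\dots]$, $\Gamma(x|a)=\mathbb C[a]\otimes\Gamma(x)$, and let $\hat\Gamma(y|a)$ be the set of formal sums $\sum_{k\ge0}f_k(y)$ with $f_k\in\Gamma(y|a)$ homogeneous of degree $k$ in $y$. The factorial $Q$-function $Q_\lambda(x|a)\in\Gamma(x|a)$ is the stable limit, as $n\to\infty$, of $$Q_\lambda(x_1,\dots,x_n|a)=\frac1{(n-\ell(\lambda))!}\sum_{w\in S_n}w\Bigl(\prod_{i=1}^{\ell(\lambda)}(\!(x_i|a)\!)^{\lambda_i}\prod_{i=1}^{\ell(\lambda)}\prod_{j=i+1}^n\frac{x_i+x_j}{x_i-x_j}\Bigr),\qquad (\!(x|a)\!)^k=2x(x-a_1)\cdots(x-a_{k-1}).$$ Put $Q_\lambda(x)=Q_\lambda(x|0)$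 and $P_\lambda=2^{-\ell(\lambda)}Q_\lambda$. Let $\langle\cdot,\cdot\rangle:\hat\Gamma(y|a)\times\Gamma(x|a)\to\mathbb C[a]$ be the pairing $\bigl\langle\sum_\lambda u_\lambda P_\lambda(y),\sum_\lambda v_\lambda Q_\lambda(x)\bigr\rangle=\sum_\lambda u_\lambda v_\lambda$ (with $u_\lambda,v_\lambda\in\mathbb C[a]$, almost all $v_\lambda=0$). The dual factorial $P$-function $\hat P_\lambda(y|a)$ is the unique element of $\hat\Gamma(y|a)$ with $\langle\hat P_\lambda(y|a),Q_\mu(x|a)\rangle=\delta_{\lambda\mu}$ for all strict partitions $\mu$. Let $\mathcal C$ be the $\mathbb C[a]$-algebra generated by $\phi_n$ ($n\in\mathbb Z$) with relations $\phi_m\phi_n+\phi_n\phi_m=2(-1)^m\delta_{m+n,0}$, let $\mathcal F=\mathcal C/\sum_{n\ge1}\mathcal C\phi_{-n}$ be the Fock space, with vacuum vector $|\mathrm{vac}\rangle$ the class of $1$. Let $\langle\mathrm{vac}|:\mathcal F\to\mathbb C[a]$ be the functional $u|\mathrm{vac}\rangle\mapsto\langle\mathrm{vac}|u|\mathrm{vac}\rangle$,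 where $u\mapsto\langle\mathrm{vac}|u|\mathrm{vac}\rangle$ is the $\mathbb C[a]$-linear map $\mathcal C\to\mathbb C[a]$ with $1\mapsto1$, $\phi_0\mapsto0$, vanishing on $\mathcal C\phi_{-n}$ and $\phi_n\mathcal C$ for $n\ge1$. For odd $m\ge1$ let $H_m=\frac14\sum_{i\in\mathbb Z}(-1)^i\phi_{-i-m}\phi_i$, and $H(x)=2\sum_{m\ge1\text{ odd}}\frac{p_m(x)}m H_m$. Let $\hat{\mathcal F}$ be the completion of $\mathcal F$ consisting of the formal sums $\sum_{d\ge0}v_d$ with $v_d\in\mathcal F$ homogeneous of degree $d$, where $\phi_{i_1}\cdots\phi_{i_p}|\mathrm{vac}\rangle$ has degree $i_1+\dots+i_p$; $\langle\mathrm{vac}|e^{H(y)}|\cdot\rangle$ extends to $\hat{\mathcal F}$ term by term, with values in $\hat\Gamma(y|a)$. With $e_i,h_i$ the elementary and complete symmetric polynomials, let $$\phi^{(a)}_j=\sum_{i=0}^{j-1}(-1)^ie_i(a_1,\dots,a_{j-1})\phi_{j-i}\ (j>0),\qquad \phi_0^{(a)}=\phi_0,\qquad \hat\phi^{(a)}_j=\sum_{i\ge0}h_i(a_1,\dots,a_j)\phi_{j+i}\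 (j\ge0),$$ $$|\lambda\rangle_C=\phi^{(a)}_{\lambda_1}\cdots\phi^{(a)}_{\lambda_{r'}}|\mathrm{vac}\rangle\in\mathcal F,\qquad |\lambda\rangle_H=\hat\phi^{(a)}_{\lambda_1}\cdots\hat\phi^{(a)}_{\lambda_{r'}}|\mathrm{vac}\rangle\in\hat{\mathcal F}.$$ **Theorem.** For every strict partition $\lambda$, the function $\hat P_\lambda(y|a)$ exists and is unique, and $$\hat P_\lambda(y|a)=2^{-\ell(\lambda)}\langle\mathrm{vac}|e^{H(y)}|\lambda\rangle_H .$$ Moreover, for every strict partition $\lambda$, $$Q_\lambda(x|a)=\langle\mathrm{vac}|e^{H(x)}|\lambda\rangle_C .$$ -/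

import Mathlib

open scoped BigOperators TensorProduct

noncomputable section

namespace NeutralFermion

/-- The coefficient ring `ℂ[a] = ℂ[a₁, a₂, …]`; the parameters are indexed by the
positive integers. -/
abbrev CoeffRing : Type := MvPolynomial ℕ+ ℂ

/-- A complex number, seen in `ℂ[a]`. -/
abbrev cst (c : ℂ) : CoeffRing := MvPolynomial.C c

/-- The elementary symmetric polynomial `e_i(a₁, …, a_p)`. -/
def elem (p i : ℕ) : CoeffRing :=
  MvPolynomial.aeval (fun k : Fin p => (MvPolynomial.X (Nat.succPNat (k : ℕ)) : CoeffRing))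
    (MvPolynomial.esymm (Fin p) ℂ i)

/-- The complete homogeneous symmetric polynomial `h_i(a₁, …, a_p)`. -/
def homog (p i : ℕ) : CoeffRing :=
  MvPolynomial.aeval (fun k : Fin p => (MvPolynomial.X (Nat.succPNat (k : ℕ)) : CoeffRing))
    (MvPolynomial.hsymm (Fin p) ℂ i)

/-! ### Strict partitions -/

/-- A strict partition `λ₁ > λ₂ > … > λ_ℓ > 0`. -/
structure StrictPartition where
  /-- the (nonzero) parts, in decreasing order -/
  parts : List ℕ
  strict : parts.Pairwise (· > ·)
  pos : ∀ k ∈ parts, 0 < k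

/-- The length `ℓ(λ)`. -/
def StrictPartition.length (lam : StrictPartition) : ℕ := lam.parts.length

/-- The sequence `(λ₁, …, λ_{r'})`, where `r'` is the least even number with `r' ≥ ℓ(λ)`, and
`λ_{r'} = 0` if `ℓ(λ)` is odd. -/
def StrictPartition.evenParts (lam : StrictPartition) : List ℕ :=
  if Even lam.parts.length then lam.parts else lam.parts ++ [0]

/-! ### Symmetric functions -/

/-- Formal power series over `ℂ[a]` in the variables `x₁, x₂, …`; `x_{i+1}` is `MvPowerSeries.X i`.
The rings of symmetric functions below live in it. -/
abbrev Series : Type := MvPowerSeries ℕ CoeffRing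

open Classical in
/-- The power sum `p_m(x) = ∑ x_i ^ m` (for `m ≥ 1`). -/
def powerSum (m : ℕ) : Series :=
  fun d => if ∃ i : ℕ, d = Finsupp.single i m then 1 else 0

/-- `Γ(x|a) = ℂ[a] ⊗ Γ(x)`, with `Γ(x) = ℂ[p₁(x), p₃(x), p₅(x), …]`. -/
def Gam : Subalgebra CoeffRing Series :=
  Algebra.adjoin CoeffRing (Set.range fun k : ℕ => powerSum (2 * k + 1))

/-- The homogeneous component of degree `k` of a series in the variables `x₁, x₂, …`. -/
def component (k : ℕ) (f : Series) : Series :=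
  fun d => if d.degree = k then MvPowerSeries.coeff d f else 0

/-- `\hat Γ(y|a)`: the formal sums `∑ f_k` with `f_k ∈ Γ(y|a)` homogeneous of degree `k` in `y`. -/
def IsInGamHat (f : Series) : Prop := ∀ k : ℕ, component k f ∈ Gam

/-- The factorial power `((x|a))^k`, equal to `2 x (x - a₁) ⋯ (x - a_{k-1})` for `k ≥ 1`, with `x`
in a `ℂ[a]`-algebra. (Only the values at `k ≥ 1` are ever used.) -/
def factorialPower {K : Type} [CommRing K] [Algebra CoeffRing K] (x : K) (k : ℕ) : K :=
  2 * x * ∏ t ∈ Finset.range (k - 1), (x - algebraMap CoeffRing K (MvPolynomial.X (Nat.succPNat t)))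

/-- The field of rational functions in `x₁, …, x_n` (and the parameters `a`). -/
abbrev RatFun (n : ℕ) : Type := FractionRing (MvPolynomial (Fin n) CoeffRing)

/-- The variable `x_{i+1}` as a rational function. -/
def xvar {n : ℕ} (i : Fin n) : RatFun n :=
  algebraMap (MvPolynomial (Fin n) CoeffRing) (RatFun n) (MvPolynomial.X i)

/-- The defining symmetrization
`1/(n-ℓ)! ∑_{w ∈ S_n} w (∏_{i ≤ ℓ} ((x_i|a))^{λ_i} ∏_{i ≤ ℓ} ∏_{i < j ≤ n} (x_i+x_j)/(x_i-x_j))`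
of the factorial `Q`-function of `λ` in `n ≥ ℓ = ℓ(λ)` variables. -/
def factorialQRat (lam : StrictPartition) (n : ℕ) (hn : lam.length ≤ n) : RatFun n :=
  ((n - lam.length).factorial : RatFun n)⁻¹ *
    ∑ w : Equiv.Perm (Fin n),
      ((∏ i : Fin lam.length,
          factorialPower (xvar (w (Fin.castLE hn i))) (lam.parts.get i)) *
        ∏ i : Fin lam.length, ∏ j ∈ Finset.univ.filter (fun j : Fin n => Fin.castLE hn i < j),
          (xvar (w (Fin.castLE hn i)) + xvar (w j)) / (xvar (w (Fin.castLE hn i)) - xvar (w j)))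

open Classical in
/-- The polynomial `Q_λ(x₁, …, x_n|a)`: the polynomial that the above rational function is;
it is `0` if `n < ℓ(λ)`. -/
def factorialQPoly (lam : StrictPartition) (n : ℕ) : MvPolynomial (Fin n) CoeffRing :=
  if h : ∃ hn : lam.length ≤ n, ∃ f : MvPolynomial (Fin n) CoeffRing,
      algebraMap (MvPolynomial (Fin n) CoeffRing) (RatFun n) f = factorialQRat lam n hn
  then h.choose_spec.choose else 0

/-- The factorial `Q`-function `Q_λ(x|a)`, the stable limit of the `Q_λ(x₁, …, x_n|a)`: the
coefficient of a monomial is read off with just enough variables to contain the monomial (more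
variables give the same, since `Q_λ(x₁, …, x_n, 0|a) = Q_λ(x₁, …, x_n|a)`). -/
def factorialQ (lam : StrictPartition) : Series :=
  fun d =>
    let n : ℕ := d.support.sup (fun i => i + 1)
    MvPolynomial.coeff (d.comapDomain (Fin.val : Fin n → ℕ) (Fin.val_injective.injOn))
      (factorialQPoly lam n)

/-- The substitution `a₁ = a₂ = … = 0` in the coefficients of a series. -/
def specializeZero : Series →+* Series :=
  MvPowerSeries.map (MvPolynomial.C.comp (MvPolynomial.constantCoeff (R := ℂ) (σ := ℕ+)))

/-- Schur's `Q`-function `Q_λ(x)`, that is `Q_λ(x|0)`. -/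
def schurQ (lam : StrictPartition) : Series := specializeZero (factorialQ lam)

/-- Schur's `P`-function `P_λ = 2^{-ℓ(λ)} Q_λ`. -/
def schurP (lam : StrictPartition) : Series := cst ((2 : ℂ)⁻¹ ^ lam.length) • schurQ lam

/-- `f = ∑_λ u_λ P_λ(y)`, a formal infinite sum taken coefficient by coefficient. (`P_λ` is
homogeneous of degree `|λ|`, so that only finitely many terms have a given monomial.) -/
def IsPExpansion (u : StrictPartition → CoeffRing) (f : Series) : Prop :=
  ∀ d : ℕ →₀ ℕ, MvPowerSeries.coeff d f =
    ∑ᶠ lam : StrictPartition, u lam * MvPowerSeries.coeff d (schurP lam)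

/-- `g = ∑_λ v_λ Q_λ(x)`, a finite sum. -/
def IsQExpansion (v : StrictPartition →₀ CoeffRing) (g : Series) : Prop :=
  g = v.sum fun lam c => c • schurQ lam

open Classical in
/-- The coefficients of `f ∈ \hat Γ(y|a)` with respect to the `P_λ(y)`. -/
def pCoeffs (f : Series) : StrictPartition → CoeffRing :=
  if h : ∃ u, IsPExpansion u f then h.choose else 0

open Classical in
/-- The coefficients of `g ∈ Γ(x|a)` with respect to the basis of the `Q_λ(x)`. -/
def qCoeffs (g : Series) : StrictPartition →₀ CoeffRing :=
  if h : ∃ v, IsQExpansion v g then h.choose else 0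

/-- The `ℂ[a]`-bilinear pairing `\hat Γ(y|a) × Γ(x|a) → ℂ[a]` with `⟨P_λ(y), Q_μ(x)⟩ = δ_{λμ}`:
`⟨∑ u_λ P_λ(y), ∑ v_λ Q_λ(x)⟩ = ∑ u_λ v_λ`. -/
def pairing (f g : Series) : CoeffRing :=
  (qCoeffs g).sum fun lam c => pCoeffs f lam * c

open Classical in
/-- The defining property of the dual factorial `P`-function `\hat P_λ(y|a)`: it lies in
`\hat Γ(y|a)` and `⟨\hat P_λ(y|a), Q_μ(x|a)⟩ = δ_{λμ}` for all strict partitions `μ`. -/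
def IsDualFactorialP (lam : StrictPartition) (f : Series) : Prop :=
  IsInGamHat f ∧ ∀ mu : StrictPartition, pairing f (factorialQ mu) = if lam = mu then 1 else 0

open Classical in
/-- The dual factorial `P`-function `\hat P_λ(y|a)`, the element with the property
`IsDualFactorialP`. -/
def dualFactorialP (lam : StrictPartition) : Series :=
  Classical.epsilon (IsDualFactorialP lam)

/-! ### The algebra of neutral fermions

The `ℂ[a]`-algebra generated by `φ_n`, `n ∈ ℤ`, with the relations
`φ_m φ_n + φ_n φ_m = 2 (-1)^m δ_{m+n,0}` is the Clifford algebra of the quadratic form on the free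
module with basis `ℤ` whose symmetric bilinear form is `(-1)^m δ_{m+n,0}`. -/

/-- The sign `(-1)^m`. -/
def sgn (m : ℤ) : CoeffRing := (-1) ^ m.natAbs

/-- The bilinear form with prescribed values on the basis. -/
def formOf (b : ℤ → ℤ → CoeffRing) : LinearMap.BilinForm CoeffRing (ℤ →₀ CoeffRing) :=
  Finsupp.linearCombination CoeffRing fun m => Finsupp.linearCombination CoeffRing (b m)

theorem formOf_single (b : ℤ → ℤ → CoeffRing) (m n : ℤ) :
    formOf b (Finsupp.single m 1) (Finsupp.single n 1) = b m n := by
  simp [formOf]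

/-- The symmetric form `(φ_m, φ_n) ↦ (-1)^m δ_{m+n,0}`. -/
def symForm : LinearMap.BilinForm CoeffRing (ℤ →₀ CoeffRing) :=
  formOf fun m n => if m + n = 0 then sgn m else 0

/-- The quadratic form of the neutral fermions. -/
def fermionForm : QuadraticForm CoeffRing (ℤ →₀ CoeffRing) :=
  LinearMap.BilinMap.toQuadraticMap symForm

/-- The algebra `𝒞` of neutral fermions. -/
abbrev Fermions : Type := CliffordAlgebra fermionForm

/-- The generator `φ_n`. -/
def phi (n : ℤ) : Fermions := CliffordAlgebra.ι fermionForm (Finsupp.single n 1)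

theorem sgn_neg (m : ℤ) : sgn (-m) = sgn m := by simp [sgn]

theorem phi_anticomm (m n : ℤ) :
    phi m * phi n + phi n * phi m =
      algebraMap CoeffRing Fermions (if m + n = 0 then 2 * sgn m else 0) := by
  unfold phi
  rw [CliffordAlgebra.ι_mul_ι_add_swap]
  congr 1
  rw [fermionForm, LinearMap.BilinMap.polar_toQuadraticMap, symForm, formOf_single, formOf_single]
  by_cases h : m + n = 0
  · obtain rfl : n = -m := by omega
    simp [sgn_neg, two_mul]
  · have h' : ¬ n + m = 0 := by omega
    simp [h, h']

/-! ### The vacuum expectation value on the algebra of fermions -/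

/-- The two-point function `⟨vac| φ_m φ_n |vac⟩`. -/
def twoPoint : LinearMap.BilinForm CoeffRing (ℤ →₀ CoeffRing) :=
  formOf fun m n => if m + n = 0 then (if m < 0 then 2 * sgn m else if m = 0 then 1 else 0) else 0

theorem twoPoint_add_flip : twoPoint + LinearMap.flip twoPoint = (2 : CoeffRing) • symForm := by
  refine Finsupp.lhom_ext' fun m => LinearMap.ext_ring ?_
  refine Finsupp.lhom_ext' fun n => LinearMap.ext_ring ?_
  simp only [LinearMap.comp_apply, Finsupp.lsingle_apply, LinearMap.add_apply,
    LinearMap.flip_apply, LinearMap.smul_apply, twoPoint, symForm, formOf_single]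
  by_cases h : m + n = 0
  · obtain rfl : n = -m := by omega
    rcases lt_trichotomy m 0 with hm | hm | hm
    · have h1 : ¬ 0 < m := by omega
      have h2 : m ≠ 0 := by omega
      simp [hm, h1, h2]
    · subst hm
      simp [sgn]
      norm_num
    · have h1 : ¬ m < 0 := by omega
      have h2 : m ≠ 0 := by omega
      simp [hm, h1, h2, sgn_neg]
  · have h' : ¬ n + m = 0 := by omega
    simp [h, h']

theorem twoPoint_toQuadraticMap :
    LinearMap.BilinMap.toQuadraticMap (-twoPoint) =
      (0 : QuadraticForm CoeffRing (ℤ →₀ CoeffRing)) - fermionForm := by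
  ext1 v
  have h := congrArg (fun B : LinearMap.BilinForm CoeffRing (ℤ →₀ CoeffRing) => B v v)
    twoPoint_add_flip
  simp only [LinearMap.add_apply, LinearMap.flip_apply, LinearMap.smul_apply,
    smul_eq_mul] at h
  rw [← two_mul] at h
  have h2 : twoPoint v v = symForm v v := mul_left_cancel₀ two_ne_zero h
  simp [fermionForm, h2]

/-- Normal ordering: the linear isomorphism of `𝒞` with the exterior algebra determined by
`φ_m x ↦ φ_m ∧ x + ⟨vac| φ_m · |vac⟩ ⌋ x`. -/
def normalOrder : Fermions →ₗ[CoeffRing]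
    CliffordAlgebra (0 : QuadraticForm CoeffRing (ℤ →₀ CoeffRing)) :=
  CliffordAlgebra.changeForm twoPoint_toQuadraticMap

/-- The vacuum expectation value `π : 𝒞 → ℂ[a]`, `x ↦ ⟨vac| x |vac⟩`: the component of degree `0`
of the normally ordered form of `x`. The next facts show that `π(1) = 1`, `π(φ₀) = 0`,
and `π(x φ_{-n}) = π(φ_n x) = 0` for `n > 0`; these properties determine `π`. -/
def vacExp : Fermions →ₗ[CoeffRing] CoeffRing :=
  (ExteriorAlgebra.algebraMapInv (R := CoeffRing) (M := ℤ →₀ CoeffRing)).toLinearMap ∘ₗ normalOrder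

theorem vacExp_one : vacExp 1 = 1 := by
  simp [vacExp, normalOrder]

theorem normalOrder_ι_mul (v : ℤ →₀ CoeffRing) (x : Fermions) :
    normalOrder (CliffordAlgebra.ι fermionForm v * x) =
      CliffordAlgebra.ι 0 v * normalOrder x +
        CliffordAlgebra.contractLeft (twoPoint v) (normalOrder x) := by
  rw [normalOrder, CliffordAlgebra.changeForm_ι_mul]
  simp

theorem algebraMapInv_ι_zero (v : ℤ →₀ CoeffRing) :
    ExteriorAlgebra.algebraMapInv (R := CoeffRing) (CliffordAlgebra.ι 0 v) = 0 := by
  change ExteriorAlgebra.algebraMapInv (ExteriorAlgebra.ι CoeffRing v) = 0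
  simp [ExteriorAlgebra.algebraMapInv]

theorem vacExp_phi (n : ℤ) : vacExp (phi n) = 0 := by
  simp only [vacExp, normalOrder, phi, LinearMap.comp_apply, CliffordAlgebra.changeForm_ι]
  exact algebraMapInv_ι_zero _

theorem vacExp_phi_mul {n : ℤ} (hn : 0 < n) (x : Fermions) : vacExp (phi n * x) = 0 := by
  have h : twoPoint (Finsupp.single n 1) = 0 := by
    refine Finsupp.lhom_ext' fun m => LinearMap.ext_ring ?_
    simp only [LinearMap.comp_apply, Finsupp.lsingle_apply, twoPoint, formOf_single]
    simp [not_lt.2 hn.le, hn.ne']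
  rw [vacExp, LinearMap.comp_apply, phi, normalOrder_ι_mul, h]
  simp only [map_zero, LinearMap.zero_apply, add_zero, AlgHom.toLinearMap_apply]
  erw [map_mul, algebraMapInv_ι_zero, zero_mul]

theorem contractLeft_mul_ι_of_eq_zero {Q : QuadraticForm CoeffRing (ℤ →₀ CoeffRing)}
    (d : Module.Dual CoeffRing (ℤ →₀ CoeffRing)) (w : ℤ →₀ CoeffRing) (h : d w = 0)
    (x : CliffordAlgebra Q) :
    CliffordAlgebra.contractLeft d (x * CliffordAlgebra.ι Q w) =
      CliffordAlgebra.contractLeft d x * CliffordAlgebra.ι Q w := by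
  induction x using CliffordAlgebra.left_induction with
  | algebraMap r =>
    rw [CliffordAlgebra.contractLeft_algebraMap_mul, CliffordAlgebra.contractLeft_ι, h,
      CliffordAlgebra.contractLeft_algebraMap]
    simp
  | add x y hx hy => simp only [add_mul, map_add, hx, hy]
  | ι_mul x m hx =>
    rw [mul_assoc, CliffordAlgebra.contractLeft_ι_mul, hx, CliffordAlgebra.contractLeft_ι_mul,
      sub_mul, smul_mul_assoc, mul_assoc]

theorem normalOrder_mul_ι (w : ℤ →₀ CoeffRing) (h : ∀ v, twoPoint v w = 0) (x : Fermions) :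
    normalOrder (x * CliffordAlgebra.ι fermionForm w) =
      normalOrder x * CliffordAlgebra.ι 0 w := by
  induction x using CliffordAlgebra.left_induction with
  | algebraMap r =>
    rw [← Algebra.smul_def, map_smul]
    simp only [normalOrder, CliffordAlgebra.changeForm_ι, CliffordAlgebra.changeForm_algebraMap]
    rw [Algebra.smul_def]
  | add x y hx hy => simp only [add_mul, map_add, hx, hy]
  | ι_mul x m hx =>
    rw [mul_assoc, normalOrder_ι_mul, hx, normalOrder_ι_mul,
      contractLeft_mul_ι_of_eq_zero _ _ (h m), add_mul, mul_assoc]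

theorem vacExp_mul_phi {n : ℤ} (hn : n < 0) (x : Fermions) : vacExp (x * phi n) = 0 := by
  have h : ∀ v, twoPoint v (Finsupp.single n 1) = 0 := by
    intro v
    have : LinearMap.flip twoPoint (Finsupp.single n 1) = 0 := by
      refine Finsupp.lhom_ext' fun m => LinearMap.ext_ring ?_
      simp only [LinearMap.comp_apply, Finsupp.lsingle_apply, LinearMap.flip_apply, twoPoint,
        formOf_single, LinearMap.zero_apply]
      split_ifs <;> first | rfl | omega
    simpa using congrArg (fun l => l v) this
  rw [vacExp, LinearMap.comp_apply, phi, normalOrder_mul_ι _ h]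
  simp only [AlgHom.toLinearMap_apply]
  erw [map_mul, algebraMapInv_ι_zero, mul_zero]

/-! ### The Fock space -/

/-- The left ideal `∑_{n ≥ 1} 𝒞 φ_{-n}`. -/
def vacIdeal : Ideal Fermions := Ideal.span (Set.range fun n : ℕ => phi (-((n : ℤ) + 1)))

/-- The Fock space `ℱ = 𝒞 / ∑_{n ≥ 1} 𝒞 φ_{-n}`, a left `𝒞`-module. -/
def Fock : Type := Fermions ⧸ vacIdeal

instance : AddCommGroup Fock := inferInstanceAs (AddCommGroup (Fermions ⧸ vacIdeal))

instance : Module Fermions Fock := inferInstanceAs (Module Fermions (Fermions ⧸ vacIdeal))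

instance : Module CoeffRing Fock := inferInstanceAs (Module CoeffRing (Fermions ⧸ vacIdeal))

instance : IsScalarTower CoeffRing Fermions Fock :=
  inferInstanceAs (IsScalarTower CoeffRing Fermions (Fermions ⧸ vacIdeal))

/-- The quotient map `𝒞 → ℱ`. -/
def toFock : Fermions →ₗ[Fermions] Fock := vacIdeal.mkQ

/-- The vacuum vector `|vac⟩`. -/
def vac : Fock := toFock 1

theorem toFock_eq (x : Fermions) : toFock x = x • vac := by
  rw [vac, ← map_smul, smul_eq_mul, mul_one]

theorem vacExp_eq_zero_of_mem {x : Fermions} (hx : x ∈ vacIdeal) : vacExp x = 0 := by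
  suffices h : ∀ y, vacExp (y * x) = 0 by simpa using h 1
  induction hx using Submodule.span_induction with
  | mem x hx =>
    obtain ⟨n, rfl⟩ := hx
    exact vacExp_mul_phi (by omega)
  | zero => simp
  | add x y _ _ hx hy => intro z; rw [mul_add, map_add, hx, hy, add_zero]
  | smul c x _ hx => intro z; rw [smul_eq_mul, ← mul_assoc]; exact hx _

/-- The functional `⟨vac|` on the Fock space, `x |vac⟩ ↦ ⟨vac| x |vac⟩`. -/
def vacBra : Fock →ₗ[CoeffRing] CoeffRing :=
  (((vacIdeal.restrictScalars CoeffRing).liftQ vacExp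
      (fun _ hx => LinearMap.mem_ker.2 (vacExp_eq_zero_of_mem hx)) ∘ₗ
    (Submodule.Quotient.restrictScalarsEquiv CoeffRing vacIdeal).symm.toLinearMap :
      (Fermions ⧸ vacIdeal) →ₗ[CoeffRing] CoeffRing) :)

theorem vacBra_smul_vac (x : Fermions) : vacBra (x • vac) = vacExp x := by
  rw [← toFock_eq]
  rfl

/-- Spanning vectors: every vector of the Fock space is `x |vac⟩`. -/
theorem exists_smul_vac (v : Fock) : ∃ x : Fermions, x • vac = v := by
  obtain ⟨x, rfl⟩ := Submodule.Quotient.mk_surjective _ v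
  exact ⟨x, (toFock_eq x).symm⟩

theorem phi_smul_vac {n : ℤ} (hn : n < 0) : phi n • vac = 0 := by
  rw [← toFock_eq]
  refine (Submodule.Quotient.mk_eq_zero vacIdeal).2 (Submodule.subset_span ⟨(-n - 1).toNat, ?_⟩)
  dsimp only
  congr 1
  omega

/-- The action of `φ_n` on the Fock space. -/
def phiOp (n : ℤ) : Fock →ₗ[CoeffRing] Fock := Algebra.lsmul CoeffRing CoeffRing Fock (phi n)

theorem phiOp_apply (n : ℤ) (v : Fock) : phiOp n v = phi n • v := rfl

theorem phiOp_anticomm (m n : ℤ) (v : Fock) :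
    phiOp m (phiOp n v) + phiOp n (phiOp m v) = (if m + n = 0 then 2 * sgn m else 0) • v := by
  simp only [phiOp_apply, smul_smul, ← add_smul, phi_anticomm, algebraMap_smul]

/-- Induction on words in the `φ_n` applied to the vacuum. -/
theorem fock_induction {P : Fock → Prop} (hvac : P vac) (hadd : ∀ v w, P v → P w → P (v + w))
    (hsmul : ∀ (c : CoeffRing) v, P v → P (c • v)) (hphi : ∀ n v, P v → P (phiOp n v))
    (v : Fock) : P v := by
  obtain ⟨x, rfl⟩ := exists_smul_vac v
  induction x using CliffordAlgebra.left_induction with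
  | algebraMap r => rw [algebraMap_smul]; exact hsmul _ _ hvac
  | add x y hx hy => rw [add_smul]; exact hadd _ _ hx hy
  | ι_mul x m hx =>
    rw [← smul_smul]
    generalize x • vac = w at hx
    induction m using Finsupp.induction_linear with
    | zero => rw [map_zero, zero_smul]; simpa using hsmul 0 _ hx
    | add f g hf hg => rw [map_add, add_smul]; exact hadd _ _ hf hg
    | single n r =>
      have : Finsupp.single n r = r • Finsupp.single n (1 : CoeffRing) := by simp
      rw [this, map_smul, smul_assoc]
      exact hsmul _ _ (hphi n _ hx)

theorem phiOp_locally_zero (v : Fock) : ∃ N : ℤ, ∀ n < N, phiOp n v = 0 := by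
  induction v using fock_induction with
  | hvac => exact ⟨0, fun n hn => phi_smul_vac hn⟩
  | hadd v w hv hw =>
    obtain ⟨N, hN⟩ := hv
    obtain ⟨M, hM⟩ := hw
    refine ⟨min N M, fun n hn => ?_⟩
    rw [map_add, hN n (by omega), hM n (by omega), add_zero]
  | hsmul c v hv =>
    obtain ⟨N, hN⟩ := hv
    exact ⟨N, fun n hn => by rw [map_smul, hN n hn, smul_zero]⟩
  | hphi m v hv =>
    obtain ⟨N, hN⟩ := hv
    refine ⟨min N (-m), fun n hn => ?_⟩
    have h := phiOp_anticomm n m v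
    rw [hN n (by omega), map_zero, add_zero, if_neg (by omega), zero_smul] at h
    exact h

/-! ### The Hamiltonian -/

theorem hamTerm_finite (m : ℤ) (hm : m ≠ 0) (v : Fock) :
    (Function.support fun i : ℤ => sgn i • phiOp (-i - m) (phiOp i v)).Finite := by
  obtain ⟨N, hN⟩ := phiOp_locally_zero v
  refine (Set.finite_Icc N (-m - N)).subset fun i hi => ?_
  by_contra hcon
  refine hi ?_
  rw [Set.mem_Icc, not_and_or] at hcon
  rcases hcon with h | h
  · simp [hN i (by omega)]
  · have h1 := phiOp_anticomm (-i - m) i v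
    rw [hN (-i - m) (by omega), map_zero, add_zero, if_neg (by omega), zero_smul] at h1
    simp [h1]

/-- `H_m = 1/4 ∑_{i ∈ ℤ} (-1)^i φ_{-i-m} φ_i` for `m = 2 k + 1`, an operator on the Fock space;
the sum is finite on each vector. -/
def hamMode (k : ℕ) : Fock →ₗ[CoeffRing] Fock where
  toFun v := cst (1 / 4) •
    ∑ᶠ i : ℤ, sgn i • phiOp (-i - (2 * (k : ℤ) + 1)) (phiOp i v)
  map_add' v w := by
    rw [← smul_add, ← finsum_add_distrib (hamTerm_finite _ (by omega) v)
      (hamTerm_finite _ (by omega) w)]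
    simp only [map_add, smul_add]
  map_smul' c v := by
    rw [RingHom.id_apply, smul_comm c, smul_finsum' c (hamTerm_finite _ (by omega) v)]
    simp only [map_smul, smul_comm c]

/-- The Fock space with coefficients extended to power series in `x₁, x₂, …` over `ℂ[a]`. -/
abbrev FockX : Type := Series ⊗[CoeffRing] Fock

/-- The Hamiltonian `H(x) = 2 ∑_{m odd} p_m(x)/m H_m`; the sum is finite on each vector. -/
def hamiltonian (z : FockX) : FockX :=
  ∑ᶠ k : ℕ, (cst (2 / (2 * (k : ℂ) + 1)) • powerSum (2 * k + 1)) •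
    LinearMap.baseChange Series (hamMode k) z

/-- The exponential `e^{H(x)} = ∑_k H(x)^k / k!`; the sum is finite on each vector. -/
def expHamiltonian (z : FockX) : FockX :=
  ∑ᶠ k : ℕ, cst ((k.factorial : ℂ)⁻¹) • (hamiltonian^[k] z)

/-- `⟨vac| e^{H(x)} |v⟩`, for a vector `v` of the Fock space. -/
def vev (v : Fock) : Series :=
  TensorProduct.rid CoeffRing Series (LinearMap.lTensor Series vacBra (expHamiltonian (1 ⊗ₜ v)))

/-! ### Deformed fermions -/

/-- The deformed fermion
`φ^{(a)}_j = ∑_{i=0}^{j-1} (-1)^i e_i(a₁, …, a_{j-1}) φ_{j-i}` for `j > 0`, and `φ^{(a)}_0 = φ_0`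
(the sum `∑_{i ≥ 0} h_i() φ_{-i}`, with `h_i() = δ_{i,0}`), as an operator on the Fock space. -/
def phiA (j : ℕ) : Fock →ₗ[CoeffRing] Fock :=
  if j = 0 then phiOp 0
  else ∑ i ∈ Finset.range j, ((-1) ^ i * elem (j - 1) i) • phiOp ((j : ℤ) - (i : ℤ))

/-- The vector `|λ⟩_C = φ^{(a)}_{λ₁} ⋯ φ^{(a)}_{λ_{r'}} |vac⟩`. -/
def ketC (lam : StrictPartition) : Fock := lam.evenParts.foldr (fun j v => phiA j v) vac

/-- The homogeneous part of degree `d` of the Fock space, spanned by the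
`φ_{i_1} ⋯ φ_{i_p} |vac⟩` with `i_1 + ⋯ + i_p = d`. -/
def fockDeg (d : ℤ) : Submodule CoeffRing Fock :=
  Submodule.span CoeffRing {v | ∃ l : List ℤ, l.sum = d ∧ v = l.foldr (fun n w => phiOp n w) vac}

theorem phiOp_mem_fockDeg {d : ℤ} (n : ℤ) {v : Fock} (hv : v ∈ fockDeg d) :
    phiOp n v ∈ fockDeg (n + d) := by
  induction hv using Submodule.span_induction with
  | mem v hv =>
    obtain ⟨l, hl, rfl⟩ := hv
    exact Submodule.subset_span ⟨n :: l, by simp [hl], rfl⟩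
  | zero => simp
  | add v w _ _ hv hw => rw [map_add]; exact add_mem hv hw
  | smul c v _ hv => rw [map_smul]; exact Submodule.smul_mem _ _ hv

theorem vac_mem_fockDeg : vac ∈ fockDeg 0 := Submodule.subset_span ⟨[], rfl, rfl⟩

/-- The completed Fock space: formal sums `∑_{d ≥ 0} v_d`, with `v_d` in the Fock space homogeneous
of degree `d`. -/
def FockHat : Submodule CoeffRing (ℕ → Fock) where
  carrier := {v | ∀ d : ℕ, v d ∈ fockDeg d}
  add_mem' hv hw d := add_mem (hv d) (hw d)
  zero_mem' _ := Submodule.zero_mem _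
  smul_mem' c _ hv d := Submodule.smul_mem _ c (hv d)

/-- The vacuum vector in the completed Fock space. -/
def vacHat : FockHat :=
  ⟨Pi.single 0 vac, fun d => by
    rcases Nat.eq_zero_or_pos d with rfl | hd
    · simpa using vac_mem_fockDeg
    · rw [Pi.single_eq_of_ne hd.ne']; exact Submodule.zero_mem _⟩

/-- The deformed fermion `\hat φ^{(a)}_j = ∑_{i ≥ 0} h_i(a₁, …, a_j) φ_{j+i}` for `j ≥ 0`, as an
operator on the completed Fock space: since `φ_n` has degree `n`, the component of degree `d` of
`\hat φ^{(a)}_j v` is `∑_{j + i + e = d} h_i(a₁, …, a_j) φ_{j+i} v_e`. -/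
def phiHat (j : ℕ) (v : FockHat) : FockHat :=
  ⟨fun d => if j ≤ d then
      ∑ p ∈ Finset.HasAntidiagonal.antidiagonal (d - j), homog j p.1 • phiOp ((j : ℤ) + (p.1 : ℤ)) (v.1 p.2)
    else 0, fun d => by
    dsimp only
    split_ifs with h
    · refine Submodule.sum_mem _ fun p hp => Submodule.smul_mem _ _ ?_
      rw [Finset.HasAntidiagonal.mem_antidiagonal] at hp
      have := phiOp_mem_fockDeg ((j : ℤ) + (p.1 : ℤ)) (v.2 p.2)
      rwa [show (j : ℤ) + (p.1 : ℤ) + (p.2 : ℤ) = (d : ℤ) by omega] at this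
    · exact Submodule.zero_mem _⟩

/-- The vector `|λ⟩_H = \hat φ^{(a)}_{λ₁} ⋯ \hat φ^{(a)}_{λ_{r'}} |vac⟩`. -/
def ketH (lam : StrictPartition) : FockHat := lam.evenParts.foldr (fun j v => phiHat j v) vacHat

/-- `⟨vac| e^{H(y)} |v⟩ = ∑_d ⟨vac| e^{H(y)} |v_d⟩` for `v = ∑_d v_d` in the completed Fock space:
the `d`-th term is homogeneous of degree `d` in `y`, and the sum is taken coefficient by
coefficient. -/
def vevHat (v : FockHat) : Series :=
  fun n => ∑ᶠ d : ℕ, MvPowerSeries.coeff n (vev (v.1 d))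

end NeutralFermion

end

open NeutralFermion

noncomputable section

namespace NeutralFermion

/-! Both formulas are computations in the Fock space.

The vertex relation. For odd m one has [H_m, φ_n] = φ_{n-m}, so e^H φ(t) = q(t) φ(t) e^H with q(t) =
exp(2 ∑ p_m t^m / m) (`current_phiOp`, `expHamK_phiK`). Since e^H fixes the vacuum, this relation
determines e^H, and its additivity in the power sums, its naturality and its grading follow by
induction on words. Coefficients lie in an arbitrary ℂ[a]-algebra K, so that series, polynomials and
rational functions are handled by the same operators and compared through `map_vevK`.

The Q-functions. In finitely many distinct variables q(t) = ∏ (1 + x_i t)/(1 - x_i t) is a constant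
plus a combination of geometric series (`qSeries_psums`). Let ψ be a functional that kills the image
of every φ_n with n > 0. Then ψ sees only the geometric series, and ψ (∑ x^i φ_{-i}) e^{H(x)} = ψ
φ_0 removes one variable (`apply_act_geom_expHamK`). Hence for m > 0 the functional ψ e^{H(X)} φ_m
is the sum over k in X of 2 x_k^m ∏_{l ≠ k} (x_k + x_l)/(x_k - x_l) times ψ φ_0 e^{H(X ∖ k)}. The
coefficients of φ^{(a)}_j are those of the factorial power, which therefore replaces 2 x_k^m. As ψ
φ_0 again kills the positive modes, iteration gives a sum over injective choices of variables, which
is the defining symmetrization. The letters φ_0 left over cancel in pairs, thanks to the zero part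
added when ℓ(λ) is odd.

The duality. At a = 0 this says that Q_λ is ⟨vac| e^H applied to a strictly decreasing word. Such
words of even length are orthogonal, of norm 2^{ℓ(λ)}, for the form with φ_n^* = (-1)^n φ_{-n}, so
the coefficients in the P_ν are values of this form (`isPExpansion_vevHat`). The adjoint of `phiHat
j` and `phiA k` have anticommutator 2 δ_{jk} unless j = k = 0: for j < k the quotient of ∏_{t<k} (1
- a_t z) by ∏_{t≤j} (1 - a_t z) is a polynomial of degree k - 1 - j, without a term in z^{k-j}.
Hence |λ⟩_H and |μ⟩_C pair to 2^{ℓ(λ)} δ_{λμ} (`formHat_ketH_ketC`).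

The coefficients are well defined because the Q_λ form a basis. They span since multiplication by
p_m is the action of H_{-m} on the Fock space (`vevK_current_neg`), and they are independent since
in ℓ(λ) variables they become alternants times a common factor (`linearIndependent_schurQ`).
Uniqueness of the dual function holds because Q_μ(x|a) is Q_μ plus terms of lower degree. -/

/-! ### Words in the fermions -/

/-- The vector `φ_{n₁} ⋯ φ_{n_p} |vac⟩` of the Fock space. -/
def word (l : List ℤ) : Fock := l.foldr (fun n w => phiOp n w) vac

theorem word_nil : word [] = vac := rfl

theorem word_cons (n : ℤ) (l : List ℤ) : word (n :: l) = phiOp n (word l) := rfl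

theorem phiOp_vac {n : ℤ} (hn : n < 0) : phiOp n vac = 0 := phi_smul_vac hn

theorem vacBra_vac : vacBra vac = 1 := by
  have := vacBra_smul_vac 1
  rwa [one_smul, vacExp_one] at this

theorem vacBra_phiOp {n : ℤ} (hn : 0 < n) (v : Fock) : vacBra (phiOp n v) = 0 := by
  obtain ⟨x, rfl⟩ := exists_smul_vac v
  rw [phiOp_apply, smul_smul, vacBra_smul_vac, vacExp_phi_mul hn]

theorem vacBra_phiOp_vac (n : ℤ) : vacBra (phiOp n vac) = 0 := by
  rw [phiOp_apply, vacBra_smul_vac, vacExp_phi]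

theorem sgn_eq_ite (m : ℤ) : sgn m = if Even m then 1 else -1 := by
  unfold sgn
  split_ifs with h
  · exact Even.neg_one_pow (Int.natAbs_even.2 h)
  · exact Odd.neg_one_pow (Int.natAbs_odd.2 (Int.not_even_iff_odd.1 h))

theorem sgn_add (m n : ℤ) : sgn (m + n) = sgn m * sgn n := by
  simp only [sgn_eq_ite, Int.even_add]
  split_ifs <;> simp_all

theorem sgn_mul_self (m : ℤ) : sgn m * sgn m = 1 := by
  rw [sgn_eq_ite]
  split_ifs <;> simp

theorem sgn_odd {m : ℤ} (hm : Odd m) : sgn m = -1 := by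
  rw [sgn_eq_ite, if_neg (Int.not_even_iff_odd.2 hm)]

/-- Integrality of the scalars produced by reordering letters lets normal ordering take place in an
additive group, with no coefficients from ℂ[a]. This is what later shows that ⟨vac| e^H |word⟩ does
not involve the parameters. -/
theorem exists_sgn_eq_intCast (m : ℤ) : ∃ s : ℤ, sgn m = (s : CoeffRing) := by
  rw [sgn_eq_ite]
  split_ifs
  · exact ⟨1, by simp⟩
  · exact ⟨-1, by simp⟩

theorem cst_half_mul_two : cst (1 / 2) * 2 = 1 := by
  have : (2 : CoeffRing) = cst 2 := (map_ofNat MvPolynomial.C _).symm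
  rw [this, ← map_mul]
  norm_num

theorem eq_of_add_self_eq {M : Type*} [AddCommGroup M] [Module CoeffRing M] {v w : M}
    (h : v + v = (2 : CoeffRing) • w) : v = w := by
  have := congrArg (fun z => cst (1 / 2) • z) h
  simpa only [← two_smul CoeffRing v, smul_smul, cst_half_mul_two, one_smul] using this

theorem phiOp_phiOp_self {n : ℤ} (hn : n ≠ 0) (v : Fock) : phiOp n (phiOp n v) = 0 := by
  have h := phiOp_anticomm n n v
  rw [if_neg (by omega), zero_smul] at h
  exact eq_of_add_self_eq (by rw [h, smul_zero])

theorem phiOp_zero_phiOp_zero (v : Fock) : phiOp 0 (phiOp 0 v) = v := by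
  have h := phiOp_anticomm 0 0 v
  exact eq_of_add_self_eq (by simpa [sgn] using h)

theorem phiOp_swap {m n : ℤ} (h : m + n ≠ 0) (v : Fock) :
    phiOp m (phiOp n v) = -phiOp n (phiOp m v) := by
  have := phiOp_anticomm m n v
  rw [if_neg h, zero_smul] at this
  exact eq_neg_of_add_eq_zero_left this

/-- The additive group generated by the normally ordered words with letters in `[0, M)`, of
degree `d`, and with number of letters of the parity of `p`. -/
def normalWords (M d : ℤ) (p : ℕ) : AddSubgroup Fock :=
  AddSubgroup.closure {v | ∃ l : List ℤ, l.Pairwise (· > ·) ∧ (∀ k ∈ l, 0 ≤ k ∧ k < M) ∧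
    l.sum = d ∧ l.length % 2 = p % 2 ∧ v = word l}

theorem word_mem_normalWords {M : ℤ} {l : List ℤ} (h : l.Pairwise (· > ·))
    (hM : ∀ k ∈ l, 0 ≤ k ∧ k < M) {d : ℤ} (hd : l.sum = d) {p : ℕ} (hp : l.length % 2 = p % 2) :
    word l ∈ normalWords M d p :=
  AddSubgroup.subset_closure ⟨l, h, hM, hd, hp, rfl⟩

theorem phiOp_mem_normalWords_of_lt {m M d : ℤ} {p : ℕ} (hm : 0 ≤ m) (hM : m < M) {v : Fock}
    (hv : v ∈ normalWords m d p) : phiOp m v ∈ normalWords M (m + d) (p + 1) := by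
  induction hv using AddSubgroup.closure_induction with
  | mem v hv =>
    obtain ⟨l, h, hl, hd, hp, rfl⟩ := hv
    rw [← word_cons]
    refine word_mem_normalWords (List.pairwise_cons.2 ⟨fun k hk => (hl k hk).2, h⟩) ?_ (by simp [hd])
      (by rw [List.length_cons]; omega)
    intro k hk
    rcases List.mem_cons.1 hk with rfl | hk
    · exact ⟨hm, hM⟩
    · exact ⟨(hl k hk).1, (hl k hk).2.trans hM⟩
  | zero => rw [map_zero]; exact zero_mem _
  | add v w _ _ hv hw => rw [map_add]; exact add_mem hv hw
  | neg v _ hv => rw [map_neg]; exact neg_mem hv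

/-- Insertion of a letter into a sorted word: it moves right past the larger letters, each exchange
changing the sign and possibly leaving a contraction, which is a word with two letters fewer. Degree
and parity are kept. -/
theorem phiOp_word_mem_normalWords (l : List ℤ) : ∀ (n M : ℤ), l.Pairwise (· > ·) →
    (∀ k ∈ l, 0 ≤ k ∧ k < M) → n < M →
      phiOp n (word l) ∈ normalWords M (n + l.sum) (l.length + 1) := by
  induction l with
  | nil =>
    intro n M _ _ hn
    rcases lt_or_ge n 0 with h | h
    · rw [word_nil, phiOp_vac h]; exact zero_mem _
    · rw [← word_cons]
      exact word_mem_normalWords (by simp) (by simpa using ⟨h, hn⟩) (by simp) (by simp)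
  | cons m l ih =>
    intro n M hl hM hn
    have hl' := List.pairwise_cons.1 hl
    have hm := hM m (by simp)
    rcases lt_trichotomy n m with h | rfl | h
    · have hz : phiOp n (word (m :: l)) =
          (if n + m = 0 then 2 * sgn n else 0 : CoeffRing) • word l -
            phiOp m (phiOp n (word l)) := by
        rw [word_cons, ← phiOp_anticomm, add_sub_cancel_right]
      rw [hz]
      refine sub_mem ?_ ?_
      · split_ifs with h0
        · obtain ⟨s, hs⟩ := exists_sgn_eq_intCast n
          have : (2 * sgn n : CoeffRing) = ((2 * s : ℤ) : CoeffRing) := by rw [hs]; push_cast; rfl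
          rw [this, Int.cast_smul_eq_zsmul]
          refine zsmul_mem (word_mem_normalWords hl'.2 (fun k hk => hM k (by simp [hk])) ?_ ?_) _
          · rw [List.sum_cons]; omega
          · rw [List.length_cons]; omega
        · rw [zero_smul]; exact zero_mem _
      -- The induction hypothesis is used with the bound m instead of M: its words have all letters
      -- below m, so φ_m can be put in front of them.
      · have := phiOp_mem_normalWords_of_lt (M := M) hm.1 hm.2
          (ih n m hl'.2 (fun k hk => ⟨(hM k (by simp [hk])).1, hl'.1 k hk⟩) h)
        rwa [show m + (n + l.sum) = n + (m :: l).sum by rw [List.sum_cons]; ring] at this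
    · rw [word_cons]
      by_cases h0 : n = 0
      · subst h0
        rw [phiOp_zero_phiOp_zero]
        exact word_mem_normalWords hl'.2 (fun k hk => hM k (by simp [hk])) (by simp)
          (by rw [List.length_cons]; omega)
      · rw [phiOp_phiOp_self h0]; exact zero_mem _
    · rw [← word_cons]
      refine word_mem_normalWords (List.pairwise_cons.2 ⟨?_, hl⟩) ?_ (by simp) (by simp)
      · intro k hk
        rcases List.mem_cons.1 hk with rfl | hk
        · exact h
        · exact (hl'.1 k hk).trans h
      · intro k hk
        rcases List.mem_cons.1 hk with rfl | hk
        · exact ⟨hm.1.trans h.le, hn⟩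
        · exact hM k hk

theorem phiOp_mem_normalWords {n M M' d : ℤ} {p : ℕ} (hM : M ≤ M') (hn : n < M') {v : Fock}
    (hv : v ∈ normalWords M d p) : phiOp n v ∈ normalWords M' (n + d) (p + 1) := by
  induction hv using AddSubgroup.closure_induction with
  | mem v hv =>
    obtain ⟨l, h, hl, rfl, hp, rfl⟩ := hv
    have := phiOp_word_mem_normalWords l n M' h
      (fun k hk => ⟨(hl k hk).1, (hl k hk).2.trans_le hM⟩) hn
    have e : normalWords M' (n + l.sum) (l.length + 1) = normalWords M' (n + l.sum) (p + 1) := by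
      unfold normalWords
      rw [show (l.length + 1) % 2 = (p + 1) % 2 by omega]
    rwa [e] at this
  | zero => rw [map_zero]; exact zero_mem _
  | add v w _ _ hv hw => rw [map_add]; exact add_mem hv hw
  | neg v _ hv => rw [map_neg]; exact neg_mem hv

/-- Every word is a combination of normally ordered words. -/
theorem exists_word_mem_normalWords (l : List ℤ) : ∃ M, word l ∈ normalWords M l.sum l.length := by
  induction l with
  | nil => exact ⟨0, word_mem_normalWords (by simp) (by simp) rfl rfl⟩
  | cons n l ih =>
    obtain ⟨M, hM⟩ := ih
    exact ⟨max M (n + 1), by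
      simpa [word_cons] using phiOp_mem_normalWords (n := n) (le_max_left M (n + 1)) (by omega) hM⟩

/-- A nonempty strict word with letters ≥ 0 is φ_0 |vac⟩ or starts with a positive letter, which
⟨vac| kills. -/
theorem vacBra_word_of_strict {l : List ℤ} (h : l.Pairwise (· > ·)) (h0 : ∀ k ∈ l, 0 ≤ k) :
    vacBra (word l) = if l = [] then 1 else 0 := by
  cases l with
  | nil => rw [if_pos rfl]; exact vacBra_vac
  | cons n l =>
    rw [if_neg (by simp), word_cons]
    rcases (h0 n (by simp)).lt_or_eq with hn | rfl
    · exact vacBra_phiOp hn _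
    · have : l = [] := List.eq_nil_iff_forall_not_mem.2 fun k hk => by
        have h1 := (List.pairwise_cons.1 h).1 k hk
        have h2 := h0 k (by simp [hk])
        omega
      subst this
      exact vacBra_phiOp_vac 0

theorem vacBra_of_mem_normalWords {M d : ℤ} {p : ℕ} {v : Fock} (hv : v ∈ normalWords M d p) :
    (∃ s : ℤ, vacBra v = s) ∧ (¬ (d = 0 ∧ p % 2 = 0) → vacBra v = 0) := by
  induction hv using AddSubgroup.closure_induction with
  | mem v hv =>
    obtain ⟨l, h, hl, rfl, hp, rfl⟩ := hv
    rw [vacBra_word_of_strict h fun k hk => (hl k hk).1]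
    refine ⟨?_, fun hn => if_neg ?_⟩
    · split_ifs
      · exact ⟨1, by simp⟩
      · exact ⟨0, by simp⟩
    · rintro rfl
      exact hn ⟨rfl, hp.symm⟩
  | zero => exact ⟨⟨0, by simp⟩, fun _ => by simp⟩
  | add v w _ _ hv hw =>
    obtain ⟨⟨s, hs⟩, h1⟩ := hv
    obtain ⟨⟨t, ht⟩, h2⟩ := hw
    exact ⟨⟨s + t, by rw [map_add, hs, ht]; push_cast; rfl⟩,
      fun h => by rw [map_add, h1 h, h2 h, add_zero]⟩
  | neg v _ hv =>
    obtain ⟨⟨s, hs⟩, h1⟩ := hv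
    exact ⟨⟨-s, by rw [map_neg, hs]; push_cast; rfl⟩, fun h => by rw [map_neg, h1 h, neg_zero]⟩

theorem exists_vacBra_word_eq_intCast (l : List ℤ) : ∃ s : ℤ, vacBra (word l) = s :=
  let ⟨_, h⟩ := exists_word_mem_normalWords l
  (vacBra_of_mem_normalWords h).1

theorem vacBra_word_eq_zero {l : List ℤ} (h : ¬ (l.sum = 0 ∧ l.length % 2 = 0)) :
    vacBra (word l) = 0 :=
  let ⟨_, hM⟩ := exists_word_mem_normalWords l
  (vacBra_of_mem_normalWords hM).2 h

theorem span_word_eq_top : Submodule.span CoeffRing (Set.range word) = ⊤ := by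
  refine Submodule.eq_top_iff'.2 fun v => ?_
  induction v using fock_induction with
  | hvac => exact Submodule.subset_span ⟨[], rfl⟩
  | hadd v w hv hw => exact add_mem hv hw
  | hsmul c v hv => exact Submodule.smul_mem _ _ hv
  | hphi n v hv =>
    induction hv using Submodule.span_induction with
    | mem v hv =>
      obtain ⟨l, rfl⟩ := hv
      exact Submodule.subset_span ⟨n :: l, rfl⟩
    | zero => simp
    | add v w _ _ hv hw => rw [map_add]; exact add_mem hv hw
    | smul c v _ hv => rw [map_smul]; exact Submodule.smul_mem _ _ hv

/-- Induction on the normally ordered words. -/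
theorem fock_induction_normal {P : Fock → Prop} (hadd : ∀ v w, P v → P w → P (v + w))
    (hsmul : ∀ (c : CoeffRing) v, P v → P (c • v)) (hvac : P vac) (hzero : P (phiOp 0 vac))
    (hphi : ∀ n v, 0 < n → P (phiOp n v)) (v : Fock) : P v := by
  have hv : v ∈ Submodule.span CoeffRing (Set.range word) := by
    rw [span_word_eq_top]; trivial
  have h0 : P 0 := by simpa using hsmul 0 _ hvac
  induction hv using Submodule.span_induction with
  | mem v hv =>
    obtain ⟨l, rfl⟩ := hv
    obtain ⟨M, hM⟩ := exists_word_mem_normalWords l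
    generalize word l = w at hM
    induction hM using AddSubgroup.closure_induction with
    | mem v hv =>
      obtain ⟨l, h, hl, -, -, rfl⟩ := hv
      cases l with
      | nil => exact hvac
      | cons n l =>
        rcases (hl n (by simp)).1.lt_or_eq with hn | rfl
        · exact hphi _ _ hn
        · have : l = [] := List.eq_nil_iff_forall_not_mem.2 fun k hk => by
            have h1 := (List.pairwise_cons.1 h).1 k hk
            have h2 := (hl k (by simp [hk])).1
            omega
          subst this
          exact hzero
    | zero => exact h0
    | add v w _ _ hv hw => exact hadd _ _ hv hw
    | neg v _ hv => simpa using hsmul (-1) _ hv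
  | zero => exact h0
  | add v w _ _ hv hw => exact hadd _ _ hv hw
  | smul c v _ hv => exact hsmul _ _ hv

/-! ### The current modes -/

/-- The mode `1/4 ∑_{i ∈ ℤ} (-1)^i φ_{-i-m} φ_i`, for any `m ≠ 0`. -/
def current (m : ℤ) (hm : m ≠ 0) : Fock →ₗ[CoeffRing] Fock where
  toFun v := cst (1 / 4) • ∑ᶠ i : ℤ, sgn i • phiOp (-i - m) (phiOp i v)
  map_add' v w := by
    rw [← smul_add, ← finsum_add_distrib (hamTerm_finite _ hm v) (hamTerm_finite _ hm w)]
    simp only [map_add, smul_add]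
  map_smul' c v := by
    rw [RingHom.id_apply, smul_comm c, smul_finsum' c (hamTerm_finite _ hm v)]
    simp only [map_smul, smul_comm c]

theorem current_apply (m : ℤ) (hm : m ≠ 0) (v : Fock) :
    current m hm v = cst (1 / 4) • ∑ᶠ i : ℤ, sgn i • phiOp (-i - m) (phiOp i v) := rfl

theorem cst_quarter_mul_four : cst (1 / 4) * 4 = 1 := by
  have : (4 : CoeffRing) = cst 4 := (map_ofNat MvPolynomial.C _).symm
  rw [this, ← map_mul]
  norm_num

theorem phiOp_phiOp_eq (m n : ℤ) (v : Fock) : phiOp m (phiOp n v) =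
    (if m + n = 0 then 2 * sgn m else 0 : CoeffRing) • v - phiOp n (phiOp m v) := by
  rw [← phiOp_anticomm, add_sub_cancel_right]

/-- `[H_m, φ_n] = φ_{n-m}`. -/
theorem current_phiOp {m : ℤ} (hm : m ≠ 0) (hodd : Odd m) (n : ℤ) (v : Fock) :
    current m hm (phiOp n v) = phiOp n (current m hm v) + phiOp (n - m) v := by
  -- Moving φ_n to the left through both factors leaves contractions at i = -n and i = n - m. Each
  -- contributes 2 φ_{n-m}, the second with this sign because m is odd; the total 4 cancels the
  -- factor 1/4.
  have key : ∀ i : ℤ, sgn i • phiOp (-i - m) (phiOp i (phiOp n v)) =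
      phiOp n (sgn i • phiOp (-i - m) (phiOp i v)) +
        ((if i = -n then (2 : CoeffRing) • phiOp (n - m) v else 0) +
          (if i = n - m then (2 : CoeffRing) • phiOp (n - m) v else 0)) := by
    intro i
    rw [phiOp_phiOp_eq i n, map_sub, map_smul, phiOp_phiOp_eq (-i - m) n, map_smul, smul_sub,
      smul_sub, smul_smul, smul_smul]
    have h1 : (sgn i * if i + n = 0 then 2 * sgn i else 0) • phiOp (-i - m) v =
        if i = -n then (2 : CoeffRing) • phiOp (n - m) v else 0 := by
      by_cases h : i = -n
      · rw [if_pos (by omega), if_pos h, mul_left_comm, sgn_mul_self, mul_one, h, neg_neg]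
      · rw [if_neg (by omega), if_neg h, mul_zero, zero_smul]
    have h2 : (sgn i * if -i - m + n = 0 then 2 * sgn (-i - m) else 0) • phiOp i v =
        -if i = n - m then (2 : CoeffRing) • phiOp (n - m) v else 0 := by
      by_cases h : i = n - m
      · rw [if_pos (by omega), if_pos h, mul_left_comm, ← sgn_add,
          show i + (-i - m) = -m by ring, sgn_neg, sgn_odd hodd, mul_neg, mul_one, neg_smul, h]
      · rw [if_neg (by omega), if_neg h, mul_zero, zero_smul, neg_zero]
    rw [h1, h2]
    abel
  have f1 : (Function.support fun i : ℤ =>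
      phiOp n (sgn i • phiOp (-i - m) (phiOp i v))).Finite :=
    (hamTerm_finite m hm v).subset fun i hi => by
      rw [Function.mem_support] at hi ⊢
      intro h0
      exact hi (by rw [h0, map_zero])
  have f2 : ∀ j : ℤ, (Function.support fun i : ℤ =>
      if i = j then (2 : CoeffRing) • phiOp (n - m) v else 0).Finite := fun j =>
    (Set.finite_singleton j).subset fun i hi => by
      by_contra hne
      exact hi (if_neg hne)
  have f3 : ∀ j : ℤ, (∑ᶠ i : ℤ, if i = j then (2 : CoeffRing) • phiOp (n - m) v else 0) =
      (2 : CoeffRing) • phiOp (n - m) v := fun j => by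
    rw [finsum_eq_single _ j fun i hi => if_neg hi, if_pos rfl]
  rw [current_apply, finsum_congr key, finsum_add_distrib f1, finsum_add_distrib (f2 _) (f2 _),
    f3, f3, smul_add, ← add_smul, smul_smul, show (2 + 2 : CoeffRing) = 4 by norm_num,
    cst_quarter_mul_four, one_smul, current_apply, map_smul, map_finsum _ (hamTerm_finite m hm v)]
  exact ((f2 _).union (f2 _)).subset (Function.support_add _ _)

/-- Shifts of the index by k and by m commute, so the commutator of two modes commutes with every
φ_n and is determined by its value on the vacuum. -/
theorem current_mul_phi_comm (k m : ℤ) (hk : k ≠ 0) (hm : m ≠ 0) (hk' : Odd k) (hm' : Odd m)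
    (n : ℤ) (v : Fock) :
    current k hk (current m hm (phiOp n v)) - current m hm (current k hk (phiOp n v)) =
      phiOp n (current k hk (current m hm v) - current m hm (current k hk v)) := by
  simp only [current_phiOp _ hk', current_phiOp _ hm', map_add, map_sub]
  rw [show n - m - k = n - k - m by ring]
  abel

theorem current_vac_of_pos {m : ℤ} (hm : 0 < m) : current m hm.ne' vac = 0 := by
  rw [current_apply, finsum_eq_zero_of_forall_eq_zero fun i => ?_, smul_zero]
  rcases lt_or_ge i 0 with h | h
  · rw [phiOp_vac h, map_zero, smul_zero]
  · rw [phiOp_swap (by omega), phiOp_vac (by omega), map_zero, neg_zero, smul_zero]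

theorem current_neg_vac {m : ℕ} (hm : -(m : ℤ) ≠ 0) : current (-m) hm vac =
    cst (1 / 4) • ∑ i ∈ Finset.range (m + 1), sgn i • phiOp (m - i) (phiOp i vac) := by
  rw [current_apply]
  congr 1
  have hs : (Function.support fun i : ℤ => sgn i • phiOp (-i - -(m : ℤ)) (phiOp i vac)) ⊆
      ((Finset.range (m + 1)).map Nat.castEmbedding : Finset ℤ) := by
    intro i hi
    by_contra hcon
    refine hi ?_
    dsimp only
    rcases lt_or_ge i 0 with h | h
    · rw [phiOp_vac h, map_zero, smul_zero]
    · have : (m : ℤ) < i := by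
        by_contra hle
        refine hcon (Finset.mem_coe.2 (Finset.mem_map.2 ⟨i.toNat, ?_, ?_⟩))
        · rw [Finset.mem_range]; omega
        · simp [h]
      rw [phiOp_swap (by omega), phiOp_vac (n := -i - -(m : ℤ)) (by omega), map_zero, neg_zero,
        smul_zero]
  rw [finsum_eq_sum_of_support_subset _ hs, Finset.sum_map]
  refine Finset.sum_congr rfl fun i _ => ?_
  rw [Nat.castEmbedding_apply, show -(i : ℤ) - -(m : ℤ) = m - i by ring]

/-- `[H_k, H_{-m}] |vac⟩ = (m/2) δ_{k,m} |vac⟩`. -/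
theorem current_current_neg_vac {k m : ℕ} (hk : Odd k) (hm : Odd m) (hk0 : (k : ℤ) ≠ 0)
    (hm0 : -(m : ℤ) ≠ 0) : current k hk0 (current (-m) hm0 vac) =
      (if k = m then cst (m / 2) else 0) • vac := by
  have hpos : 0 < k := by omega
  have hvac : current k hk0 vac = 0 := current_vac_of_pos (by omega)
  have hko : Odd (k : ℤ) := by exact_mod_cast hk
  have e : ∀ i : ℕ, current k hk0 (phiOp (m - i) (phiOp i vac)) =
      phiOp (m - i) (phiOp (i - k) vac) + phiOp (m - i - k) (phiOp i vac) := by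
    intro i
    rw [current_phiOp hk0 hko, current_phiOp hk0 hko, hvac, map_zero, zero_add]
  rw [current_neg_vac, map_smul, map_sum]
  simp only [map_smul, e, smul_add, Finset.sum_add_distrib]
  rw [← smul_add]
  rcases lt_trichotomy m k with h | h | h
  · rw [if_neg (by omega), zero_smul, Finset.sum_eq_zero, Finset.sum_eq_zero, add_zero, smul_zero]
    · intro i hi
      rw [phiOp_swap (by omega), phiOp_vac (n := m - i - k) (by omega), map_zero, neg_zero,
        smul_zero]
    · intro i hi
      rw [Finset.mem_range] at hi
      rw [phiOp_vac (n := i - k) (by omega), map_zero, smul_zero]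
  · subst h
    rw [if_pos rfl, Finset.sum_range_succ, Finset.sum_eq_zero, Finset.sum_range_succ']
    -- Case k = m. In the first sum only i = m survives and gives -1; in the second, i = 0 gives 1
    -- and each of the m indices i ≥ 1 gives 2. The total is 2m, and 2m/4 = m/2.
    · have : ∀ i ∈ Finset.range m, sgn ((i + 1 : ℕ) : ℤ) •
          phiOp (m - (i + 1 : ℕ) - m) (phiOp (i + 1 : ℕ) vac) = (2 : CoeffRing) • vac := by
        intro i _
        rw [phiOp_phiOp_eq, if_pos (by ring), phiOp_vac (n := m - (i + 1 : ℕ) - m) (by omega),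
          map_zero, sub_zero, smul_smul, mul_left_comm, ← sgn_add,
          show ((i + 1 : ℕ) : ℤ) + (m - (i + 1 : ℕ) - m) = 0 by ring]
        simp [sgn]
      rw [Finset.sum_congr rfl this, Finset.sum_const, Finset.card_range]
      simp only [sub_self, Nat.cast_zero, sub_zero, phiOp_zero_phiOp_zero, zero_add]
      rw [sgn_odd hko, ← Nat.cast_smul_eq_nsmul CoeffRing m, smul_smul, ← add_smul, ← add_smul,
        smul_smul, sgn_eq_ite, if_pos (by simp)]
      congr 1
      have h1 : (m : CoeffRing) = cst m := (map_natCast MvPolynomial.C _).symm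
      have h2 : (2 : CoeffRing) = cst 2 := (map_ofNat MvPolynomial.C _).symm
      rw [h1, h2, add_left_comm, neg_add_cancel, add_zero, ← map_mul, ← map_mul]
      congr 1
      ring
    · intro i hi
      rw [Finset.mem_range] at hi
      rw [phiOp_vac (n := i - m) (by omega), map_zero, smul_zero]
  -- Case k < m. The term k + i of the first sum cancels the term i of the second, the signs being
  -- opposite because k is odd; the terms outside these N + 2 pairs vanish.
  · obtain ⟨N, rfl⟩ := Nat.exists_eq_add_of_lt h
    have hz : ∀ i ∈ Finset.range k, sgn (i : ℤ) •
        phiOp ((k + N + 1 : ℕ) - i) (phiOp (i - k) vac) = 0 := by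
      intro i hi
      rw [Finset.mem_range] at hi
      rw [phiOp_vac (n := i - k) (by omega), map_zero, smul_zero]
    have hz' : ∀ i ∈ Finset.range k, sgn ((N + 2 + i : ℕ) : ℤ) •
        phiOp ((k + N + 1 : ℕ) - (N + 2 + i : ℕ) - k) (phiOp (N + 2 + i : ℕ) vac) = 0 := by
      intro i hi
      rw [phiOp_swap (by push_cast; omega),
        phiOp_vac (n := (k + N + 1 : ℕ) - (N + 2 + i : ℕ) - k) (by push_cast; omega), map_zero,
        neg_zero, smul_zero]
    rw [if_neg (by omega), zero_smul, show k + N + 1 + 1 = k + (N + 2) by ring,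
      Finset.sum_range_add, Finset.sum_eq_zero hz, zero_add, add_comm k (N + 2),
      Finset.sum_range_add _ (N + 2) k, Finset.sum_eq_zero hz', add_zero, ← Finset.sum_add_distrib,
      Finset.sum_eq_zero, smul_zero]
    intro i _
    rw [Nat.cast_add k i, sgn_add, sgn_odd hko, add_sub_cancel_left,
      show ((k + N + 1 : ℕ) : ℤ) - (k + i : ℤ) = (k + N + 1 : ℕ) - i - k by ring, neg_one_mul,
      neg_smul, neg_add_cancel]

/-- `[H_k, H_{-m}] = (m/2) δ_{k,m}`. -/
theorem current_current_neg {k m : ℕ} (hk : Odd k) (hm : Odd m) (hk0 : (k : ℤ) ≠ 0)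
    (hm0 : -(m : ℤ) ≠ 0) (v : Fock) : current k hk0 (current (-m) hm0 v) =
      current (-m) hm0 (current k hk0 v) + (if k = m then cst (m / 2) else 0 : CoeffRing) • v := by
  rw [← sub_eq_iff_eq_add']
  induction v using fock_induction with
  | hvac =>
    have hpos : 0 < k := by omega
    rw [current_current_neg_vac hk hm, current_vac_of_pos (by omega), map_zero, sub_zero]
  | hadd v w hv hw => rw [smul_add, ← hv, ← hw]; simp only [map_add]; abel
  | hsmul c v hv => rw [smul_comm, ← hv]; simp only [map_smul, smul_sub]
  | hphi n v hv =>
    rw [current_mul_phi_comm _ _ _ _ (by exact_mod_cast hk) (by simpa using hm), hv, map_smul]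

/-- In every term φ_{m-i} φ_i at least one index is positive, and that factor can be brought to the
left since the two anticommute. -/
theorem vacBra_current_neg {m : ℤ} (hm : 0 < m) (v : Fock) :
    vacBra (current (-m) (by omega) v) = 0 := by
  rw [current_apply, map_smul, map_finsum _ (hamTerm_finite _ (by omega) v),
    finsum_eq_zero_of_forall_eq_zero fun i => ?_, smul_zero]
  rw [map_smul]
  rcases lt_or_ge 0 i with h | h
  · rw [phiOp_swap (by omega), map_neg, vacBra_phiOp h, neg_zero, smul_zero]
  · rw [vacBra_phiOp (by omega), smul_zero]

/-! ### Vertex operators -/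

section Vertex

variable {K M : Type*} [CommRing K] [AddCommGroup M] [Module K M]

/-- The family of operators vanishes on each vector for small indices. -/
def LocallyZero (Φ : ℤ → M →ₗ[K] M) : Prop := ∀ z, ∃ N : ℤ, ∀ n < N, Φ n z = 0

variable {Φ : ℤ → M →ₗ[K] M}

theorem LocallyZero.exists_nat (hΦ : LocallyZero Φ) (n : ℤ) (z : M) :
    ∃ N : ℕ, ∀ m : ℕ, N ≤ m → Φ (n - m) z = 0 := by
  obtain ⟨N, hN⟩ := hΦ z
  exact ⟨(n - N + 1).toNat, fun m hm => hN _ (by omega)⟩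

theorem LocallyZero.finite (hΦ : LocallyZero Φ) (g : PowerSeries K) (n : ℤ) (z : M) :
    (Function.support fun m : ℕ => PowerSeries.coeff m g • Φ (n - m) z).Finite := by
  obtain ⟨N, hN⟩ := hΦ.exists_nat n z
  refine (Finset.range N).finite_toSet.subset fun m hm => ?_
  by_contra hcon
  exact hm (by dsimp only; rw [hN m (by simpa using hcon), smul_zero])

/-- The coefficient of `t^n` in `g(t) Φ(t)`, where `Φ(t) = ∑ Φ_n t^n`. -/
def act (hΦ : LocallyZero Φ) (g : PowerSeries K) (n : ℤ) : M →ₗ[K] M where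
  toFun z := ∑ᶠ m : ℕ, PowerSeries.coeff m g • Φ (n - m) z
  map_add' v w := by
    rw [← finsum_add_distrib (hΦ.finite g n v) (hΦ.finite g n w)]
    simp only [map_add, smul_add]
  map_smul' c v := by
    rw [RingHom.id_apply, smul_finsum' c (hΦ.finite g n v)]
    simp only [map_smul, smul_comm c]

variable (hΦ : LocallyZero Φ)

theorem act_apply (g : PowerSeries K) (n : ℤ) (z : M) :
    act hΦ g n z = ∑ᶠ m : ℕ, PowerSeries.coeff m g • Φ (n - m) z := rfl

theorem act_eq_sum (g : PowerSeries K) {n : ℤ} {z : M} {N : ℕ}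
    (h : ∀ m : ℕ, N ≤ m → Φ (n - m) z = 0) :
    act hΦ g n z = ∑ m ∈ Finset.range N, PowerSeries.coeff m g • Φ (n - m) z := by
  refine finsum_eq_sum_of_support_subset _ fun m hm => ?_
  by_contra hcon
  exact hm (by dsimp only; rw [h m (by simpa using hcon), smul_zero])

theorem act_eq_zero (g : PowerSeries K) {n : ℤ} {z : M}
    (h : ∀ m : ℕ, PowerSeries.coeff m g ≠ 0 → Φ (n - m) z = 0) : act hΦ g n z = 0 := by
  refine finsum_eq_zero_of_forall_eq_zero fun m => ?_
  by_cases hm : PowerSeries.coeff m g = 0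
  · rw [hm, zero_smul]
  · rw [h m hm, smul_zero]

theorem act_add (g h : PowerSeries K) (n : ℤ) (z : M) :
    act hΦ (g + h) n z = act hΦ g n z + act hΦ h n z := by
  rw [act_apply, act_apply, act_apply,
    ← finsum_add_distrib (hΦ.finite g n z) (hΦ.finite h n z)]
  simp only [map_add, add_smul]

theorem act_smul (c : K) (g : PowerSeries K) (n : ℤ) (z : M) :
    act hΦ (c • g) n z = c • act hΦ g n z := by
  rw [act_apply, act_apply, smul_finsum' c (hΦ.finite g n z)]
  simp only [PowerSeries.coeff_smul, smul_assoc]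

theorem act_zero (n : ℤ) (z : M) : act hΦ 0 n z = 0 :=
  act_eq_zero hΦ _ fun m hm => absurd (by simp) hm

theorem act_finset_sum {ι : Type*} (s : Finset ι) (g : ι → PowerSeries K) (n : ℤ) (z : M) :
    act hΦ (∑ i ∈ s, g i) n z = ∑ i ∈ s, act hΦ (g i) n z := by
  classical
  induction s using Finset.induction_on with
  | empty => simp [act_zero]
  | insert i s hi ih => rw [Finset.sum_insert hi, Finset.sum_insert hi, act_add, ih]

theorem act_C (c : K) (n : ℤ) (z : M) : act hΦ (PowerSeries.C c) n z = c • Φ n z := by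
  rw [act_apply, finsum_eq_single _ 0 fun m hm => ?_]
  · simp
  · rw [PowerSeries.coeff_C, if_neg hm, zero_smul]

theorem act_one (n : ℤ) (z : M) : act hΦ 1 n z = Φ n z := by
  rw [← map_one PowerSeries.C, act_C, one_smul]

theorem act_mul_eq_sum (g h : PowerSeries K) {n : ℤ} {z : M} {N : ℕ}
    (hN : ∀ m : ℕ, N ≤ m → Φ (n - m) z = 0) :
    act hΦ (g * h) n z =
      ∑ m ∈ Finset.range N, PowerSeries.coeff m g • act hΦ h (n - m) z := by
  have h1 : ∀ m ∈ Finset.range N, act hΦ h (n - m) z =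
      ∑ k ∈ Finset.range (N - m), PowerSeries.coeff k h • Φ (n - (m + k : ℕ)) z := by
    intro m _
    rw [act_eq_sum hΦ h (N := N - m) (fun k hk => by
      rw [show n - m - k = n - (m + k : ℕ) by push_cast; ring]; exact hN _ (by omega))]
    refine Finset.sum_congr rfl fun k _ => ?_
    rw [show n - m - k = n - (m + k : ℕ) by push_cast; ring]
  have h2 : ∑ m ∈ Finset.range N, PowerSeries.coeff m g • act hΦ h (n - m) z =
      ∑ m ∈ Finset.range N, ∑ k ∈ Finset.range (N - m), PowerSeries.coeff m g •
        PowerSeries.coeff k h • Φ (n - (m + k : ℕ)) z :=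
    Finset.sum_congr rfl fun m hm => by rw [h1 m hm, Finset.smul_sum]
  rw [act_eq_sum hΦ _ hN, h2, ← Finset.sum_range_diag_flip N fun m k => PowerSeries.coeff m g •
      PowerSeries.coeff k h • Φ (n - (m + k : ℕ)) z]
  refine Finset.sum_congr rfl fun m _ => ?_
  rw [PowerSeries.coeff_mul, Finset.Nat.sum_antidiagonal_eq_sum_range_succ
    (fun i j => PowerSeries.coeff i g * PowerSeries.coeff j h), Finset.sum_smul]
  refine Finset.sum_congr rfl fun k hk => ?_
  rw [Finset.mem_range] at hk
  rw [smul_smul, Nat.add_sub_cancel' (by omega)]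

/-- Associativity: multiplying Φ(t) by g h is multiplying h(t) Φ(t) by g. -/
theorem act_mul (g h : PowerSeries K) (n : ℤ) (z : M) :
    act hΦ (g * h) n z = ∑ᶠ m : ℕ, PowerSeries.coeff m g • act hΦ h (n - m) z := by
  obtain ⟨N, hN⟩ := hΦ.exists_nat n z
  rw [act_mul_eq_sum hΦ g h hN]
  symm
  refine finsum_eq_sum_of_support_subset _ fun m hm => ?_
  by_contra hcon
  refine hm ?_
  dsimp only
  rw [act_eq_zero hΦ h fun k _ => ?_, smul_zero]
  rw [show n - m - k = n - (m + k : ℕ) by push_cast; ring]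
  exact hN _ (by simp at hcon; omega)

/-- A linear operator that intertwines each `Φ_n` with `act q n` turns `act g` into
`act (g * q)`. -/
theorem map_act {M' : Type*} [AddCommGroup M'] [Module K M'] {Φ' : ℤ → M' →ₗ[K] M'}
    (hΦ' : LocallyZero Φ') {T : M →ₗ[K] M'} {q : PowerSeries K}
    (hT : ∀ n z, T (Φ n z) = act hΦ' q n (T z)) (g : PowerSeries K) (n : ℤ) (z : M) :
    T (act hΦ g n z) = act hΦ' (g * q) n (T z) := by
  rw [act_apply, map_finsum _ (hΦ.finite g n z), act_mul]
  simp only [map_smul, hT]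

/-! ### Exponentials of locally nilpotent operators -/

section Exp

variable (H : M →ₗ[K] M) (c : PowerSeries K)

/-- `H` acts nilpotently on each vector. -/
def LocallyNilpotent : Prop := ∀ z, ∃ J : ℕ, ∀ j, J ≤ j → (H ^ j) z = 0

variable {H c}

/-- The binomial theorem for the iterated Leibniz rule: the adjoint action of H on Φ(t) is
multiplication by the scalar series c(t), so its i-th iterate is c(t)^i. -/
theorem pow_apply_vertex (hH : ∀ n z, H (Φ n z) = Φ n (H z) + act hΦ c n z) (n : ℤ) (z : M)
    (k : ℕ) : (H ^ k) (Φ n z) = ∑ p ∈ Finset.HasAntidiagonal.antidiagonal k,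
      k.choose p.1 • act hΦ (c ^ p.1) n ((H ^ p.2) z) := by
  have hHact : ∀ g n z, H (act hΦ g n z) = act hΦ g n (H z) + act hΦ (g * c) n z := by
    intro g n z
    have hf : (Function.support fun m : ℕ =>
        PowerSeries.coeff m g • act hΦ c (n - m) z).Finite := by
      obtain ⟨N, hN⟩ := hΦ.exists_nat n z
      refine (Finset.range N).finite_toSet.subset fun m hm => ?_
      by_contra hcon
      refine hm ?_
      dsimp only
      rw [act_eq_zero hΦ c fun k _ => ?_, smul_zero]
      rw [show n - m - k = n - (m + k : ℕ) by push_cast; ring]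
      exact hN _ (by simp at hcon; omega)
    rw [act_apply, map_finsum _ (hΦ.finite g n z), act_mul, act_apply,
      ← finsum_add_distrib (hΦ.finite g n _) hf]
    simp only [map_smul, hH, smul_add]
  induction k with
  | zero => simp [act_one]
  | succ k ih =>
    rw [pow_succ', Module.End.mul_apply, ih, map_sum,
      Finset.sum_antidiagonal_choose_succ_nsmul
        (fun i j => act hΦ (c ^ i) n ((H ^ j) z)) k, ← Finset.sum_add_distrib]
    refine Finset.sum_congr rfl fun p hp => ?_
    rw [map_nsmul, hHact, nsmul_add, pow_succ c, pow_succ', Module.End.mul_apply]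
    congr 2
    rw [← Finset.HasAntidiagonal.mem_antidiagonal.1 hp, Nat.choose_symm_add]

theorem coeff_pow_of_lt (hc : PowerSeries.constantCoeff c = 0) {i m : ℕ} (h : m < i) :
    PowerSeries.coeff m (c ^ i) = 0 := by
  refine PowerSeries.X_pow_dvd_iff.1 (pow_dvd_pow_of_dvd (PowerSeries.X_dvd_iff.2 hc) i) m h

/-- `exp(c) = ∑ c^i / i!`, where `κ i` stands for `1/i!`. -/
def expSeries (κ : ℕ → K) (c : PowerSeries K) : PowerSeries K :=
  PowerSeries.mk fun m => ∑ i ∈ Finset.range (m + 1), κ i * PowerSeries.coeff m (c ^ i)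

/-- Without a constant term c^i starts at t^i, so any truncation beyond m computes the same
coefficient. -/
theorem coeff_expSeries (κ : ℕ → K) (hc : PowerSeries.constantCoeff c = 0) {m N : ℕ} (h : m < N) :
    PowerSeries.coeff m (expSeries κ c) =
      ∑ i ∈ Finset.range N, κ i * PowerSeries.coeff m (c ^ i) := by
  rw [expSeries, PowerSeries.coeff_mk]
  refine Finset.sum_subset (Finset.range_mono h) fun i _ hi => ?_
  rw [coeff_pow_of_lt hc (by simpa using hi), mul_zero]

theorem coeff_expSeries' (κ : ℕ → K) (hc : PowerSeries.constantCoeff c = 0) {m N : ℕ} (h : m < N) :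
    PowerSeries.coeff m (expSeries κ c) =
      PowerSeries.coeff m (∑ i ∈ Finset.range N, κ i • c ^ i) := by
  rw [coeff_expSeries κ hc h, map_sum]
  rfl

theorem constantCoeff_expSeries {κ : ℕ → K} (h0 : κ 0 = 1) :
    PowerSeries.constantCoeff (expSeries κ c) = 1 := by
  rw [← PowerSeries.coeff_zero_eq_constantCoeff_apply, expSeries, PowerSeries.coeff_mk]
  simp [h0]

open PowerSeries in
theorem derivative_expSeries {κ : ℕ → K} (hκ : ∀ k : ℕ, (k + 1 : K) * κ (k + 1) = κ k)
    (hc : PowerSeries.constantCoeff c = 0) :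
    d⁄dX K (expSeries κ c) = expSeries κ c * d⁄dX K c := by
  ext m
  have h1 : coeff m (d⁄dX K (expSeries κ c)) =
      coeff m (d⁄dX K (∑ i ∈ Finset.range (m + 2), κ i • c ^ i)) := by
    rw [coeff_derivative, coeff_derivative, coeff_expSeries' κ hc (Nat.lt_succ_self _)]
  have h2 : d⁄dX K (∑ i ∈ Finset.range (m + 2), κ i • c ^ i) =
      (∑ i ∈ Finset.range (m + 1), κ i • c ^ i) * d⁄dX K c := by
    rw [map_sum, Finset.sum_range_succ', Finset.sum_mul, pow_zero, Derivation.map_smul,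
      Derivation.map_one_eq_zero, smul_zero, add_zero]
    refine Finset.sum_congr rfl fun i _ => ?_
    rw [Derivation.map_smul, Derivation.leibniz_pow, Nat.add_sub_cancel, ← hκ i, smul_mul_assoc, ← Nat.cast_smul_eq_nsmul K,
      smul_smul, mul_comm, smul_eq_mul]
    push_cast
    rfl
  rw [h1, h2, coeff_mul, coeff_mul]
  refine Finset.sum_congr rfl fun p hp => ?_
  rw [coeff_expSeries' κ hc (N := m + 1)]
  have := Finset.HasAntidiagonal.mem_antidiagonal.1 hp
  omega

-- Uniqueness for the linear equation g' = g e, coefficient by coefficient. Exponential series are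
-- evaluated below by comparing logarithmic derivatives.
open PowerSeries in
theorem eq_of_derivative_eq_mul {g h e : PowerSeries K} (hu : ∀ k : ℕ, IsUnit (k + 1 : K))
    (hg : d⁄dX K g = g * e) (hh : d⁄dX K h = h * e) (h0 : constantCoeff g = constantCoeff h) :
    g = h := by
  ext m
  induction m using Nat.strong_induction_on with
  | _ m ih =>
    cases m with
    | zero => simpa using h0
    | succ m =>
      have h1 : coeff m (d⁄dX K g) = coeff m (d⁄dX K h) := by
        rw [hg, hh, coeff_mul, coeff_mul]
        refine Finset.sum_congr rfl fun p hp => ?_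
        have := Finset.HasAntidiagonal.mem_antidiagonal.1 hp
        rw [ih p.1 (by omega)]
      rw [coeff_derivative, coeff_derivative] at h1
      exact (hu m).mul_right_cancel h1

/-- `exp(H) = ∑ H^k / k!`, where `κ k` stands for `1/k!`. -/
def expOp (κ : ℕ → K) (hn : LocallyNilpotent H) : M →ₗ[K] M where
  toFun z := ∑ᶠ k : ℕ, κ k • (H ^ k) z
  map_add' v w := by
    have hf : ∀ z, (Function.support fun k : ℕ => κ k • (H ^ k) z).Finite := fun z => by
      obtain ⟨J, hJ⟩ := hn z
      refine (Finset.range J).finite_toSet.subset fun k hk => ?_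
      by_contra hcon
      exact hk (by dsimp only; rw [hJ k (by simpa using hcon), smul_zero])
    rw [← finsum_add_distrib (hf v) (hf w)]
    simp only [map_add, smul_add]
  map_smul' a v := by
    have hf : ∀ z, (Function.support fun k : ℕ => κ k • (H ^ k) z).Finite := fun z => by
      obtain ⟨J, hJ⟩ := hn z
      refine (Finset.range J).finite_toSet.subset fun k hk => ?_
      by_contra hcon
      exact hk (by dsimp only; rw [hJ k (by simpa using hcon), smul_zero])
    rw [RingHom.id_apply, smul_finsum' a (hf v)]
    simp only [map_smul, smul_comm a]

theorem expOp_apply (κ : ℕ → K) (hn : LocallyNilpotent H) (z : M) :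
    expOp κ hn z = ∑ᶠ k : ℕ, κ k • (H ^ k) z := rfl

theorem expOp_eq_sum (κ : ℕ → K) (hn : LocallyNilpotent H) {z : M} {J : ℕ}
    (hJ : ∀ j, J ≤ j → (H ^ j) z = 0) :
    expOp κ hn z = ∑ k ∈ Finset.range J, κ k • (H ^ k) z := by
  refine finsum_eq_sum_of_support_subset _ fun k hk => ?_
  by_contra hcon
  exact hk (by dsimp only; rw [hJ k (by simpa using hcon), smul_zero])

include hΦ in
theorem exists_uniform_cutoff (n : ℤ) (J : ℕ) (w : ℕ → M) :
    ∃ N : ℕ, ∀ j < J, ∀ m : ℕ, N ≤ m → Φ (n - m) (w j) = 0 := by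
  choose N hN using fun j => hΦ.exists_nat n (w j)
  refine ⟨(Finset.range J).sup N, fun j hj m hm => hN j m (le_trans ?_ hm)⟩
  exact Finset.le_sup (f := N) (Finset.mem_range.2 hj)

theorem act_pow_eq_zero (hc : PowerSeries.constantCoeff c = 0) {n : ℤ} {N i : ℕ} {w : M}
    (hN : ∀ m : ℕ, N ≤ m → Φ (n - m) w = 0) (hi : N ≤ i) : act hΦ (c ^ i) n w = 0 := by
  refine act_eq_zero hΦ _ fun m hm => hN m ?_
  by_contra hlt
  exact hm (coeff_pow_of_lt hc (by omega))

/-- In each term of the binomial expansion, with exponents adding up to at least N + J, either the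
power of H kills z or the power of c lowers the index past the cutoff. This carries local nilpotency
from the vacuum to all words. -/
theorem pow_apply_vertex_eq_zero (hH : ∀ n z, H (Φ n z) = Φ n (H z) + act hΦ c n z)
    (hc : PowerSeries.constantCoeff c = 0) {n : ℤ} {z : M} {J N k : ℕ}
    (hJ : ∀ j, J ≤ j → (H ^ j) z = 0)
    (hN : ∀ j < J, ∀ m : ℕ, N ≤ m → Φ (n - m) ((H ^ j) z) = 0) (hk : N + J ≤ k) :
    (H ^ k) (Φ n z) = 0 := by
  rw [pow_apply_vertex hΦ hH]
  refine Finset.sum_eq_zero fun p hp => ?_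
  have := Finset.HasAntidiagonal.mem_antidiagonal.1 hp
  rcases lt_or_ge p.2 J with h | h
  · rw [act_pow_eq_zero hΦ hc (hN _ h) (by omega), smul_zero]
  · rw [hJ _ h, map_zero, smul_zero]

include hΦ in
theorem exists_pow_apply_vertex_eq_zero (hH : ∀ n z, H (Φ n z) = Φ n (H z) + act hΦ c n z)
    (hc : PowerSeries.constantCoeff c = 0) (n : ℤ) {z : M}
    (hz : ∃ J : ℕ, ∀ j, J ≤ j → (H ^ j) z = 0) : ∃ J : ℕ, ∀ j, J ≤ j → (H ^ j) (Φ n z) = 0 := by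
  obtain ⟨J, hJ⟩ := hz
  obtain ⟨N, hN⟩ := exists_uniform_cutoff hΦ n J fun j => (H ^ j) z
  exact ⟨N + J, fun j hj => pow_apply_vertex_eq_zero hΦ hH hc hJ hN hj⟩

/-- `exp(H) Φ(t) = exp(c(t)) Φ(t) exp(H)` if `[H, Φ(t)] = c(t) Φ(t)`. -/
theorem expOp_vertex {κ : ℕ → K} (hκ : ∀ i j : ℕ, ((i + j).choose i : K) * κ (i + j) = κ i * κ j)
    (hn : LocallyNilpotent H) (hH : ∀ n z, H (Φ n z) = Φ n (H z) + act hΦ c n z)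
    (hc : PowerSeries.constantCoeff c = 0) (n : ℤ) (z : M) :
    expOp κ hn (Φ n z) = act hΦ (expSeries κ c) n (expOp κ hn z) := by
  obtain ⟨J, hJ⟩ := hn z
  obtain ⟨N, hN⟩ := exists_uniform_cutoff hΦ n J fun j => (H ^ j) z
  have hact : ∀ j < J, act hΦ (expSeries κ c) n ((H ^ j) z) =
      ∑ i ∈ Finset.range N, κ i • act hΦ (c ^ i) n ((H ^ j) z) := by
    intro j hj
    simp only [← act_smul]
    rw [← act_finset_sum, act_eq_sum hΦ _ (hN j hj), act_eq_sum hΦ _ (hN j hj)]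
    refine Finset.sum_congr rfl fun m hm => ?_
    rw [coeff_expSeries' κ hc (Finset.mem_range.1 hm)]
  -- By `hκ` the binomial coefficients turn both sides into the double sum of f. It is supported in
  -- the box i < N, j < J, so the triangle i + j < N + J may be replaced by that box.
  set f : ℕ → ℕ → M := fun i j => (κ i * κ j) • act hΦ (c ^ i) n ((H ^ j) z) with hf
  have f1 : ∀ i j, N ≤ i → f i j = 0 := by
    intro i j hi
    simp only [hf]
    rcases lt_or_ge j J with h | h
    · rw [act_pow_eq_zero hΦ hc (hN _ h) hi, smul_zero]
    · rw [hJ _ h, map_zero, smul_zero]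
  have f2 : ∀ i j, J ≤ j → f i j = 0 := by
    intro i j hj
    simp only [hf]
    rw [hJ _ hj, map_zero, smul_zero]
  have lhs : expOp κ hn (Φ n z) = ∑ i ∈ Finset.range N, ∑ j ∈ Finset.range J, f i j := by
    rw [expOp_eq_sum κ hn fun k => pow_apply_vertex_eq_zero hΦ hH hc hJ hN]
    have : ∀ k ∈ Finset.range (N + J), κ k • (H ^ k) (Φ n z) =
        ∑ i ∈ Finset.range (k + 1), f i (k - i) := by
      intro k _
      rw [pow_apply_vertex hΦ hH, Finset.smul_sum,
        ← Finset.Nat.sum_antidiagonal_eq_sum_range_succ f]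
      refine Finset.sum_congr rfl fun p hp => ?_
      rw [← Finset.HasAntidiagonal.mem_antidiagonal.1 hp, ← Nat.cast_smul_eq_nsmul K, smul_smul, mul_comm, hκ]
    rw [Finset.sum_congr rfl this, Finset.sum_range_diag_flip, Finset.sum_range_add,
      Finset.sum_eq_zero (s := Finset.range J) fun i _ => Finset.sum_eq_zero fun j _ =>
        f1 _ _ (by omega), add_zero]
    refine Finset.sum_congr rfl fun i hi => ?_
    symm
    refine Finset.sum_subset (Finset.range_mono ?_) fun j _ hj => f2 _ _ (by simpa using hj)
    have := Finset.mem_range.1 hi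
    omega
  rw [lhs, expOp_eq_sum κ hn hJ, map_sum, Finset.sum_comm]
  refine Finset.sum_congr rfl fun j hj => ?_
  rw [map_smul, hact j (Finset.mem_range.1 hj), Finset.smul_sum]
  refine Finset.sum_congr rfl fun i _ => ?_
  rw [smul_smul, mul_comm]

/-- `exp(H) X = (X + s) exp(H)` if `[H, X] = s` is a scalar. -/
theorem expOp_of_commutator_scalar {κ : ℕ → K} (hκ : ∀ k : ℕ, (k + 1 : K) * κ (k + 1) = κ k)
    (hn : LocallyNilpotent H) {X : M →ₗ[K] M} {s : K} (hX : ∀ z, H (X z) = X (H z) + s • z)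
    (z : M) : expOp κ hn (X z) = X (expOp κ hn z) + s • expOp κ hn z := by
  have hpow : ∀ k : ℕ, (H ^ (k + 1)) (X z) =
      X ((H ^ (k + 1)) z) + ((k + 1 : K) * s) • (H ^ k) z := by
    intro k
    induction k with
    | zero => simpa using hX z
    | succ k ih =>
      rw [pow_succ', Module.End.mul_apply, ih, map_add, hX, map_smul, ← Module.End.mul_apply H,
        ← pow_succ', ← Module.End.mul_apply H, ← pow_succ', add_assoc, ← add_smul]
      congr 2
      push_cast
      ring
  obtain ⟨J, hJ⟩ := hn z
  obtain ⟨J', hJ'⟩ := hn (X z)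
  -- The scalar term lowers the power of H by one, so the two sums are cut off at J + J' + 1 and at
  -- J + J'.
  have e1 := expOp_eq_sum κ hn (z := X z) (J := J + J' + 1) fun j hj => hJ' j (by omega)
  have e2 := expOp_eq_sum κ hn (z := z) (J := J + J' + 1) fun j hj => hJ j (by omega)
  have e3 := expOp_eq_sum κ hn (z := z) (J := J + J') fun j hj => hJ j (by omega)
  have e4 : expOp κ hn (X z) = X (∑ k ∈ Finset.range (J + J' + 1), κ k • (H ^ k) z) +
      s • ∑ k ∈ Finset.range (J + J'), κ k • (H ^ k) z := by
    rw [e1, Finset.sum_range_succ', Finset.sum_range_succ', map_add, map_sum, Finset.smul_sum,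
      add_right_comm, ← Finset.sum_add_distrib]
    simp only [hpow, smul_add, map_smul, pow_zero, Module.End.one_apply]
    congr 1
    refine Finset.sum_congr rfl fun k _ => ?_
    rw [smul_smul, smul_smul, ← hκ k]
    congr 2
    ring
  rw [e4, ← e2, ← e3]

end Exp

end Vertex

/-! ### The Fock space over an algebra of coefficients -/

section BaseChange

variable (K : Type) [CommRing K] [Algebra CoeffRing K]

/-- The inverse factorials in a `ℂ[a]`-algebra. -/
def invFact (k : ℕ) : K := algebraMap CoeffRing K (cst ((k.factorial : ℂ)⁻¹))

theorem invFact_zero : invFact K 0 = 1 := by simp [invFact]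

theorem succ_mul_invFact (k : ℕ) : (k + 1 : K) * invFact K (k + 1) = invFact K k := by
  have : (k + 1 : K) = algebraMap CoeffRing K (cst ((k : ℂ) + 1)) := by simp
  rw [this, invFact, invFact, ← map_mul, ← map_mul, Nat.factorial_succ]
  congr 2
  push_cast
  have := Nat.cast_add_one_ne_zero (R := ℂ) k
  field_simp

theorem choose_mul_invFact (i j : ℕ) :
    ((i + j).choose i : K) * invFact K (i + j) = invFact K i * invFact K j := by
  have : ((i + j).choose i : K) = algebraMap CoeffRing K (cst ((i + j).choose i : ℂ)) := by simp
  rw [this, invFact, invFact, invFact, ← map_mul, ← map_mul, ← map_mul, ← map_mul]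
  congr 2
  rw [Nat.cast_add_choose]
  have h := fun k => Nat.cast_ne_zero (R := ℂ).2 (Nat.factorial_ne_zero k)
  have h1 := h i
  have h2 := h j
  have h3 := h (i + j)
  field_simp

theorem isUnit_succ (k : ℕ) : IsUnit (k + 1 : K) := by
  have : (k + 1 : K) = algebraMap CoeffRing K (cst ((k : ℂ) + 1)) := by simp
  rw [this]
  exact ((IsUnit.mk0 _ (Nat.cast_add_one_ne_zero (R := ℂ) k)).map MvPolynomial.C).map _

/-- The action of `φ_n` on the Fock space over `K`. -/
def phiK (n : ℤ) : K ⊗[CoeffRing] Fock →ₗ[K] K ⊗[CoeffRing] Fock :=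
  LinearMap.baseChange K (phiOp n)

variable {K}

theorem phiK_tmul (n : ℤ) (a : K) (v : Fock) : phiK K n (a ⊗ₜ v) = a ⊗ₜ phiOp n v := rfl

theorem tmul_eq_smul (a : K) (v : Fock) : a ⊗ₜ[CoeffRing] v = a • (1 : K) ⊗ₜ[CoeffRing] v := by
  rw [TensorProduct.smul_tmul', smul_eq_mul, mul_one]

theorem one_tmul_smul (c : CoeffRing) (v : Fock) :
    (1 : K) ⊗ₜ[CoeffRing] (c • v) = algebraMap CoeffRing K c • (1 : K) ⊗ₜ[CoeffRing] v := by
  rw [TensorProduct.tmul_smul, algebraMap_smul]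

/-- Induction on the words in the fermions, with coefficients in `K`. -/
theorem fockK_induction {P : K ⊗[CoeffRing] Fock → Prop} (hvac : P (1 ⊗ₜ vac))
    (hadd : ∀ v w, P v → P w → P (v + w)) (hsmul : ∀ (c : K) v, P v → P (c • v))
    (hphi : ∀ n v, P v → P (phiK K n v)) (v : K ⊗[CoeffRing] Fock) : P v := by
  have h1 : ∀ v : Fock, P (1 ⊗ₜ v) := fun v => by
    induction v using fock_induction with
    | hvac => exact hvac
    | hadd v w hv hw => rw [TensorProduct.tmul_add]; exact hadd _ _ hv hw
    | hsmul c v hv => rw [one_tmul_smul]; exact hsmul _ _ hv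
    | hphi n v hv => rw [← phiK_tmul]; exact hphi _ _ hv
  induction v using TensorProduct.induction_on with
  | zero => simpa using hsmul 0 _ hvac
  | tmul a v => rw [tmul_eq_smul]; exact hsmul _ _ (h1 v)
  | add v w hv hw => exact hadd _ _ hv hw

theorem phiK_anticomm (m n : ℤ) (z : K ⊗[CoeffRing] Fock) :
    phiK K m (phiK K n z) + phiK K n (phiK K m z) =
      algebraMap CoeffRing K (if m + n = 0 then 2 * sgn m else 0) • z := by
  induction z using TensorProduct.induction_on with
  | zero => simp
  | tmul a v =>
    rw [phiK_tmul, phiK_tmul, phiK_tmul, phiK_tmul, ← TensorProduct.tmul_add, phiOp_anticomm,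
      TensorProduct.tmul_smul, algebraMap_smul]
  | add v w hv hw => rw [smul_add, ← hv, ← hw]; simp only [map_add]; abel

theorem locallyZero_phiK : LocallyZero (phiK K) := by
  intro z
  induction z using TensorProduct.induction_on with
  | zero => exact ⟨0, fun n _ => map_zero _⟩
  | tmul a v =>
    obtain ⟨N, hN⟩ := phiOp_locally_zero v
    exact ⟨N, fun n hn => by rw [phiK_tmul, hN n hn, TensorProduct.tmul_zero]⟩
  | add v w hv hw =>
    obtain ⟨N, hN⟩ := hv
    obtain ⟨M, hM⟩ := hw
    refine ⟨min N M, fun n hn => ?_⟩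
    rw [map_add, hN n (by omega), hM n (by omega), add_zero]

theorem act_phiK_vac (g : PowerSeries K) {n : ℤ} (hn : n ≤ 0) :
    act locallyZero_phiK g n ((1 : K) ⊗ₜ vac) =
      PowerSeries.constantCoeff g • phiK K n ((1 : K) ⊗ₜ vac) := by
  rw [act_apply, finsum_eq_single _ 0 fun m hm => ?_]
  · simp
  · rw [phiK_tmul, phiOp_vac (by omega), TensorProduct.tmul_zero, smul_zero]

/-- The action of `H_m` on the Fock space over `K`. -/
def currentK (K : Type) [CommRing K] [Algebra CoeffRing K] (m : ℤ) (hm : m ≠ 0) :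
    K ⊗[CoeffRing] Fock →ₗ[K] K ⊗[CoeffRing] Fock :=
  LinearMap.baseChange K (current m hm)

theorem currentK_tmul (m : ℤ) (hm : m ≠ 0) (a : K) (v : Fock) :
    currentK K m hm (a ⊗ₜ v) = a ⊗ₜ current m hm v := rfl

theorem currentK_phiK {m : ℤ} (hm : m ≠ 0) (hodd : Odd m) (n : ℤ) (z : K ⊗[CoeffRing] Fock) :
    currentK K m hm (phiK K n z) = phiK K n (currentK K m hm z) + phiK K (n - m) z := by
  induction z using TensorProduct.induction_on with
  | zero => simp
  | tmul a v =>
    rw [phiK_tmul, currentK_tmul, currentK_tmul, phiK_tmul, phiK_tmul, ← TensorProduct.tmul_add,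
      current_phiOp hm hodd]
  | add v w hv hw => simp only [map_add, hv, hw]; abel

theorem currentK_currentK_neg {k m : ℕ} (hk : Odd k) (hm : Odd m) (hk0 : (k : ℤ) ≠ 0)
    (hm0 : -(m : ℤ) ≠ 0) (z : K ⊗[CoeffRing] Fock) :
    currentK K k hk0 (currentK K (-m) hm0 z) = currentK K (-m) hm0 (currentK K k hk0 z) +
      algebraMap CoeffRing K (if k = m then cst (m / 2) else 0) • z := by
  induction z using TensorProduct.induction_on with
  | zero => simp
  | tmul a v =>
    simp only [currentK_tmul]
    rw [current_current_neg hk hm, TensorProduct.tmul_add, TensorProduct.tmul_smul,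
      algebraMap_smul]
  | add v w hv hw => simp only [map_add, hv, hw, smul_add]; abel

theorem odd_two_mul_add_one (k : ℕ) : Odd (2 * k + 1) := ⟨k, rfl⟩

/-- By induction on words: the commutator of H_m with φ_n is φ_{n-m}, which kills a given vector
once m is large. -/
theorem exists_currentK_eq_zero (z : K ⊗[CoeffRing] Fock) : ∃ N : ℕ, ∀ k : ℕ, N ≤ k →
    currentK K ((2 * k + 1 : ℕ) : ℤ) (by omega) z = 0 := by
  induction z using fockK_induction with
  | hvac =>
    refine ⟨0, fun k _ => ?_⟩
    rw [currentK_tmul, current_vac_of_pos (by omega), TensorProduct.tmul_zero]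
  | hadd v w hv hw =>
    obtain ⟨N, hN⟩ := hv
    obtain ⟨M, hM⟩ := hw
    refine ⟨max N M, fun n hn => ?_⟩
    rw [map_add, hN n (by omega), hM n (by omega), add_zero]
  | hsmul c v hv =>
    obtain ⟨N, hN⟩ := hv
    exact ⟨N, fun n hn => by rw [map_smul, hN n hn, smul_zero]⟩
  | hphi n v hv =>
    obtain ⟨N, hN⟩ := hv
    obtain ⟨M, hM⟩ := locallyZero_phiK.exists_nat n v
    refine ⟨max N M, fun k hk => ?_⟩
    rw [currentK_phiK _ (by exact_mod_cast odd_two_mul_add_one k), hN k (by omega), map_zero,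
      zero_add, hM _ (by omega)]

theorem finite_hamTerm (c : ℕ → K) (z : K ⊗[CoeffRing] Fock) :
    (Function.support fun k : ℕ =>
      c k • currentK K ((2 * k + 1 : ℕ) : ℤ) (by omega) z).Finite := by
  obtain ⟨N, hN⟩ := exists_currentK_eq_zero z
  refine (Finset.range N).finite_toSet.subset fun m hm => ?_
  by_contra hcon
  exact hm (by dsimp only; rw [hN m (by simpa using hcon), smul_zero])

/-- The Hamiltonian `2 ∑_{m odd} p_m/m H_m` for given values `p_{2k+1}` in `K` of the odd power
sums. -/
def hamK (p : ℕ → K) : K ⊗[CoeffRing] Fock →ₗ[K] K ⊗[CoeffRing] Fock where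
  toFun z := ∑ᶠ k : ℕ, (cst (2 / (2 * (k : ℂ) + 1)) • p k) •
    currentK K ((2 * k + 1 : ℕ) : ℤ) (by omega) z
  map_add' v w := by
    rw [← finsum_add_distrib (finite_hamTerm _ v) (finite_hamTerm _ w)]
    simp only [map_add, smul_add]
  map_smul' c v := by
    rw [RingHom.id_apply, smul_finsum' c (finite_hamTerm _ v)]
    simp only [map_smul, smul_comm c]

theorem hamK_apply (p : ℕ → K) (z : K ⊗[CoeffRing] Fock) :
    hamK p z = ∑ᶠ k : ℕ, (cst (2 / (2 * (k : ℂ) + 1)) • p k) •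
      currentK K ((2 * k + 1 : ℕ) : ℤ) (by omega) z := rfl

open Classical in
/-- The power series `2 ∑_{m odd} p_m/m t^m`. -/
def logSeries (p : ℕ → K) : PowerSeries K :=
  PowerSeries.mk fun m => if Odd m then cst (2 / (m : ℂ)) • p (m / 2) else 0

theorem coeff_logSeries_odd (p : ℕ → K) (k : ℕ) : PowerSeries.coeff (2 * k + 1) (logSeries p) =
    cst (2 / (2 * (k : ℂ) + 1)) • p k := by
  rw [logSeries, PowerSeries.coeff_mk, if_pos (odd_two_mul_add_one k)]
  congr 2
  · push_cast; rfl
  · omega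

theorem coeff_logSeries_not_odd (p : ℕ → K) {m : ℕ} (hm : ¬ Odd m) :
    PowerSeries.coeff m (logSeries p) = 0 := by
  rw [logSeries, PowerSeries.coeff_mk, if_neg hm]

theorem constantCoeff_logSeries (p : ℕ → K) : PowerSeries.constantCoeff (logSeries p) = 0 := by
  rw [← PowerSeries.coeff_zero_eq_constantCoeff_apply, coeff_logSeries_not_odd _ (by simp)]

theorem logSeries_add (p p' : ℕ → K) : logSeries (p + p') = logSeries p + logSeries p' := by
  ext m
  rw [map_add]
  simp only [logSeries, PowerSeries.coeff_mk]
  split_ifs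
  · rw [Pi.add_apply, smul_add]
  · rw [add_zero]

theorem act_logSeries (p : ℕ → K) (n : ℤ) (z : K ⊗[CoeffRing] Fock) :
    act locallyZero_phiK (logSeries p) n z =
      ∑ᶠ k : ℕ, (cst (2 / (2 * (k : ℂ) + 1)) • p k) • phiK K (n - (2 * k + 1 : ℕ)) z := by
  classical
  rw [act_apply]
  have hinj : Function.Injective fun k : ℕ => 2 * k + 1 := fun a b h => by
    dsimp only at h; omega
  have h1 := finsum_mem_range (f := fun m : ℕ =>
    PowerSeries.coeff m (logSeries p) • phiK K (n - m) z) hinj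
  simp only [coeff_logSeries_odd] at h1
  rw [← h1]
  refine finsum_congr fun m => ?_
  by_cases hm : m ∈ Set.range fun k : ℕ => 2 * k + 1
  · rw [finsum_eq_if, if_pos hm]
  · rw [finsum_eq_if, if_neg hm, coeff_logSeries_not_odd, zero_smul]
    rintro ⟨k, rfl⟩
    exact hm ⟨k, rfl⟩

/-- The relation [H, Φ(t)] = c(t) Φ(t), summed from `currentK_phiK`, is the hypothesis under which
exponentials act on vertex operators. -/
theorem hamK_phiK (p : ℕ → K) (n : ℤ) (z : K ⊗[CoeffRing] Fock) : hamK p (phiK K n z) =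
    phiK K n (hamK p z) + act locallyZero_phiK (logSeries p) n z := by
  have hf : (Function.support fun k : ℕ => (cst (2 / (2 * (k : ℂ) + 1)) • p k) •
      phiK K (n - (2 * k + 1 : ℕ)) z).Finite := by
    obtain ⟨N, hN⟩ := locallyZero_phiK.exists_nat n z
    refine (Finset.range N).finite_toSet.subset fun m hm => ?_
    by_contra hcon
    refine hm ?_
    dsimp only
    rw [hN _ (by simp at hcon; omega), smul_zero]
  have hf' : (Function.support fun k : ℕ => phiK K n ((cst (2 / (2 * (k : ℂ) + 1)) • p k) •
      currentK K ((2 * k + 1 : ℕ) : ℤ) (by omega) z)).Finite :=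
    (finite_hamTerm _ z).subset (Function.support_comp_subset (map_zero _) _)
  rw [hamK_apply, hamK_apply, act_logSeries, map_finsum _ (finite_hamTerm _ z),
    ← finsum_add_distrib hf' hf]
  refine finsum_congr fun k => ?_
  rw [currentK_phiK _ (by exact_mod_cast odd_two_mul_add_one k), smul_add, map_smul]

theorem hamK_vac (p : ℕ → K) : hamK p ((1 : K) ⊗ₜ vac) = 0 :=
  finsum_eq_zero_of_forall_eq_zero fun k => by
    rw [currentK_tmul, current_vac_of_pos (by omega), TensorProduct.tmul_zero, smul_zero]

theorem locallyNilpotent_hamK (p : ℕ → K) : LocallyNilpotent (hamK p) := by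
  intro z
  induction z using fockK_induction with
  | hvac =>
    refine ⟨1, fun j hj => ?_⟩
    obtain ⟨j, rfl⟩ := Nat.exists_eq_add_of_le' hj
    rw [pow_succ, Module.End.mul_apply, hamK_vac, map_zero]
  | hadd v w hv hw =>
    obtain ⟨N, hN⟩ := hv
    obtain ⟨M, hM⟩ := hw
    refine ⟨max N M, fun n hn => ?_⟩
    rw [map_add, hN n (by omega), hM n (by omega), add_zero]
  | hsmul c v hv =>
    obtain ⟨N, hN⟩ := hv
    exact ⟨N, fun n hn => by rw [map_smul, hN n hn, smul_zero]⟩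
  | hphi n v hv =>
    exact exists_pow_apply_vertex_eq_zero locallyZero_phiK (hamK_phiK p)
      (constantCoeff_logSeries p) n hv

/-- The operator `e^H`. -/
def expHamK (p : ℕ → K) : K ⊗[CoeffRing] Fock →ₗ[K] K ⊗[CoeffRing] Fock :=
  expOp (invFact K) (locallyNilpotent_hamK p)

/-- The power series `∑ q_m t^m = exp(2 ∑_{m odd} p_m/m t^m)`. -/
def qSeries (p : ℕ → K) : PowerSeries K := expSeries (invFact K) (logSeries p)

theorem constantCoeff_qSeries (p : ℕ → K) : PowerSeries.constantCoeff (qSeries p) = 1 :=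
  constantCoeff_expSeries (invFact_zero K)

theorem derivative_qSeries (p : ℕ → K) : PowerSeries.derivative K (qSeries p) =
    qSeries p * PowerSeries.derivative K (logSeries p) :=
  derivative_expSeries (succ_mul_invFact K) (constantCoeff_logSeries p)

theorem qSeries_eq_of_derivative {p : ℕ → K} {g : PowerSeries K}
    (hg : PowerSeries.derivative K g = g * PowerSeries.derivative K (logSeries p))
    (h0 : PowerSeries.constantCoeff g = 1) : qSeries p = g :=
  eq_of_derivative_eq_mul (isUnit_succ K) (derivative_qSeries p) hg
    (by rw [h0, constantCoeff_qSeries])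

theorem qSeries_add (p p' : ℕ → K) : qSeries (p + p') = qSeries p * qSeries p' := by
  refine qSeries_eq_of_derivative ?_ ?_
  · rw [Derivation.leibniz, derivative_qSeries, derivative_qSeries, logSeries_add, map_add,
      smul_eq_mul, smul_eq_mul]
    ring
  · rw [map_mul, constantCoeff_qSeries, constantCoeff_qSeries, one_mul]

theorem expHamK_phiK (p : ℕ → K) (n : ℤ) (z : K ⊗[CoeffRing] Fock) : expHamK p (phiK K n z) =
    act locallyZero_phiK (qSeries p) n (expHamK p z) :=
  expOp_vertex locallyZero_phiK (choose_mul_invFact K) (locallyNilpotent_hamK p) (hamK_phiK p)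
    (constantCoeff_logSeries p) n z

theorem expHamK_vac (p : ℕ → K) : expHamK p ((1 : K) ⊗ₜ vac) = 1 ⊗ₜ vac := by
  rw [expHamK, expOp_eq_sum _ _ (J := 1)]
  · simp [invFact_zero]
  · intro j hj
    obtain ⟨j, rfl⟩ := Nat.exists_eq_add_of_le' hj
    rw [pow_succ, Module.End.mul_apply, hamK_vac, map_zero]

theorem expHamK_phi_zero_vac (p : ℕ → K) :
    expHamK p (phiK K 0 ((1 : K) ⊗ₜ vac)) = phiK K 0 (1 ⊗ₜ vac) := by
  rw [expHamK_phiK, expHamK_vac, act_phiK_vac _ le_rfl, constantCoeff_qSeries, one_smul]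

/-- Both sides fix the vacuum and have the same vertex relation, since q is multiplicative.
Commutation of the two Hamiltonians is never needed. -/
theorem expHamK_add (p p' : ℕ → K) (z : K ⊗[CoeffRing] Fock) :
    expHamK (p + p') z = expHamK p (expHamK p' z) := by
  induction z using fockK_induction with
  | hvac => simp only [expHamK_vac]
  | hadd v w hv hw => simp only [map_add, hv, hw]
  | hsmul c v hv => simp only [map_smul, hv]
  | hphi n v hv =>
    rw [expHamK_phiK, expHamK_phiK, map_act locallyZero_phiK locallyZero_phiK (expHamK_phiK p),
      hv, qSeries_add, mul_comm]

/-- The extension to `K` of a linear functional on the Fock space. -/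
def braK (K : Type) [CommRing K] [Algebra CoeffRing K] (ψ : Fock →ₗ[CoeffRing] CoeffRing) :
    K ⊗[CoeffRing] Fock →ₗ[K] K :=
  (TensorProduct.AlgebraTensorModule.rid CoeffRing K K).toLinearMap ∘ₗ LinearMap.baseChange K ψ

theorem braK_tmul (ψ : Fock →ₗ[CoeffRing] CoeffRing) (a : K) (v : Fock) :
    braK K ψ (a ⊗ₜ v) = ψ v • a := by
  simp [braK]

/-- `⟨vac| e^H |v⟩` for given values of the odd power sums. -/
def vevK (p : ℕ → K) (v : Fock) : K := braK K vacBra (expHamK p (1 ⊗ₜ v))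

theorem vevK_add (p : ℕ → K) (v w : Fock) : vevK p (v + w) = vevK p v + vevK p w := by
  simp only [vevK, TensorProduct.tmul_add, map_add]

theorem vevK_smul (p : ℕ → K) (c : CoeffRing) (v : Fock) : vevK p (c • v) = c • vevK p v := by
  rw [vevK, one_tmul_smul, map_smul, map_smul, smul_eq_mul, ← Algebra.smul_def, vevK]

theorem vevK_vac (p : ℕ → K) : vevK p vac = 1 := by
  rw [vevK, expHamK_vac, braK_tmul, vacBra_vac, one_smul]

/-- Only the mode with the same index fails to commute, and there the weight 2/m in the Hamiltonian
cancels the central term m/2. -/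
theorem hamK_currentK_neg (p : ℕ → K) (k : ℕ) (z : K ⊗[CoeffRing] Fock) :
    hamK p (currentK K (-(2 * k + 1 : ℕ)) (by omega) z) =
      currentK K (-(2 * k + 1 : ℕ)) (by omega) (hamK p z) + p k • z := by
  have hf : (Function.support fun j : ℕ => if j = k then p k • z else 0).Finite :=
    (Set.finite_singleton k).subset fun i hi => by
      by_contra hne
      exact hi (if_neg hne)
  have hf' : (Function.support fun j : ℕ => currentK K (-(2 * k + 1 : ℕ)) (by omega)
      ((cst (2 / (2 * (j : ℂ) + 1)) • p j) •
        currentK K ((2 * j + 1 : ℕ) : ℤ) (by omega) z)).Finite :=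
    (finite_hamTerm _ z).subset (Function.support_comp_subset (map_zero _) _)
  have hs : p k • z = ∑ᶠ j : ℕ, if j = k then p k • z else 0 := by
    rw [finsum_eq_single _ k fun j hj => if_neg hj, if_pos rfl]
  rw [hs, hamK_apply, hamK_apply, map_finsum _ (finite_hamTerm _ z), ← finsum_add_distrib hf' hf]
  refine finsum_congr fun j => ?_
  rw [currentK_currentK_neg (odd_two_mul_add_one j) (odd_two_mul_add_one k), smul_add, map_smul,
    smul_smul]
  congr 1
  by_cases h : j = k
  · subst h
    rw [if_pos rfl, if_pos rfl]
    congr 1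
    rw [Algebra.smul_def, mul_right_comm, ← map_mul, ← map_mul]
    have : (2 / (2 * (j : ℂ) + 1) * ((2 * j + 1 : ℕ) / 2)) = 1 := by
      have : (2 * (j : ℂ) + 1) ≠ 0 := by exact_mod_cast Nat.succ_ne_zero (2 * j)
      push_cast
      field_simp
    rw [this, map_one, map_one, one_mul]
  · rw [if_neg (by omega), if_neg h, map_zero, mul_zero, zero_smul]

theorem braK_currentK_neg (k : ℕ) (z : K ⊗[CoeffRing] Fock) :
    braK K vacBra (currentK K (-(2 * k + 1 : ℕ)) (by omega) z) = 0 := by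
  induction z using TensorProduct.induction_on with
  | zero => simp
  | tmul a v => rw [currentK_tmul, braK_tmul, vacBra_current_neg (by omega), zero_smul]
  | add v w hv hw => rw [map_add, map_add, hv, hw, add_zero]

/-- Multiplication by a power sum is the action of a current mode. -/
theorem vevK_current_neg (p : ℕ → K) (k : ℕ) (v : Fock) :
    vevK p (current (-(2 * k + 1 : ℕ)) (by omega) v) = p k * vevK p v := by
  rw [vevK, ← currentK_tmul, expHamK, expOp_of_commutator_scalar (succ_mul_invFact K)
    (locallyNilpotent_hamK p) (hamK_currentK_neg p k), map_add, braK_currentK_neg, zero_add,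
    map_smul, smul_eq_mul]
  rfl

end BaseChange

/-! ### Naturality in the algebra of coefficients -/

section Naturality

variable {K K' : Type} [CommRing K] [Algebra CoeffRing K] [CommRing K'] [Algebra CoeffRing K']
  (f : K →ₐ[CoeffRing] K')

theorem map_invFact (k : ℕ) : f (invFact K k) = invFact K' k := f.commutes _

theorem map_logSeries (p : ℕ → K) :
    PowerSeries.map (f : K →+* K') (logSeries p) = logSeries fun k => f (p k) := by
  ext m
  rw [PowerSeries.coeff_map, logSeries, logSeries, PowerSeries.coeff_mk, PowerSeries.coeff_mk]
  split_ifs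
  · exact map_smul f _ _
  · exact map_zero f

theorem map_qSeries (p : ℕ → K) :
    PowerSeries.map (f : K →+* K') (qSeries p) = qSeries fun k => f (p k) := by
  ext m
  rw [PowerSeries.coeff_map, qSeries, qSeries, expSeries, expSeries, PowerSeries.coeff_mk,
    PowerSeries.coeff_mk, map_sum]
  refine Finset.sum_congr rfl fun i _ => ?_
  rw [map_mul, ← PowerSeries.coeff_map, map_pow, map_logSeries]
  congr 1
  exact map_invFact f i

theorem rTensor_phiK (n : ℤ) (z : K ⊗[CoeffRing] Fock) :
    LinearMap.rTensor Fock f.toLinearMap (phiK K n z) =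
      phiK K' n (LinearMap.rTensor Fock f.toLinearMap z) := by
  induction z using TensorProduct.induction_on with
  | zero => simp
  | tmul a v => rfl
  | add v w hv hw => simp only [map_add, hv, hw]

theorem rTensor_smul (a : K) (z : K ⊗[CoeffRing] Fock) :
    LinearMap.rTensor Fock f.toLinearMap (a • z) =
      f a • LinearMap.rTensor Fock f.toLinearMap z := by
  induction z using TensorProduct.induction_on with
  | zero => simp
  | tmul b v => simp [TensorProduct.smul_tmul']
  | add v w hv hw => simp only [map_add, hv, hw, smul_add]

theorem rTensor_act (g : PowerSeries K) (n : ℤ) (z : K ⊗[CoeffRing] Fock) :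
    LinearMap.rTensor Fock f.toLinearMap (act locallyZero_phiK g n z) =
      act locallyZero_phiK (PowerSeries.map (f : K →+* K') g) n
        (LinearMap.rTensor Fock f.toLinearMap z) := by
  rw [act_apply, act_apply, map_finsum _ (locallyZero_phiK.finite g n z)]
  simp only [rTensor_smul, rTensor_phiK, PowerSeries.coeff_map]
  rfl

/-- Both sides fix the vacuum, and their vertex relations agree because the coefficients of q are
natural in the power sums. -/
theorem rTensor_expHamK (p : ℕ → K) (z : K ⊗[CoeffRing] Fock) :
    LinearMap.rTensor Fock f.toLinearMap (expHamK p z) =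
      expHamK (fun k => f (p k)) (LinearMap.rTensor Fock f.toLinearMap z) := by
  induction z using fockK_induction with
  | hvac => simp [expHamK_vac]
  | hadd v w hv hw => simp only [map_add, hv, hw]
  | hsmul c v hv => rw [map_smul, rTensor_smul, rTensor_smul, map_smul, hv]
  | hphi n v hv =>
    rw [expHamK_phiK, rTensor_act, hv, map_qSeries, rTensor_phiK, expHamK_phiK]

theorem braK_rTensor (ψ : Fock →ₗ[CoeffRing] CoeffRing) (z : K ⊗[CoeffRing] Fock) :
    braK K' ψ (LinearMap.rTensor Fock f.toLinearMap z) = f (braK K ψ z) := by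
  induction z using TensorProduct.induction_on with
  | zero => simp
  | tmul a v => rw [LinearMap.rTensor_tmul, braK_tmul, braK_tmul, map_smul]; rfl
  | add v w hv hw => simp only [map_add, hv, hw]

theorem map_vevK (p : ℕ → K) (v : Fock) : f (vevK p v) = vevK (fun k => f (p k)) v := by
  rw [vevK, ← braK_rTensor, rTensor_expHamK]
  simp [vevK]

end Naturality

/-! ### Symmetric functions from the Fock space -/

/-- The odd power sums `p_{2k+1}(x)`. -/
def oddPowerSum (k : ℕ) : Series := powerSum (2 * k + 1)

theorem vev_eq_vevK (v : Fock) : vev v = vevK oddPowerSum v := by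
  have h1 : expHamiltonian (1 ⊗ₜ v) = expHamK oddPowerSum ((1 : Series) ⊗ₜ v) := by
    rw [expHamiltonian, expHamK, expOp_apply]
    refine finsum_congr fun k => ?_
    rw [invFact, algebraMap_smul, Module.End.pow_apply]
    rfl
  rw [vev, vevK, h1]
  generalize expHamK oddPowerSum ((1 : Series) ⊗ₜ[CoeffRing] v) = z
  induction z using TensorProduct.induction_on with
  | zero => simp
  | tmul a v => rw [braK_tmul]; simp
  | add v w hv hw => simp only [map_add, hv, hw]

/-- The map `v ↦ ⟨vac| e^{H(x)} |v⟩`, as a linear map. -/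
def vevLin : Fock →ₗ[CoeffRing] Series where
  toFun := vev
  map_add' v w := by simp only [vev_eq_vevK, vevK_add]
  map_smul' c v := by simp only [vev_eq_vevK, vevK_smul, RingHom.id_apply]

theorem vevLin_apply (v : Fock) : vevLin v = vev v := rfl

/-- The whole construction can be run with coefficients in `Gam` itself, which contains the odd
power sums; naturality along the inclusion then places the value in `Gam`. -/
theorem vev_mem_Gam (v : Fock) : vev v ∈ Gam := by
  have h := map_vevK Gam.val
    (fun k => ⟨oddPowerSum k, Algebra.subset_adjoin ⟨k, rfl⟩⟩ : ℕ → Gam) v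
  rw [vev_eq_vevK]
  have h2 := (vevK (fun k => ⟨oddPowerSum k, Algebra.subset_adjoin ⟨k, rfl⟩⟩ : ℕ → Gam) v).2
  rw [← Subalgebra.coe_val, h] at h2
  exact h2

theorem exists_vev_eq_of_mem_Gam {g : Series} (hg : g ∈ Gam) : ∃ v, vev v = g := by
  -- Quantifying over w makes the claim stable under products of the generators; a generator acts
  -- through the mode H_{-m}.
  suffices h : ∀ w, ∃ v, vev v = g * vev w by
    obtain ⟨v, hv⟩ := h vac
    exact ⟨v, by rw [hv, vev_eq_vevK, vevK_vac, mul_one]⟩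
  induction hg using Algebra.adjoin_induction with
  | mem g hg =>
    obtain ⟨k, rfl⟩ := hg
    intro w
    exact ⟨_, by simp only [vev_eq_vevK]; exact vevK_current_neg oddPowerSum k w⟩
  | algebraMap c =>
    intro w
    exact ⟨c • w, by rw [← vevLin_apply, map_smul, Algebra.smul_def]; rfl⟩
  | add g h _ _ hg hh =>
    intro w
    obtain ⟨v, hv⟩ := hg w
    obtain ⟨u, hu⟩ := hh w
    exact ⟨v + u, by rw [← vevLin_apply, map_add, vevLin_apply, vevLin_apply, hv, hu, add_mul]⟩
  | mul g h _ _ hg hh =>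
    intro w
    obtain ⟨u, hu⟩ := hh w
    obtain ⟨v, hv⟩ := hg u
    exact ⟨v, by rw [hv, hu, mul_assoc]⟩

/-! ### Homogeneous series with constant coefficients -/

theorem coeff_specializeZero (d : ℕ →₀ ℕ) (s : Series) :
    MvPowerSeries.coeff d (specializeZero s) =
      cst (MvPolynomial.constantCoeff (MvPowerSeries.coeff d s)) := rfl

/-- The homogeneous series of degree `e` with coefficients in `ℂ`. -/
def homogFixed (e : ℤ) : AddSubgroup Series where
  carrier := {s | (∀ d, MvPowerSeries.coeff d s ≠ 0 → (d.degree : ℤ) = e) ∧ specializeZero s = s}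
  add_mem' {s t} hs ht := by
    refine ⟨fun d hd => ?_, by rw [map_add, hs.2, ht.2]⟩
    by_contra hne
    refine hd ?_
    rw [map_add, by_contra fun h => hne (hs.1 d h), by_contra fun h => hne (ht.1 d h), add_zero]
  zero_mem' := ⟨fun d hd => absurd (map_zero _) hd, map_zero _⟩
  neg_mem' {s} hs := ⟨fun d hd => hs.1 d (by rwa [map_neg, neg_ne_zero] at hd), by
    rw [map_neg, hs.2]⟩

theorem one_mem_homogFixed : (1 : Series) ∈ homogFixed 0 := by
  classical
  refine ⟨fun d hd => ?_, map_one _⟩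
  rw [MvPowerSeries.coeff_one] at hd
  by_cases h : d = 0
  · simp [h]
  · rw [if_neg h] at hd
    exact absurd rfl hd

theorem mul_mem_homogFixed {e e' : ℤ} {s t : Series} (hs : s ∈ homogFixed e)
    (ht : t ∈ homogFixed e') : s * t ∈ homogFixed (e + e') := by
  classical
  refine ⟨fun d hd => ?_, by rw [map_mul, hs.2, ht.2]⟩
  rw [MvPowerSeries.coeff_mul] at hd
  obtain ⟨p, hp, hne⟩ := Finset.exists_ne_zero_of_sum_ne_zero hd
  rw [← Finset.HasAntidiagonal.mem_antidiagonal.1 hp, map_add, Nat.cast_add,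
    hs.1 _ (left_ne_zero_of_mul hne), ht.1 _ (right_ne_zero_of_mul hne)]

theorem specializeZero_smul (c : CoeffRing) (s : Series) :
    specializeZero (c • s) = cst (MvPolynomial.constantCoeff c) • specializeZero s := by
  ext1 d
  rw [coeff_specializeZero, MvPowerSeries.coeff_smul, MvPowerSeries.coeff_smul, map_mul, cst, map_mul,
    coeff_specializeZero]

theorem cst_smul_mem_homogFixed {e : ℤ} {s : Series} (c : ℂ) (hs : s ∈ homogFixed e) :
    cst c • s ∈ homogFixed e := by
  refine ⟨fun d hd => hs.1 d ?_, ?_⟩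
  · rw [MvPowerSeries.coeff_smul] at hd
    exact right_ne_zero_of_mul hd
  · rw [specializeZero_smul, hs.2, MvPolynomial.constantCoeff_C]

theorem powerSum_mem_homogFixed (m : ℕ) : powerSum m ∈ homogFixed m := by
  classical
  have h : ∀ d, MvPowerSeries.coeff d (powerSum m) =
      if ∃ i : ℕ, d = Finsupp.single i m then 1 else 0 := fun d => by
    change powerSum m d = _
    unfold powerSum
    congr
  refine ⟨fun d hd => ?_, ?_⟩
  · rw [h] at hd
    split_ifs at hd with hi
    · obtain ⟨i, rfl⟩ := hi
      simp
    · exact absurd rfl hd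
  · ext1 d
    rw [coeff_specializeZero, h]
    split_ifs <;> simp

theorem coeff_logSeries_mem_homogFixed (m : ℕ) :
    PowerSeries.coeff m (logSeries oddPowerSum) ∈ homogFixed m := by
  rw [logSeries, PowerSeries.coeff_mk]
  split_ifs with h
  · refine cst_smul_mem_homogFixed _ ?_
    have : oddPowerSum (m / 2) = powerSum m := by
      rw [oddPowerSum, Nat.two_mul_div_two_add_one_of_odd h]
    rw [this]
    exact powerSum_mem_homogFixed m
  · exact zero_mem _

theorem coeff_pow_logSeries_mem_homogFixed (i m : ℕ) :
    PowerSeries.coeff m (logSeries oddPowerSum ^ i) ∈ homogFixed m := by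
  induction i generalizing m with
  | zero =>
    rw [pow_zero, PowerSeries.coeff_one]
    split_ifs with h
    · subst h; exact one_mem_homogFixed
    · exact zero_mem _
  | succ i ih =>
    rw [pow_succ, PowerSeries.coeff_mul]
    refine sum_mem fun p hp => ?_
    rw [← Finset.HasAntidiagonal.mem_antidiagonal.1 hp, Nat.cast_add]
    exact mul_mem_homogFixed (ih _) (coeff_logSeries_mem_homogFixed _)

theorem coeff_qSeries_mem_homogFixed (m : ℕ) :
    PowerSeries.coeff m (qSeries oddPowerSum) ∈ homogFixed m := by
  rw [qSeries, expSeries, PowerSeries.coeff_mk]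
  refine sum_mem fun i _ => ?_
  rw [invFact, ← Algebra.smul_def]
  exact cst_smul_mem_homogFixed _ (coeff_pow_logSeries_mem_homogFixed i m)

/-- The additive group generated by the `s ⊗ word l`, with `s` homogeneous with coefficients in
`ℂ`, of total degree `d` and with `l` of length `p`. -/
def gradedWords (d : ℤ) (p : ℕ) : AddSubgroup FockX :=
  AddSubgroup.closure {z | ∃ (e : ℤ) (s : Series) (l : List ℤ), s ∈ homogFixed e ∧
    e + l.sum = d ∧ l.length = p ∧ z = s ⊗ₜ word l}

theorem smul_phiK_mem_gradedWords {m : ℕ} {s : Series} (hs : s ∈ homogFixed m) (n : ℤ) {d : ℤ}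
    {p : ℕ} {z : FockX} (hz : z ∈ gradedWords d p) :
    s • phiK Series (n - m) z ∈ gradedWords (n + d) (p + 1) := by
  induction hz using AddSubgroup.closure_induction with
  | mem z hz =>
    obtain ⟨e, t, l, ht, hd, rfl, rfl⟩ := hz
    rw [phiK_tmul, TensorProduct.smul_tmul', smul_eq_mul, ← word_cons]
    refine AddSubgroup.subset_closure ⟨m + e, s * t, _, mul_mem_homogFixed hs ht, ?_, rfl, rfl⟩
    rw [List.sum_cons, ← hd]
    ring
  | zero => simp
  | add v w _ _ hv hw => rw [map_add, smul_add]; exact add_mem hv hw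
  | neg v _ hv => rw [map_neg, smul_neg]; exact neg_mem hv

/-- The coefficient of t^m in q has degree m and comes with φ_{n-m}, so the degree in x plus the
degree of the word is preserved, and so is the number of letters. -/
theorem expHamK_word_mem_gradedWords (l : List ℤ) :
    expHamK oddPowerSum (1 ⊗ₜ word l) ∈ gradedWords l.sum l.length := by
  induction l with
  | nil =>
    rw [word_nil, expHamK_vac]
    exact AddSubgroup.subset_closure ⟨0, 1, [], one_mem_homogFixed, rfl, rfl, rfl⟩
  | cons n l ih =>
    obtain ⟨N, hN⟩ := locallyZero_phiK.exists_nat n (expHamK oddPowerSum (1 ⊗ₜ word l))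
    rw [word_cons, ← phiK_tmul, expHamK_phiK, act_eq_sum locallyZero_phiK _ hN, List.sum_cons,
      List.length_cons]
    exact sum_mem fun m _ => smul_phiK_mem_gradedWords (coeff_qSeries_mem_homogFixed m) n ih

/-- Only words of degree 0 have a nonzero vacuum value, and it is an integer. So the value has the
degree of the word, and its coefficients are unaffected by setting a = 0. -/
theorem vev_word_mem_homogFixed (l : List ℤ) : vev (word l) ∈ homogFixed l.sum := by
  rw [vev_eq_vevK, vevK]
  have h := expHamK_word_mem_gradedWords l
  generalize expHamK oddPowerSum (1 ⊗ₜ word l) = z at h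
  induction h using AddSubgroup.closure_induction with
  | mem z hz =>
    obtain ⟨e, s, l', hs, hd, -, rfl⟩ := hz
    rw [braK_tmul]
    by_cases h0 : l'.sum = 0
    · obtain ⟨c, hc⟩ := exists_vacBra_word_eq_intCast l'
      rw [hc, Int.cast_smul_eq_zsmul, ← hd, h0, add_zero]
      exact zsmul_mem hs c
    · rw [vacBra_word_eq_zero fun h => h0 h.1, zero_smul]
      exact zero_mem _
  | zero => rw [map_zero]; exact zero_mem _
  | add v w _ _ hv hw => rw [map_add]; exact add_mem hv hw
  | neg v _ hv => rw [map_neg]; exact neg_mem hv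

theorem vev_word_eq_zero_of_odd {l : List ℤ} (hl : ¬ l.length % 2 = 0) : vev (word l) = 0 := by
  rw [vev_eq_vevK, vevK]
  have h := expHamK_word_mem_gradedWords l
  generalize expHamK oddPowerSum (1 ⊗ₜ word l) = z at h
  induction h using AddSubgroup.closure_induction with
  | mem z hz =>
    obtain ⟨e, s, l', hs, hd, hl', rfl⟩ := hz
    rw [braK_tmul, vacBra_word_eq_zero (fun h => hl (by rw [← hl', h.2])), zero_smul]
  | zero => rw [map_zero]
  | add v w _ _ hv hw => rw [map_add, hv, hw, add_zero]
  | neg v _ hv => rw [map_neg, hv, neg_zero]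

theorem coeff_component (k : ℕ) (f : Series) (d : ℕ →₀ ℕ) :
    MvPowerSeries.coeff d (component k f) =
      if d.degree = k then MvPowerSeries.coeff d f else 0 := rfl

theorem coeff_vev_eq_zero {d : ℤ} {v : Fock} (hv : v ∈ fockDeg d) {n : ℕ →₀ ℕ}
    (hn : (n.degree : ℤ) ≠ d) : MvPowerSeries.coeff n (vev v) = 0 := by
  rw [← vevLin_apply]
  induction hv using Submodule.span_induction with
  | mem v hv =>
    obtain ⟨l, rfl, rfl⟩ := hv
    by_contra h
    exact hn ((vev_word_mem_homogFixed l).1 n h)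
  | zero => rw [map_zero, map_zero]
  | add v w _ _ hv hw => rw [map_add, map_add, hv, hw, add_zero]
  | smul c v _ hv => rw [map_smul, MvPowerSeries.coeff_smul, hv, mul_zero]

/-- By homogeneity a monomial occurs only in the term of its own degree, so the formal sum over d is
harmless. -/
theorem coeff_vevHat (v : FockHat) (n : ℕ →₀ ℕ) :
    MvPowerSeries.coeff n (vevHat v) = MvPowerSeries.coeff n (vev (v.1 n.degree)) := by
  change ∑ᶠ d : ℕ, MvPowerSeries.coeff n (vev (v.1 d)) = _
  rw [finsum_eq_single _ n.degree fun d hd => ?_]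
  exact coeff_vev_eq_zero (v.2 d) (by exact_mod_cast hd.symm)

theorem component_vevHat (v : FockHat) (k : ℕ) : component k (vevHat v) = vev (v.1 k) := by
  ext1 d
  rw [coeff_component]
  split_ifs with h
  · rw [coeff_vevHat, h]
  · rw [coeff_vev_eq_zero (v.2 k) (by exact_mod_cast h)]

theorem isInGamHat_vevHat (v : FockHat) : IsInGamHat (vevHat v) := fun k => by
  rw [component_vevHat]
  exact vev_mem_Gam _

/-! ### One variable -/

section Geometric

variable {K : Type} [CommRing K] [Algebra CoeffRing K]

/-- The geometric series `∑ x^m t^m`. -/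
def geom (x : K) : PowerSeries K := PowerSeries.mk fun m => x ^ m

omit [Algebra CoeffRing K] in
theorem coeff_geom (x : K) (m : ℕ) : PowerSeries.coeff m (geom x) = x ^ m :=
  PowerSeries.coeff_mk _ _

omit [Algebra CoeffRing K] in
theorem constantCoeff_geom (x : K) : PowerSeries.constantCoeff (geom x) = 1 := by
  rw [← PowerSeries.coeff_zero_eq_constantCoeff_apply, coeff_geom, pow_zero]

omit [Algebra CoeffRing K] in
theorem geom_eq (x : K) : geom x = 1 + x • (PowerSeries.X * geom x) := by
  ext m
  cases m with
  | zero => simp [coeff_geom]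
  | succ m =>
    rw [map_add, PowerSeries.coeff_smul, PowerSeries.coeff_succ_X_mul, coeff_geom, coeff_geom,
      PowerSeries.coeff_one, if_neg (Nat.succ_ne_zero m), zero_add, smul_eq_mul, pow_succ']

omit [Algebra CoeffRing K] in
theorem one_sub_mul_geom (x : K) : (1 - PowerSeries.C x * PowerSeries.X) * geom x = 1 := by
  have h := geom_eq x
  rw [PowerSeries.smul_eq_C_mul] at h
  linear_combination h

omit [Algebra CoeffRing K] in
theorem derivative_geom (x : K) : PowerSeries.derivative K (geom x) =
    PowerSeries.C x * geom x ^ 2 := by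
  have h := one_sub_mul_geom x
  have h' := congrArg (PowerSeries.derivative K) h
  rw [Derivation.leibniz, Derivation.map_one_eq_zero, map_sub, Derivation.map_one_eq_zero,
    ← PowerSeries.smul_eq_C_mul, Derivation.map_smul, PowerSeries.derivative_X, smul_eq_mul, smul_eq_mul,
    PowerSeries.smul_eq_C_mul, PowerSeries.smul_eq_C_mul] at h'
  linear_combination geom x * h' - PowerSeries.derivative K (geom x) * h

theorem derivative_logSeries_pow (x : K) :
    PowerSeries.derivative K (logSeries fun k => x ^ (2 * k + 1)) =
      PowerSeries.C x * (geom x + geom (-x)) := by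
  ext m
  rw [PowerSeries.coeff_derivative, PowerSeries.coeff_C_mul, map_add, coeff_geom, coeff_geom]
  rcases Nat.even_or_odd m with hm | hm
  · obtain ⟨k, rfl⟩ := even_iff_exists_two_mul.1 hm
    rw [coeff_logSeries_odd, Even.neg_pow hm, Algebra.smul_def]
    have : ((2 * k : ℕ) + 1 : K) = algebraMap CoeffRing K (cst (2 * (k : ℂ) + 1)) := by
      simp [map_ofNat]
    rw [this, mul_right_comm, ← map_mul, ← map_mul, div_mul_cancel₀ _ (by
      exact_mod_cast Nat.succ_ne_zero (2 * k))]
    rw [map_ofNat, map_ofNat]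
    ring
  · rw [coeff_logSeries_not_odd _ (by rw [Nat.not_odd_iff_even]; exact hm.add_one), Odd.neg_pow hm,
      add_neg_cancel, mul_zero, zero_mul]

/-- In one variable q(t) = (1 + x t)/(1 - x t) = 2/(1 - x t) - 1, because the logarithmic derivative
is x/(1 - x t) + x/(1 + x t). -/
theorem qSeries_pow (x : K) : qSeries (fun k => x ^ (2 * k + 1)) = 2 * geom x - 1 := by
  refine qSeries_eq_of_derivative ?_ ?_
  · have h := one_sub_mul_geom x
    have h' := one_sub_mul_geom (-x)
    have h2 : PowerSeries.derivative K (2 * geom x - 1) = 2 * PowerSeries.derivative K (geom x) := by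
      rw [two_mul, two_mul, map_sub, map_add, Derivation.map_one_eq_zero, sub_zero]
    rw [h2, derivative_logSeries_pow, derivative_geom]
    rw [map_neg] at h'
    linear_combination -PowerSeries.C x * geom (-x) * h - PowerSeries.C x * geom x * h'
  · rw [map_sub, map_mul, constantCoeff_geom, map_one, map_ofNat]
    norm_num

theorem act_geom (x : K) (n : ℤ) (z : K ⊗[CoeffRing] Fock) : act locallyZero_phiK (geom x) n z =
    phiK K n z + x • act locallyZero_phiK (geom x) (n - 1) z := by
  conv_lhs => rw [geom_eq, act_add, act_one, act_smul, act_mul,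
    finsum_eq_single _ 1 fun m hm => by rw [PowerSeries.coeff_X, if_neg hm, zero_smul]]
  rw [PowerSeries.coeff_one_X, one_smul, Nat.cast_one]

theorem act_phiK_add_phiK_act (g : PowerSeries K) {m n : ℤ} {k : ℕ} (h : m + n = k)
    (z : K ⊗[CoeffRing] Fock) :
    act locallyZero_phiK g m (phiK K n z) + phiK K n (act locallyZero_phiK g m z) =
      (PowerSeries.coeff k g * algebraMap CoeffRing K (2 * sgn n)) • z := by
  have hf := (locallyZero_phiK.finite g m z)
  have hf' : (Function.support fun j : ℕ =>
      phiK K n (PowerSeries.coeff j g • phiK K (m - j) z)).Finite :=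
    hf.subset (Function.support_comp_subset (map_zero _) _)
  rw [act_apply, act_apply, map_finsum _ hf,
    ← finsum_add_distrib (locallyZero_phiK.finite g m _) hf', finsum_eq_single _ k fun j hj => ?_]
  · rw [map_smul, ← smul_add, phiK_anticomm, if_pos (by omega), smul_smul,
      show m - (k : ℤ) = -n by omega, sgn_neg]
  · rw [map_smul, ← smul_add, phiK_anticomm, if_neg (by omega), map_zero, zero_smul, smul_zero]

theorem algebraMap_two_mul_sgn_zero : algebraMap CoeffRing K (2 * sgn 0) = 2 := by
  simp [sgn, map_ofNat]

theorem act_zero_phiK_neg (g : PowerSeries K) (j : ℕ) (z : K ⊗[CoeffRing] Fock) :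
    act locallyZero_phiK g 0 (phiK K (0 - j) z) + phiK K (0 - j) (act locallyZero_phiK g 0 z) =
      (if j = 0 then PowerSeries.constantCoeff g * 2 else 0) • z := by
  by_cases hj : j = 0
  · subst hj
    rw [if_pos rfl, act_phiK_add_phiK_act g (k := 0) (by simp)]
    simp [sgn, map_ofNat]
  · rw [if_neg hj, zero_smul]
    have hf := (locallyZero_phiK.finite g 0 z)
    have hf' : (Function.support fun i : ℕ =>
        phiK K (0 - j) (PowerSeries.coeff i g • phiK K (0 - i) z)).Finite :=
      hf.subset (Function.support_comp_subset (map_zero _) _)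
    rw [act_apply, act_apply, map_finsum _ hf,
      ← finsum_add_distrib (locallyZero_phiK.finite g 0 _) hf',
      finsum_eq_zero_of_forall_eq_zero fun i => ?_]
    rw [map_smul, ← smul_add, phiK_anticomm, if_neg (by omega), map_zero, zero_smul, smul_zero]

theorem eq_of_add_self_eq_two_smul {v w : K ⊗[CoeffRing] Fock} (h : v + v = (2 : K) • w) :
    v = w := by
  refine eq_of_add_self_eq ?_
  rw [h, ← algebraMap_smul K (2 : CoeffRing), map_ofNat]

/-- The square of ∑ g_i φ_{-i}, i ≥ 0, is half its anticommutator with itself. Among modes of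
nonpositive index only φ_0 contracts, with itself, so the square is g_0^2 = 1. -/
theorem act_zero_act_zero {g : PowerSeries K} (hg : PowerSeries.constantCoeff g = 1)
    (z : K ⊗[CoeffRing] Fock) :
    act locallyZero_phiK g 0 (act locallyZero_phiK g 0 z) = z := by
  have hf := (locallyZero_phiK.finite g 0 z)
  have hf' : (Function.support fun i : ℕ =>
      act locallyZero_phiK g 0 (PowerSeries.coeff i g • phiK K (0 - i) z)).Finite :=
    hf.subset (Function.support_comp_subset (map_zero _) _)
  refine eq_of_add_self_eq_two_smul ?_
  have e1 : act locallyZero_phiK g 0 (act locallyZero_phiK g 0 z) =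
      ∑ᶠ i : ℕ, act locallyZero_phiK g 0 (PowerSeries.coeff i g • phiK K (0 - i) z) := by
    rw [act_apply locallyZero_phiK g 0 z, map_finsum _ hf]
  have e2 : act locallyZero_phiK g 0 (act locallyZero_phiK g 0 z) =
      ∑ᶠ i : ℕ, PowerSeries.coeff i g • phiK K (0 - i) (act locallyZero_phiK g 0 z) := rfl
  conv_lhs => lhs; rw [e1]
  rw [e2, ← finsum_add_distrib hf' (locallyZero_phiK.finite g 0 _),
    finsum_eq_single _ 0 fun i hi => ?_]
  · rw [map_smul, ← smul_add, act_zero_phiK_neg, if_pos rfl,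
      PowerSeries.coeff_zero_eq_constantCoeff_apply, hg, one_smul, one_mul]
  · rw [map_smul, ← smul_add, act_zero_phiK_neg, if_neg hi, zero_smul, smul_zero]

variable {ψ : K ⊗[CoeffRing] Fock →ₗ[K] K}

theorem apply_act_geom_act_geom (hψ : ∀ n z, 0 < n → ψ (phiK K n z) = 0) (x : K) (n : ℕ)
    (z : K ⊗[CoeffRing] Fock) :
    ψ (act locallyZero_phiK (geom x) 0 (act locallyZero_phiK (geom x) n z)) =
      (-x) ^ n * ψ z := by
  induction n with
  | zero => rw [Nat.cast_zero, act_zero_act_zero (constantCoeff_geom x), pow_zero, one_mul]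
  | succ n ih =>
    have h := act_phiK_add_phiK_act (geom x) (m := 0) (n := (n + 1 : ℕ)) (zero_add _) z
    have h' := congrArg ψ h
    rw [map_add, hψ _ _ (by omega), add_zero, map_smul, coeff_geom, map_mul, map_ofNat,
      smul_eq_mul] at h'
    have hs : algebraMap CoeffRing K (sgn (n + 1 : ℕ)) = (-1) ^ (n + 1) := by
      rw [sgn, Int.natAbs_natCast, map_pow, map_neg, map_one]
    -- Peeling off the mode n + 1 leaves its contraction 2(-x)^{n+1}, while the rest is x(-x)^n =
    -- -(-x)^{n+1} by induction.
    rw [act_geom x ((n + 1 : ℕ) : ℤ), map_add, map_add, map_smul, map_smul, h',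
      show ((n + 1 : ℕ) : ℤ) - 1 = n by push_cast; ring, ih, hs, smul_eq_mul, neg_pow x, neg_pow x]
    ring

/-- Annihilation of a variable: `⟨ψ| (∑_i x^i φ_{-i}) e^{H(x)} = ⟨ψ| φ_0` in one variable `x`, if
`⟨ψ| φ_n = 0` for `n > 0`. -/
theorem apply_act_geom_expHamK (hψ : ∀ n z, 0 < n → ψ (phiK K n z) = 0) (x : K)
    (z : K ⊗[CoeffRing] Fock) :
    ψ (act locallyZero_phiK (geom x) 0 (expHamK (fun k => x ^ (2 * k + 1)) z)) =
      ψ (phiK K 0 z) := by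
  induction z using TensorProduct.induction_on with
  | zero => simp
  | add v w hv hw => simp only [map_add, hv, hw]
  | tmul a v =>
    rw [tmul_eq_smul]
    simp only [map_smul]
    congr 1
    induction v using fock_induction_normal with
    | hadd v w hv hw => simp only [TensorProduct.tmul_add, map_add, hv, hw]
    | hsmul c v hv => simp only [one_tmul_smul, map_smul, hv]
    | hvac => rw [expHamK_vac, act_phiK_vac _ le_rfl, constantCoeff_geom, one_smul]
    | hzero =>
      rw [← phiK_tmul, expHamK_phi_zero_vac]
      have h := act_zero_phiK_neg (geom x) 0 ((1 : K) ⊗ₜ vac)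
      have h0 := phiK_anticomm (K := K) 0 0 (1 ⊗ₜ vac)
      rw [if_pos (zero_add _), algebraMap_two_mul_sgn_zero] at h0
      rw [if_pos rfl, constantCoeff_geom, one_mul, act_phiK_vac _ le_rfl, constantCoeff_geom,
        one_smul, Nat.cast_zero, sub_zero, ← h0] at h
      rw [add_right_cancel h]
    | hphi n v hn =>
      -- For a vector φ_n v with n > 0 both sides vanish. The right side does because φ_n moves past
      -- φ_0 to ψ.
      have hr : ψ (phiK K 0 (phiK K n ((1 : K) ⊗ₜ v))) = 0 := by
        have h := phiK_anticomm (K := K) 0 n (1 ⊗ₜ v)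
        rw [if_neg (by omega), map_zero, zero_smul] at h
        rw [eq_neg_of_add_eq_zero_left h, map_neg, hψ _ _ hn, neg_zero]
      obtain ⟨k, rfl⟩ : ∃ k : ℕ, n = (k + 1 : ℕ) := ⟨(n - 1).toNat, by omega⟩
      rw [← phiK_tmul, hr, expHamK_phiK, qSeries_pow]
      have h2 : (2 * geom x - 1 : PowerSeries K) = geom x + geom x + PowerSeries.C (-1) := by
        rw [map_neg, map_one]
        ring
      rw [h2, act_add, act_add, act_C, neg_one_smul, map_add, map_add, map_add, map_add]
      generalize expHamK (fun k => x ^ (2 * k + 1)) ((1 : K) ⊗ₜ[CoeffRing] v) = y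
      -- With G_n the n-th coefficient of the geometric series times φ(t), φ_n = G_n - x G_{n-1}.
      -- Hence 2 G_n - φ_n = G_n + x G_{n-1}, and ψ G_0 sends it to (-x)^n + x(-x)^{n-1} = 0 times ψ
      -- y.
      have h3 := apply_act_geom_act_geom hψ x (k + 1) y
      have h4 := apply_act_geom_act_geom hψ x k y
      have h5 := congrArg (fun w => ψ (act locallyZero_phiK (geom x) 0 w))
        (act_geom x ((k + 1 : ℕ) : ℤ) y)
      simp only [map_add, map_smul, smul_eq_mul] at h5
      rw [show ((k + 1 : ℕ) : ℤ) - 1 = k by push_cast; ring, h4] at h5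
      rw [map_neg, map_neg]
      linear_combination h3 + h5

end Geometric

/-! ### Several variables -/

section PartialFractions

variable {K ι : Type} [Field K] [DecidableEq ι] (x : ι → K)

/-- The coefficient `∏_{l ∈ X, l ≠ k} (x_k + x_l)/(x_k - x_l)`. -/
def residue (X : Finset ι) (k : ι) : K := ∏ l ∈ X.erase k, (x k + x l) / (x k - x l)

variable {x}

theorem residue_insert_of_mem {X : Finset ι} {w k : ι} (hw : w ∉ X) (hk : k ∈ X) :
    residue x (insert w X) k = (x k + x w) / (x k - x w) * residue x X k := by
  have hne : w ≠ k := by rintro rfl; exact hw hk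
  rw [residue, Finset.erase_insert_of_ne hne, Finset.prod_insert (by simp [hw]), residue]

theorem residue_insert_self {X : Finset ι} {w : ι} (hw : w ∉ X) :
    residue x (insert w X) w = ∏ l ∈ X, (x w + x l) / (x w - x l) := by
  rw [residue, Finset.erase_insert hw]

/-- Partial fractions in y: the constant is the value at y = 0, the other coefficients come from the
poles. The induction on X needs the identity at y = x_w as well, hence the quantifier over y. -/
theorem prod_add_div_sub_eq (hx : Function.Injective x) (X : Finset ι) :
    ∀ y : K, (∀ k ∈ X, y ≠ x k) → ∏ l ∈ X, (y + x l) / (y - x l) =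
      (-1) ^ X.card + ∑ k ∈ X, 2 * residue x X k * (y / (y - x k)) := by
  induction X using Finset.induction_on with
  | empty => intro y _; simp
  | insert w X hw ih =>
    intro y hy
    have h1 : y - x w ≠ 0 := sub_ne_zero.2 (hy w (by simp))
    have hne : ∀ k ∈ X, x w ≠ x k := fun k hk h => hw (hx h ▸ hk)
    have hk : ∀ k ∈ X, (y + x w) / (y - x w) * (2 * residue x X k * (y / (y - x k))) =
        2 * (2 * residue x X k * (x w / (x w - x k))) * (y / (y - x w)) +
          2 * residue x (insert w X) k * (y / (y - x k)) := by
      intro k hk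
      have h2 : y - x k ≠ 0 := sub_ne_zero.2 (hy k (by simp [hk]))
      have h4 : x w - x k ≠ 0 := sub_ne_zero.2 (hne k hk)
      have h5 : (x k - x w)⁻¹ = -(x w - x k)⁻¹ := by rw [← inv_neg, neg_sub]
      rw [residue_insert_of_mem hw hk, div_eq_mul_inv (x k + x w), h5]
      field_simp
      ring
    have e : (y + x w) / (y - x w) * (-1) ^ X.card =
        (-1) ^ (X.card + 1) + 2 * (-1) ^ X.card * (y / (y - x w)) := by
      field_simp
      ring
    rw [Finset.prod_insert hw, ih y fun k hk => hy k (by simp [hk]), Finset.sum_insert hw,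
      residue_insert_self hw, ih (x w) hne, Finset.card_insert_of_notMem hw, mul_add, Finset.mul_sum,
      Finset.sum_congr rfl hk, Finset.sum_add_distrib, e, mul_add, add_mul, Finset.mul_sum,
      Finset.sum_mul]
    ring

variable [Algebra CoeffRing K]

omit [Algebra CoeffRing K] in
theorem geom_mul_geom {y z : K} (h : y ≠ z) : geom y * geom z =
    (y / (y - z)) • geom y - (z / (y - z)) • geom z := by
  have h0 : y - z ≠ 0 := sub_ne_zero.2 h
  have hy := one_sub_mul_geom y
  have hz := one_sub_mul_geom z
  have e : (y - z) • (geom y * geom z) = y • geom y - z • geom z := by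
    simp only [PowerSeries.smul_eq_C_mul, map_sub]
    linear_combination PowerSeries.C y * geom y * hz - PowerSeries.C z * geom z * hy
  rw [div_eq_inv_mul, div_eq_inv_mul, mul_smul, mul_smul, ← smul_sub, ← e, smul_smul,
    inv_mul_cancel₀ h0, one_smul]

/-- The odd power sums of the variables with index in `X`. -/
def psums (x : ι → K) (X : Finset ι) (k : ℕ) : K := ∑ i ∈ X, x i ^ (2 * k + 1)

omit [Algebra CoeffRing K] in
theorem psums_insert {X : Finset ι} {w : ι} (hw : w ∉ X) :
    psums x (insert w X) = (fun k => x w ^ (2 * k + 1)) + psums x X := by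
  ext k
  rw [psums, Finset.sum_insert hw, Pi.add_apply, psums]

/-- Partial fraction expansion of ∏ (1 + x_k t)/(1 - x_k t), one factor at a time. The coefficient
collected at a new variable x_w is evaluated by `prod_add_div_sub_eq` at y = x_w. -/
theorem qSeries_psums (hx : Function.Injective x) (X : Finset ι) : qSeries (psums x X) =
    PowerSeries.C ((-1) ^ X.card) + ∑ k ∈ X, (2 * residue x X k) • geom (x k) := by
  induction X using Finset.induction_on with
  | empty =>
    refine qSeries_eq_of_derivative ?_ (by simp)
    have : logSeries (psums x (∅ : Finset ι)) = 0 := by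
      ext m
      rw [logSeries, PowerSeries.coeff_mk]
      split_ifs <;> simp [psums]
    rw [this]
    simp
  | insert w X hw ih =>
    have hne : ∀ k ∈ X, x w ≠ x k := fun k hk h => hw (hx h ▸ hk)
    have hk : ∀ k ∈ X, (2 * geom (x w) - 1) * (2 * residue x X k) • geom (x k) =
        (2 * (2 * residue x X k * (x w / (x w - x k)))) • geom (x w) +
          (2 * residue x (insert w X) k) • geom (x k) := by
      intro k hk
      have h4 : x w - x k ≠ 0 := sub_ne_zero.2 (hne k hk)
      have h5 : (x k - x w)⁻¹ = -(x w - x k)⁻¹ := by rw [← inv_neg, neg_sub]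
      have e : (2 * geom (x w) - 1) * (2 * residue x X k) • geom (x k) =
          (2 * (2 * residue x X k)) • (geom (x w) * geom (x k)) -
            (2 * residue x X k) • geom (x k) := by
        simp only [PowerSeries.smul_eq_C_mul, map_mul, map_ofNat]
        ring
      rw [e, geom_mul_geom (hne k hk), residue_insert_of_mem hw hk, smul_sub, smul_smul, smul_smul,
        sub_sub, ← add_smul, sub_eq_add_neg, ← neg_smul]
      congr 2
      · ring
      · rw [div_eq_mul_inv (x k + x w), h5]
        field_simp
        ring
    rw [psums_insert hw, qSeries_add, ih, qSeries_pow, mul_add, Finset.mul_sum,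
      Finset.sum_congr rfl hk, Finset.sum_add_distrib, Finset.sum_insert hw, residue_insert_self hw,
      prod_add_div_sub_eq hx X _ hne, Finset.card_insert_of_notMem hw, ← Finset.sum_smul,
      ← Finset.mul_sum, mul_add, add_smul, pow_succ]
    simp only [PowerSeries.smul_eq_C_mul, map_mul, map_ofNat, map_pow, map_neg, map_one]
    ring

variable {ψ : K ⊗[CoeffRing] Fock →ₗ[K] K}

theorem apply_act_geom_of_pos (hψ : ∀ n z, 0 < n → ψ (phiK K n z) = 0) (y : K) (m : ℕ)
    (z : K ⊗[CoeffRing] Fock) : ψ (act locallyZero_phiK (geom y) m z) =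
      y ^ m * ψ (act locallyZero_phiK (geom y) 0 z) := by
  induction m with
  | zero => simp
  | succ m ih =>
    rw [act_geom, map_add, hψ _ _ (by omega), zero_add, map_smul,
      show ((m + 1 : ℕ) : ℤ) - 1 = m by push_cast; ring, ih, smul_eq_mul]
    ring

/-- Residue calculus: the expansion of `⟨ψ| e^{H(x)} φ_m |v⟩` for `m > 0`. -/
theorem apply_expHamK_phiK (hx : Function.Injective x)
    (hψ : ∀ n z, 0 < n → ψ (phiK K n z) = 0) (X : Finset ι) {m : ℕ} (hm : 0 < m)
    (z : K ⊗[CoeffRing] Fock) : ψ (expHamK (psums x X) (phiK K m z)) =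
      ∑ k ∈ X, 2 * x k ^ m * residue x X k *
        ψ (phiK K 0 (expHamK (psums x (X.erase k)) z)) := by
  -- The constant term of the expansion contributes a multiple of ψ φ_m, which is zero because m >
  -- 0.
  rw [expHamK_phiK, qSeries_psums hx, act_add, act_C, act_finset_sum, map_add, map_smul,
    hψ _ _ (by omega), smul_zero, zero_add, map_sum]
  refine Finset.sum_congr rfl fun k hk => ?_
  -- The variable belonging to the geometric series is split off from e^H, so that it can be
  -- annihilated, leaving φ_0.
  have h : expHamK (psums x X) z =
      expHamK (fun j => x k ^ (2 * j + 1)) (expHamK (psums x (X.erase k)) z) := by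
    rw [← expHamK_add, ← psums_insert (Finset.notMem_erase k X), Finset.insert_erase hk]
  rw [act_smul, map_smul, apply_act_geom_of_pos hψ, h, apply_act_geom_expHamK hψ, smul_eq_mul]
  ring

end PartialFractions

/-! ### Deformed fermions and factorial powers -/

theorem elem_eq (p i : ℕ) : elem p i = ((Finset.univ : Finset (Fin p)).val.map fun k : Fin p =>
    (MvPolynomial.X (Nat.succPNat (k : ℕ)) : CoeffRing)).esymm i := by
  rw [elem, MvPolynomial.aeval_esymm_eq_multiset_esymm]

theorem prod_sub_eq_sum_elem {K : Type} [CommRing K] [Algebra CoeffRing K] (p : ℕ) (y : K) :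
    ∏ t ∈ Finset.range p, (y - algebraMap CoeffRing K (MvPolynomial.X (Nat.succPNat t))) =
      ∑ i ∈ Finset.range (p + 1), algebraMap CoeffRing K ((-1) ^ i * elem p i) * y ^ (p - i) := by
  have h := Multiset.prod_X_sub_X_eq_sum_esymm ((Finset.univ : Finset (Fin p)).val.map
    fun k : Fin p => (MvPolynomial.X (Nat.succPNat (k : ℕ)) : CoeffRing))
  have h' := congrArg (Polynomial.eval₂ (algebraMap CoeffRing K) y) h
  rw [Polynomial.eval₂_finsetSum, Multiset.map_map, Multiset.card_map] at h'
  simp only [← elem_eq, Finset.card_val, Finset.card_univ, Fintype.card_fin] at h'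
  rw [← Finset.prod, Polynomial.eval₂_finsetProd, ← Fin.prod_univ_eq_prod_range fun t =>
    (y - algebraMap CoeffRing K (MvPolynomial.X (Nat.succPNat t)))] at *
  simpa [Polynomial.eval₂_mul, Polynomial.eval₂_pow, mul_assoc] using h'

/-- The signed elementary symmetric polynomials are the same as in φ^{(a)}_j, with 2 y^{j-i} in
place of φ_{j-i}; this is why the deformed fermion produces the factorial power. -/
theorem factorialPower_eq_sum {K : Type} [CommRing K] [Algebra CoeffRing K] {j : ℕ} (hj : 0 < j)
    (y : K) : factorialPower y j = ∑ i ∈ Finset.range j,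
      algebraMap CoeffRing K ((-1) ^ i * elem (j - 1) i) * (2 * y ^ (j - i)) := by
  obtain ⟨j, rfl⟩ := Nat.exists_eq_add_of_le' hj
  rw [factorialPower, Nat.add_sub_cancel, prod_sub_eq_sum_elem, Finset.mul_sum]
  refine Finset.sum_congr rfl fun i hi => ?_
  rw [Finset.mem_range] at hi
  rw [Nat.succ_sub (by omega), pow_succ]
  ring

theorem phiA_eq_sum {j : ℕ} (hj : 0 < j) : phiA j =
    ∑ i ∈ Finset.range j, ((-1) ^ i * elem (j - 1) i) • phiOp ((j : ℤ) - (i : ℤ)) := by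
  rw [phiA, if_neg hj.ne']

section SeveralVariables

variable {K ι : Type} [Field K] [DecidableEq ι] {x : ι → K} [Algebra CoeffRing K]
  {ψ : K ⊗[CoeffRing] Fock →ₗ[K] K}

theorem apply_expHamK_phiA (hx : Function.Injective x)
    (hψ : ∀ n z, 0 < n → ψ (phiK K n z) = 0) (X : Finset ι) {j : ℕ} (hj : 0 < j)
    (v : Fock) : ψ (expHamK (psums x X) (1 ⊗ₜ phiA j v)) =
      ∑ k ∈ X, factorialPower (x k) j * residue x X k *
        ψ (phiK K 0 (expHamK (psums x (X.erase k)) (1 ⊗ₜ v))) := by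
  rw [phiA_eq_sum hj, LinearMap.sum_apply, TensorProduct.tmul_sum, map_sum, map_sum]
  have h : ∀ i ∈ Finset.range j, ψ (expHamK (psums x X) (1 ⊗ₜ
      (((-1) ^ i * elem (j - 1) i) • phiOp ((j : ℤ) - (i : ℤ))) v)) =
      ∑ k ∈ X, algebraMap CoeffRing K ((-1) ^ i * elem (j - 1) i) * (2 * x k ^ (j - i)) *
        (residue x X k * ψ (phiK K 0 (expHamK (psums x (X.erase k)) (1 ⊗ₜ v)))) := by
    intro i hi
    rw [Finset.mem_range] at hi
    rw [LinearMap.smul_apply, one_tmul_smul, map_smul, map_smul, ← phiK_tmul,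
      ← Nat.cast_sub hi.le, apply_expHamK_phiK hx hψ X (by omega), smul_eq_mul, Finset.mul_sum]
    exact Finset.sum_congr rfl fun k _ => by ring
  rw [Finset.sum_congr rfl h, Finset.sum_comm]
  refine Finset.sum_congr rfl fun k _ => ?_
  rw [factorialPower_eq_sum hj, ← Finset.sum_mul, mul_assoc]

/-- The iterated sum over distinct variables in `X` that `⟨ψ| e^{H(x)} |v⟩` expands to, with
`g j k` the value at the variable `x_k` of the polynomial of index `j`. -/
def symSum (x : ι → K) (g : ℕ → ι → K) : List ℕ → Finset ι → K
  | [], _ => 1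
  | j :: L, X => ∑ k ∈ X, g j k * residue x X k * symSum x g L (X.erase k)

/-- One variable is removed per letter. The family A is left general so that the deformed fermions
and, at a = 0, the plain ones are covered together. -/
theorem apply_expHamK_foldr {A : ℕ → Fock →ₗ[CoeffRing] Fock} {g : ℕ → ι → K}
    (hA : ∀ {ψ : K ⊗[CoeffRing] Fock →ₗ[K] K} (_ : ∀ n z, 0 < n → ψ (phiK K n z) = 0)
      (X : Finset ι) {j : ℕ} (_ : 0 < j) (v : Fock), ψ (expHamK (psums x X) (1 ⊗ₜ A j v)) =
        ∑ k ∈ X, g j k * residue x X k * ψ (phiK K 0 (expHamK (psums x (X.erase k)) (1 ⊗ₜ v))))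
    {w : Fock} (hw : ∀ p : ℕ → K, expHamK p ((1 : K) ⊗ₜ w) = 1 ⊗ₜ w) (L : List ℕ) :
    ∀ {ψ : K ⊗[CoeffRing] Fock →ₗ[K] K} (_ : ∀ n z, 0 < n → ψ (phiK K n z) = 0) (X : Finset ι)
      (_ : ∀ j ∈ L, 0 < j),
      ψ (expHamK (psums x X) (1 ⊗ₜ L.foldr (fun j v => A j v) w)) =
        symSum x g L X * ψ (((phiK K 0) ^ L.length) (1 ⊗ₜ w)) := by
  induction L with
  | nil => intro ψ _ X _; simp [symSum, hw]
  | cons j L ih =>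
    intro ψ hψ X hL
    rw [List.foldr_cons, hA hψ X (hL j (by simp)), symSum, Finset.sum_mul]
    refine Finset.sum_congr rfl fun k _ => ?_
    -- The removal leaves φ_0 next to ψ; since φ_0 anticommutes with the positive modes, the new
    -- functional still kills them.
    have hψ' : ∀ n z, 0 < n → (ψ ∘ₗ phiK K 0) (phiK K n z) = 0 := by
      intro n z hn
      have h := phiK_anticomm 0 n z
      rw [if_neg (by omega), map_zero, zero_smul] at h
      rw [LinearMap.comp_apply, eq_neg_of_add_eq_zero_left h, map_neg, hψ _ _ hn, neg_zero]
    have := ih hψ' (X.erase k) fun i hi => hL i (by simp [hi])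
    rw [LinearMap.comp_apply, LinearMap.comp_apply] at this
    rw [this, List.length_cons, pow_succ', Module.End.mul_apply]
    ring

end SeveralVariables

/-! ### Symmetrization -/

section Symmetrization

variable {K ι : Type} [Field K] [DecidableEq ι] (x : ι → K) (g : ℕ → ι → K)

/-- The term of the symmetrization belonging to a choice of variables `f`. -/
def symTerm (L : List ℕ) (X : Finset ι) (f : Fin L.length → ι) : K :=
  ∏ i, g (L.get i) (f i) *
    ∏ l ∈ X.filter (fun l => ∀ j ≤ i, f j ≠ l), (x (f i) + x l) / (x (f i) - x l)

theorem symTerm_cons (a : ℕ) (L : List ℕ) (X : Finset ι) (k : ι) (f : Fin L.length → ι) :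
    symTerm x g (a :: L) X (Fin.cons (α := fun _ => ι) k f : Fin (L.length + 1) → ι) =
      g a k * residue x X k * symTerm x g L (X.erase k) f := by
  have h0 : X.filter (fun l => ∀ j ≤ (0 : Fin (L.length + 1)),
      (Fin.cons k f : Fin (L.length + 1) → ι) j ≠ l) = X.erase k := by
    ext l
    simp [Finset.mem_erase, eq_comm, and_comm]
  have hs : ∀ i : Fin L.length, X.filter (fun l => ∀ j ≤ i.succ,
      (Fin.cons k f : Fin (L.length + 1) → ι) j ≠ l) =
        (X.erase k).filter fun l => ∀ j ≤ i, f j ≠ l := by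
    intro i
    ext l
    simp only [Finset.mem_filter, Finset.mem_erase]
    constructor
    · rintro ⟨h1, h2⟩
      exact ⟨⟨(h2 0 (Fin.zero_le _)).symm, h1⟩, fun j hj => h2 j.succ (Fin.succ_le_succ_iff.2 hj)⟩
    · rintro ⟨⟨h1, h2⟩, h3⟩
      refine ⟨h2, fun j hj => ?_⟩
      induction j using Fin.cases with
      | zero => exact h1.symm
      | succ j => exact h3 j (Fin.succ_le_succ_iff.1 hj)
  unfold symTerm
  refine (Fin.prod_univ_succ (n := L.length) _).trans ?_
  rw [residue]
  congr 1
  · rw [← h0]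
    rfl
  · refine Finset.prod_congr rfl fun i _ => ?_
    rw [← hs i]
    rfl

variable [Fintype ι]

-- Choosing a variable at each step and erasing it from X amounts to choosing an injection; the
-- factors of `residue` then run over the variables not chosen so far.
open Classical in
theorem symSum_eq (L : List ℕ) : ∀ X : Finset ι, symSum x g L X =
    ∑ f : Fin L.length → ι,
      if Function.Injective f ∧ ∀ i, f i ∈ X then symTerm x g L X f else 0 := by
  induction L with
  | nil =>
    intro X
    have h : Function.Injective (fun i => i.elim0 : Fin ([] : List ℕ).length → ι) :=
      fun i => i.elim0
    rw [Fintype.sum_eq_single (fun i => i.elim0) fun f hf => absurd (funext fun i => i.elim0) hf,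
      if_pos ⟨h, fun i => i.elim0⟩]
    rfl
  | cons a L ih =>
    intro X
    have e := Fintype.sum_equiv (Fin.consEquiv fun _ : Fin (L.length + 1) => ι)
      (fun p => if Function.Injective (Fin.cons p.1 p.2 : Fin (L.length + 1) → ι) ∧
          ∀ i, (Fin.cons p.1 p.2 : Fin (L.length + 1) → ι) i ∈ X then
        symTerm x g (a :: L) X (Fin.cons p.1 p.2 : Fin (L.length + 1) → ι) else 0)
      (fun f => if Function.Injective f ∧ ∀ i, f i ∈ X then symTerm x g (a :: L) X f else 0)
      (fun p => rfl)
    refine Eq.trans ?_ e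
    rw [Fintype.sum_prod_type, symSum, ← Finset.sum_subset (Finset.subset_univ X)]
    · refine Finset.sum_congr rfl fun k hk => ?_
      rw [ih, Finset.mul_sum]
      refine Finset.sum_congr rfl fun g _ => ?_
      rw [mul_ite, mul_zero, symTerm_cons]
      refine if_congr ?_ rfl rfl
      rw [Fin.cons_injective_iff]
      simp only [Set.mem_range, not_exists, Fin.forall_fin_succ, Fin.cons_zero, Fin.cons_succ,
        Finset.mem_erase]
      constructor
      · rintro ⟨h1, h2⟩
        exact ⟨⟨fun i => (h2 i).1, h1⟩, hk, fun i => (h2 i).2⟩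
      · rintro ⟨⟨h1, h2⟩, -, h3⟩
        exact ⟨h2, fun i => ⟨h1 i, h3 i⟩⟩
    · intro k _ hk
      refine Finset.sum_eq_zero fun g _ => if_neg ?_
      rintro ⟨-, h⟩
      exact hk (h 0)

-- All fibres of restriction to the first ℓ places have the same size, being permuted by left
-- translations. They partition the n! permutations, and there are n!/(n - ℓ)! injections.
open Classical in
theorem card_perm_extending {ℓ n : ℕ} (hn : ℓ ≤ n) {f : Fin ℓ → Fin n}
    (hf : Function.Injective f) :
    (Finset.univ.filter fun w : Equiv.Perm (Fin n) => (fun i => w (Fin.castLE hn i)) = f).card =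
      (n - ℓ).factorial := by
  set c : Equiv.Perm (Fin n) → (Fin ℓ → Fin n) := fun w i => w (Fin.castLE hn i) with hc
  have hcinj : ∀ w, Function.Injective (c w) := fun w =>
    w.injective.comp (Fin.castLE_injective hn)
  have hext : ∀ g : Fin ℓ → Fin n, Function.Injective g → ∃ w, c w = g := by
    intro g hg
    obtain ⟨e, he⟩ := Equiv.Perm.exists_extending_pair (Fin.castLE hn) g (Fin.castLE_injective hn) hg
    exact ⟨e, funext he⟩
  have heq : ∀ g : Fin ℓ → Fin n, Function.Injective g →
      (Finset.univ.filter fun w => c w = g).card = (Finset.univ.filter fun w => c w = f).card := by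
    intro g hg
    obtain ⟨u, hu⟩ := hext g hg
    obtain ⟨v, hv⟩ := hext f hf
    refine Finset.card_bij (fun w _ => v * u⁻¹ * w) ?_ ?_ ?_
    · intro w hw
      rw [Finset.mem_filter] at hw ⊢
      refine ⟨Finset.mem_univ _, funext fun i => ?_⟩
      have h1 := congrFun hw.2 i
      have h2 := congrFun hu i
      have h3 := congrFun hv i
      simp only [hc] at h1 h2 h3 ⊢
      rw [Equiv.Perm.mul_apply, Equiv.Perm.mul_apply, h1, ← h2, ← h3]
      exact congrArg v (u.symm_apply_apply _)
    · intro w _ w' _ h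
      exact mul_left_cancel h
    · intro w hw
      rw [Finset.mem_filter] at hw
      refine ⟨u * v⁻¹ * w, ?_, by group⟩
      rw [Finset.mem_filter]
      refine ⟨Finset.mem_univ _, funext fun i => ?_⟩
      have h1 := congrFun hw.2 i
      have h2 := congrFun hu i
      have h3 := congrFun hv i
      simp only [hc] at h1 h2 h3 ⊢
      rw [Equiv.Perm.mul_apply, Equiv.Perm.mul_apply, h1, ← h3, ← h2]
      exact congrArg u (v.symm_apply_apply _)
  have htot : (Finset.univ : Finset (Equiv.Perm (Fin n))).card =
      ∑ g ∈ Finset.univ.filter (fun g : Fin ℓ → Fin n => Function.Injective g),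
        (Finset.univ.filter fun w => c w = g).card :=
    Finset.card_eq_sum_card_fiberwise fun w _ => by simpa using hcinj w
  rw [Finset.sum_congr rfl fun g hg => heq g (Finset.mem_filter.1 hg).2, Finset.sum_const,
    Finset.card_univ, Fintype.card_perm, Fintype.card_fin, smul_eq_mul] at htot
  have hcard : (Finset.univ.filter (fun g : Fin ℓ → Fin n => Function.Injective g)).card =
      n.descFactorial ℓ := by
    rw [← Fintype.card_subtype, Fintype.card_congr (Equiv.subtypeInjectiveEquivEmbedding _ _),
      Fintype.card_embedding_eq, Fintype.card_fin, Fintype.card_fin]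
  rw [hcard, ← Nat.factorial_mul_descFactorial hn, mul_comm] at htot
  exact (Nat.eq_of_mul_eq_mul_left (Nat.descFactorial_pos.2 hn)
    htot).symm

open Classical in
theorem sum_perm_eq {M : Type*} [AddCommMonoid M] {ℓ n : ℕ} (hn : ℓ ≤ n) (F : (Fin ℓ → Fin n) → M) :
    ∑ w : Equiv.Perm (Fin n), F (fun i => w (Fin.castLE hn i)) =
      (n - ℓ).factorial • ∑ f : Fin ℓ → Fin n, if Function.Injective f then F f else 0 := by
  rw [Finset.smul_sum,
    ← Finset.sum_fiberwise (s := Finset.univ) (g := fun w : Equiv.Perm (Fin n) =>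
      (fun i => w (Fin.castLE hn i) : Fin ℓ → Fin n))]
  refine Finset.sum_congr rfl fun f _ => ?_
  split_ifs with hf
  · rw [← card_perm_extending hn hf, ← Finset.sum_const]
    refine Finset.sum_congr rfl fun w hw => ?_
    rw [(Finset.mem_filter.1 hw).2]
  · rw [smul_zero, Finset.sum_eq_zero]
    intro w hw
    refine absurd ?_ hf
    rw [← (Finset.mem_filter.1 hw).2]
    exact w.injective.comp (Fin.castLE_injective hn)

/-- The summand depends only on the first ℓ values of w: the variables x_{w(j)} with j > i are those
different from x_{w(0)}, …, x_{w(i)}. The fibres account for the factorial. -/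
theorem sum_perm_eq_symSum {K : Type} [Field K] {n : ℕ} (x : Fin n → K) (g : ℕ → Fin n → K)
    (L : List ℕ) (hn : L.length ≤ n) : ∑ w : Equiv.Perm (Fin n),
      ((∏ i : Fin L.length, g (L.get i) (w (Fin.castLE hn i))) *
        ∏ i : Fin L.length, ∏ j ∈ Finset.univ.filter (fun j : Fin n => Fin.castLE hn i < j),
          (x (w (Fin.castLE hn i)) + x (w j)) / (x (w (Fin.castLE hn i)) - x (w j))) =
      ((n - L.length).factorial : K) * symSum x g L Finset.univ := by
  classical
  have h : ∀ w : Equiv.Perm (Fin n),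
      ((∏ i : Fin L.length, g (L.get i) (w (Fin.castLE hn i))) *
        ∏ i : Fin L.length, ∏ j ∈ Finset.univ.filter (fun j : Fin n => Fin.castLE hn i < j),
          (x (w (Fin.castLE hn i)) + x (w j)) / (x (w (Fin.castLE hn i)) - x (w j))) =
      symTerm x g L Finset.univ fun i => w (Fin.castLE hn i) := by
    intro w
    rw [← Finset.prod_mul_distrib]
    refine Finset.prod_congr rfl fun i _ => ?_
    congr 1
    refine Finset.prod_equiv w (fun j => ?_) (fun j _ => rfl)
    simp only [Finset.mem_filter, Finset.mem_univ, true_and, ne_eq, EmbeddingLike.apply_eq_iff_eq]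
    constructor
    · intro h k hk he
      subst he
      exact absurd hk (not_le.2 h)
    · intro h
      by_contra hlt
      have hlt' : (j : ℕ) ≤ i := not_lt.1 hlt
      exact h ⟨j, hlt'.trans_lt i.2⟩ hlt' rfl
  rw [Finset.sum_congr rfl fun w _ => h w,
    sum_perm_eq hn fun f : Fin L.length → Fin n => symTerm x g L Finset.univ f, symSum_eq,
    nsmul_eq_mul]
  congr 1
  refine Finset.sum_congr rfl fun f _ => ?_
  simp

end Symmetrization

/-! ### The polynomials in n variables and their stable limit -/

theorem xvar_injective (n : ℕ) : Function.Injective (xvar : Fin n → RatFun n) :=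
  (IsFractionRing.injective _ _).comp (MvPolynomial.X_injective)

theorem factorialQRat_eq_symSum (lam : StrictPartition) (n : ℕ) (hn : lam.length ≤ n) :
    factorialQRat lam n hn = symSum (xvar : Fin n → RatFun n)
      (fun j k => factorialPower (xvar k) j) lam.parts Finset.univ := by
  rw [factorialQRat]
  refine (congrArg (((n - lam.length).factorial : RatFun n)⁻¹ * ·)
    (sum_perm_eq_symSum xvar (fun j k => factorialPower (xvar k) j) lam.parts hn)).trans ?_
  exact inv_mul_cancel_left₀ (by exact_mod_cast Nat.factorial_ne_zero _) _

theorem symSum_eq_zero {n : ℕ} {K : Type} [Field K] (x : Fin n → K)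
    (g : ℕ → Fin n → K) {L : List ℕ} (hL : n < L.length) : symSum x g L Finset.univ = 0 := by
  classical
  rw [symSum_eq]
  refine Finset.sum_eq_zero fun f _ => if_neg fun h => ?_
  have := Fintype.card_le_of_injective f h.1
  simp at this
  omega

/-- The vector `φ_0^p |vac⟩`, for `p` the parity of the length of `λ`. -/
def parityVac (lam : StrictPartition) : Fock := if Even lam.length then vac else phiOp 0 vac

theorem ketC_eq (lam : StrictPartition) :
    ketC lam = lam.parts.foldr (fun j v => phiA j v) (parityVac lam) := by
  rw [ketC, StrictPartition.evenParts, parityVac, StrictPartition.length]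
  split_ifs
  · rfl
  · rw [List.foldr_append, List.foldr_cons, List.foldr_nil, phiA, if_pos rfl]

theorem expHamK_parityVac {K : Type} [CommRing K] [Algebra CoeffRing K] (lam : StrictPartition)
    (p : ℕ → K) : expHamK p ((1 : K) ⊗ₜ parityVac lam) = 1 ⊗ₜ parityVac lam := by
  rw [parityVac]
  split_ifs
  · exact expHamK_vac p
  · exact expHamK_phi_zero_vac p

/-- Each part of λ leaves one φ_0, and the zero part supplies one more when ℓ(λ) is odd. Their
number is even and φ_0^2 = 1. -/
theorem braK_phiK_zero_pow_parityVac {K : Type} [CommRing K] [Algebra CoeffRing K]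
    (lam : StrictPartition) :
    braK K vacBra (((phiK K 0) ^ lam.length) ((1 : K) ⊗ₜ parityVac lam)) = 1 := by
  have hsq : ∀ v : Fock, (phiK K 0 ^ 2) ((1 : K) ⊗ₜ v) = 1 ⊗ₜ v := fun v => by
    rw [pow_two, Module.End.mul_apply, phiK_tmul, phiK_tmul, phiOp_zero_phiOp_zero]
  have hev : ∀ (k : ℕ) (v : Fock), (phiK K 0 ^ (2 * k)) ((1 : K) ⊗ₜ v) = 1 ⊗ₜ v := by
    intro k v
    induction k with
    | zero => rfl
    | succ k ih => rw [mul_add, mul_one, pow_add, Module.End.mul_apply, hsq, ih]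
  rw [parityVac]
  split_ifs with h
  · obtain ⟨k, hk⟩ := even_iff_exists_two_mul.1 h
    rw [hk, hev, braK_tmul, vacBra_vac, one_smul]
  · obtain ⟨k, hk⟩ := Nat.not_even_iff_odd.1 h
    rw [hk, pow_succ, Module.End.mul_apply, phiK_tmul, phiOp_zero_phiOp_zero, hev, braK_tmul,
      vacBra_vac, one_smul]

theorem braK_vacBra_phiK {K : Type} [CommRing K] [Algebra CoeffRing K] (n : ℤ)
    (z : K ⊗[CoeffRing] Fock) (hn : 0 < n) : braK K vacBra (phiK K n z) = 0 := by
  induction z using TensorProduct.induction_on with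
  | zero => simp
  | tmul a v => rw [phiK_tmul, braK_tmul, vacBra_phiOp hn, zero_smul]
  | add v w hv hw => rw [map_add, map_add, hv, hw, add_zero]

theorem vevK_ketC {K : Type} [Field K] [Algebra CoeffRing K] {n : ℕ} {x : Fin n → K}
    (hx : Function.Injective x) (lam : StrictPartition) :
    vevK (psums x Finset.univ) (ketC lam) =
      symSum x (fun j k => factorialPower (x k) j) lam.parts Finset.univ := by
  rw [vevK, ketC_eq, apply_expHamK_foldr (apply_expHamK_phiA hx) (expHamK_parityVac lam) lam.parts braK_vacBra_phiK _
    lam.pos]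
  have := braK_phiK_zero_pow_parityVac (K := K) lam
  rw [StrictPartition.length] at this
  rw [this, mul_one]

/-- The odd power sums in `n` variables. -/
def polyPsum (n k : ℕ) : MvPolynomial (Fin n) CoeffRing := ∑ i, MvPolynomial.X i ^ (2 * k + 1)

theorem algebraMap_vevK_polyPsum (n : ℕ) (v : Fock) :
    algebraMap (MvPolynomial (Fin n) CoeffRing) (RatFun n) (vevK (polyPsum n) v) =
      vevK (psums xvar Finset.univ) v := by
  have h := map_vevK (IsScalarTower.toAlgHom CoeffRing (MvPolynomial (Fin n) CoeffRing) (RatFun n))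
    (polyPsum n) v
  rw [IsScalarTower.toAlgHom_apply] at h
  rw [h]
  congr 1
  ext k
  simp [polyPsum, psums, xvar]

/-- The vacuum expectation value taken with polynomial coefficients is itself the witness that the
symmetrization is a polynomial. The default value 0 for n < ℓ(λ) also agrees, as there are no
injections. -/
theorem factorialQPoly_eq (lam : StrictPartition) (n : ℕ) :
    factorialQPoly lam n = vevK (polyPsum n) (ketC lam) := by
  have hmap := algebraMap_vevK_polyPsum n (ketC lam)
  rw [vevK_ketC (xvar_injective n)] at hmap
  have hinj := IsFractionRing.injective (MvPolynomial (Fin n) CoeffRing) (RatFun n)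
  unfold factorialQPoly
  split_ifs with h
  · apply hinj
    rw [hmap, h.choose_spec.choose_spec, factorialQRat_eq_symSum]
  · have hn : n < lam.parts.length := by
      by_contra hn
      exact h ⟨not_lt.1 hn, vevK (polyPsum n) (ketC lam), by
        rw [hmap, factorialQRat_eq_symSum]⟩
    apply hinj
    rw [hmap, symSum_eq_zero _ _ hn, map_zero]

open Classical in
theorem killCompl_powerSum (n : ℕ) {m : ℕ} (hm : 0 < m) :
    MvPowerSeries.killCompl (R := CoeffRing) (Fin.valEmbedding : Fin n ↪ ℕ) (powerSum m) =
      ((∑ i : Fin n, MvPolynomial.X i ^ m : MvPolynomial (Fin n) CoeffRing) :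
        MvPowerSeries (Fin n) CoeffRing) := by
  ext1 d
  rw [MvPowerSeries.coeff_killCompl, MvPolynomial.coeff_coe, MvPolynomial.coeff_sum]
  have h : MvPowerSeries.coeff (Finsupp.embDomain (Fin.valEmbedding : Fin n ↪ ℕ) d) (powerSum m) =
      if ∃ i : ℕ, Finsupp.embDomain (Fin.valEmbedding : Fin n ↪ ℕ) d = Finsupp.single i m
        then 1 else 0 := rfl
  rw [h]
  simp only [MvPolynomial.coeff_X_pow]
  split_ifs with hd
  · obtain ⟨i, hi⟩ := hd
    have hmem : i ∈ (Finsupp.embDomain (Fin.valEmbedding : Fin n ↪ ℕ) d).support := by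
      rw [hi, Finsupp.mem_support_iff, Finsupp.single_eq_same]
      exact hm.ne'
    rw [Finsupp.support_embDomain, Finset.mem_map] at hmem
    obtain ⟨j, -, rfl⟩ := hmem
    rw [← Finsupp.embDomain_single] at hi
    rw [Finsupp.embDomain_injective _ hi, Finset.sum_eq_single j, if_pos rfl]
    · intro b _ hb
      refine if_neg fun h => hb ?_
      have := congrArg Finsupp.support h
      rw [Finsupp.support_single _ hm.ne', Finsupp.support_single _ hm.ne'] at this
      exact Finset.singleton_injective this
    · simp
  · symm
    refine Finset.sum_eq_zero fun i _ => if_neg ?_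
    rintro rfl
    exact hd ⟨i, by rw [Finsupp.embDomain_single]; rfl⟩

/-- Setting all but the first n variables to zero turns the power sums of the series ring into those
of the polynomial ring; naturality does the rest. -/
theorem killCompl_vev (n : ℕ) (v : Fock) :
    MvPowerSeries.killCompl (R := CoeffRing) (Fin.valEmbedding : Fin n ↪ ℕ) (vev v) =
      ((vevK (polyPsum n) v : MvPolynomial (Fin n) CoeffRing) :
        MvPowerSeries (Fin n) CoeffRing) := by
  have h1 := map_vevK (MvPowerSeries.killCompl (R := CoeffRing) (Fin.valEmbedding : Fin n ↪ ℕ))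
    oddPowerSum v
  have h2 := map_vevK (MvPolynomial.coeToMvPowerSeries.algHom CoeffRing :
    MvPolynomial (Fin n) CoeffRing →ₐ[CoeffRing] MvPowerSeries (Fin n) CoeffRing) (polyPsum n) v
  rw [vev_eq_vevK, h1]
  simp only [MvPolynomial.coeToMvPowerSeries.algHom_apply, Algebra.algebraMap_self] at h2
  refine Eq.trans ?_ h2.symm
  congr 1
  ext1 k
  exact killCompl_powerSum n (Nat.succ_pos _)

/-- The factorial `Q`-functions as vacuum expectation values. -/
theorem factorialQ_eq_vev (lam : StrictPartition) : factorialQ lam = vev (ketC lam) := by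
  ext1 d
  set n : ℕ := d.support.sup (fun i => i + 1) with hn
  have h : MvPowerSeries.coeff d (factorialQ lam) =
      MvPolynomial.coeff (d.comapDomain (Fin.val : Fin n → ℕ) (Fin.val_injective.injOn))
        (factorialQPoly lam n) := rfl
  rw [h, factorialQPoly_eq, ← MvPolynomial.coeff_coe, ← killCompl_vev, MvPowerSeries.coeff_killCompl]
  congr 2
  refine Finsupp.embDomain_comapDomain (f := (Fin.valEmbedding : Fin n ↪ ℕ)) fun i hi => ?_
  have : i + 1 ≤ n := Finset.le_sup (f := fun i => i + 1) hi
  exact ⟨⟨i, this⟩, rfl⟩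

/-! ### Strict partitions and normally ordered words -/

/-- The parts `(λ₁, …, λ_{r'})` as integers. -/
def StrictPartition.intParts (lam : StrictPartition) : List ℤ := lam.evenParts.map Nat.cast

/-- The sum of the parts. -/
def StrictPartition.size (lam : StrictPartition) : ℕ := lam.parts.sum

theorem StrictPartition.ext_parts {lam mu : StrictPartition} (h : lam.parts = mu.parts) :
    lam = mu := by
  cases lam; cases mu; cases h; rfl

theorem StrictPartition.evenParts_pairwise (lam : StrictPartition) :
    lam.evenParts.Pairwise (· > ·) := by
  rw [evenParts]
  split_ifs
  · exact lam.strict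
  · refine List.pairwise_append.2 ⟨lam.strict, by simp, fun a ha b hb => ?_⟩
    rw [List.mem_singleton.1 hb]
    exact lam.pos a ha

theorem StrictPartition.even_length_evenParts (lam : StrictPartition) :
    Even lam.evenParts.length := by
  rw [evenParts]
  split_ifs with h
  · exact h
  · rw [List.length_append, List.length_singleton]
    exact (Nat.not_even_iff_odd.1 h).add_one

theorem StrictPartition.sum_intParts (lam : StrictPartition) : lam.intParts.sum = lam.size := by
  have h : lam.evenParts.sum = lam.parts.sum := by
    rw [evenParts]
    split_ifs <;> simp
  rw [intParts, size, ← h, Nat.cast_list_sum]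

theorem StrictPartition.length_intParts (lam : StrictPartition) :
    lam.intParts.length % 2 = 0 := by
  rw [intParts, List.length_map, ← Nat.even_iff]
  exact lam.even_length_evenParts

theorem StrictPartition.parts_eq_filter (lam : StrictPartition) :
    lam.parts = lam.evenParts.filter (fun k => 0 < k) := by
  have h : lam.parts.filter (fun k => 0 < k) = lam.parts :=
    List.filter_eq_self.2 fun k hk => by simpa using lam.pos k hk
  rw [evenParts]
  split_ifs
  · exact h.symm
  · rw [List.filter_append, h]
    simp

theorem StrictPartition.evenParts_injective {lam mu : StrictPartition}
    (h : lam.evenParts = mu.evenParts) : lam = mu :=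
  ext_parts (by rw [parts_eq_filter, h, ← parts_eq_filter])

/-- A last entry 0 records odd length, so strict partitions correspond to the decreasing lists of
even length in the nonnegative integers. -/
theorem exists_evenParts_eq {l : List ℕ} (h : l.Pairwise (· > ·)) (hl : Even l.length) :
    ∃ lam : StrictPartition, lam.evenParts = l := by
  rcases List.eq_nil_or_concat l with rfl | ⟨L, b, rfl⟩
  · exact ⟨⟨[], by simp, by simp⟩, rfl⟩
  · rw [List.concat_eq_append] at h hl ⊢
    obtain ⟨h1, -, h2⟩ := List.pairwise_append.1 h
    have hL : ∀ k ∈ L, b < k := fun k hk => h2 k hk b (by simp)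
    rw [List.length_append, List.length_singleton, Nat.even_add_one] at hl
    rcases Nat.eq_zero_or_pos b with rfl | hb
    · exact ⟨⟨L, h1, hL⟩, by rw [StrictPartition.evenParts, if_neg hl]⟩
    · refine ⟨⟨L ++ [b], h, fun k hk => ?_⟩, ?_⟩
      · rcases List.mem_append.1 hk with hk | hk
        · exact hb.trans (hL k hk)
        · rwa [List.mem_singleton.1 hk]
      · rw [StrictPartition.evenParts, if_pos]
        rw [List.length_append, List.length_singleton, Nat.even_add_one]
        exact hl

theorem exists_intParts_eq {l : List ℤ} (h : l.Pairwise (· > ·)) (h0 : ∀ k ∈ l, 0 ≤ k)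
    (hl : l.length % 2 = 0) : ∃ lam : StrictPartition, lam.intParts = l := by
  have e : (l.map Int.toNat).map Nat.cast = l := by
    rw [List.map_map]
    conv_rhs => rw [← List.map_id l]
    refine List.map_congr_left fun k hk => ?_
    simp [h0 k hk]
  obtain ⟨lam, hlam⟩ := exists_evenParts_eq (l := l.map Int.toNat) (by
    rw [List.pairwise_map]
    refine h.imp_of_mem fun {a b} ha hb hab => ?_
    have := h0 a ha
    have := h0 b hb
    omega) (by rwa [List.length_map, Nat.even_iff])
  exact ⟨lam, by rw [StrictPartition.intParts, hlam, e]⟩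

/-! ### Specialization and triangularity -/

theorem elem_zero (p : ℕ) : elem p 0 = 1 := by
  rw [elem, MvPolynomial.esymm_zero, map_one]

theorem constantCoeff_elem_succ (p i : ℕ) : MvPolynomial.constantCoeff (elem p (i + 1)) = 0 := by
  rw [elem, MvPolynomial.esymm, map_sum, map_sum]
  refine Finset.sum_eq_zero fun t ht => ?_
  have hcard := (Finset.mem_powersetCard.1 ht).2
  obtain ⟨k, hk⟩ := Finset.card_pos.1 (by rw [hcard]; exact Nat.succ_pos i)
  rw [map_prod, map_prod]
  exact Finset.prod_eq_zero hk (by simp)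

theorem phiA_eq_add (j : ℕ) (v : Fock) : phiA j v = phiOp j v +
    ∑ i ∈ Finset.range (j - 1),
      ((-1) ^ (i + 1) * elem (j - 1) (i + 1)) • phiOp ((j : ℤ) - (i + 1 : ℕ)) v := by
  rcases Nat.eq_zero_or_pos j with rfl | hj
  · simp [phiA]
  · obtain ⟨j, rfl⟩ := Nat.exists_eq_add_of_le' hj
    rw [phiA_eq_sum hj, LinearMap.sum_apply, Finset.sum_range_succ', add_comm, Nat.add_sub_cancel]
    simp [elem_zero]

/-- The vectors `c • v` with `c` vanishing at `a = 0`. -/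
def vanishing : Submodule CoeffRing Fock :=
  RingHom.ker (MvPolynomial.constantCoeff : CoeffRing →+* ℂ) • ⊤

theorem linearMap_mem_vanishing (f : Fock →ₗ[CoeffRing] Fock) {v : Fock} (hv : v ∈ vanishing) :
    f v ∈ vanishing := by
  have h := Submodule.mem_map_of_mem (f := f) hv
  rw [vanishing, Submodule.map_smul''] at h
  exact Submodule.smul_mono le_rfl le_top h

theorem foldr_phiA_sub_word_mem_vanishing (L : List ℕ) :
    L.foldr (fun j v => phiA j v) vac - word (L.map Nat.cast) ∈ vanishing := by
  induction L with
  | nil => simp [word_nil]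
  | cons j L ih =>
    rw [List.foldr_cons, List.map_cons, word_cons, phiA_eq_add, add_sub_right_comm, ← map_sub]
    refine add_mem (linearMap_mem_vanishing _ ih) (sum_mem fun i _ => ?_)
    refine Submodule.smul_mem_smul ?_ trivial
    rw [RingHom.mem_ker, map_mul, constantCoeff_elem_succ, mul_zero]

theorem specializeZero_vev_of_mem_vanishing {v : Fock} (hv : v ∈ vanishing) :
    specializeZero (vev v) = 0 := by
  rw [← vevLin_apply]
  induction hv using Submodule.smul_induction_on' with
  | smul c hc v _ =>
    rw [map_smul, specializeZero_smul, RingHom.mem_ker.1 hc, cst, map_zero, zero_smul]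
  | add v _ w _ hv hw => rw [map_add, map_add, hv, hw, add_zero]

/-- At a = 0 the deformed fermions become the φ_j, and the value on a word is unchanged by the
specialization because its coefficients are complex numbers. -/
theorem schurQ_eq_vev (lam : StrictPartition) : schurQ lam = vev (word lam.intParts) := by
  have h := specializeZero_vev_of_mem_vanishing (foldr_phiA_sub_word_mem_vanishing lam.evenParts)
  rw [← vevLin_apply, map_sub, map_sub, sub_eq_zero] at h
  rw [schurQ, factorialQ_eq_vev]
  exact h.trans (vev_word_mem_homogFixed _).2

/-- The span of the words of a given length and of degree less than `d`. -/
def lowerWords (d : ℤ) (p : ℕ) : Submodule CoeffRing Fock :=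
  Submodule.span CoeffRing {v | ∃ l : List ℤ, l.sum < d ∧ l.length = p ∧ v = word l}

theorem phiOp_mem_lowerWords {d : ℤ} {p : ℕ} {n m : ℤ} (hnm : n ≤ m) {v : Fock}
    (hv : v ∈ lowerWords d p) : phiOp n v ∈ lowerWords (m + d) (p + 1) := by
  induction hv using Submodule.span_induction with
  | mem v hv =>
    obtain ⟨l, hd, rfl, rfl⟩ := hv
    exact Submodule.subset_span ⟨n :: l, by rw [List.sum_cons]; omega, rfl, rfl⟩
  | zero => simp
  | add v w _ _ hv hw => rw [map_add]; exact add_mem hv hw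
  | smul c v _ hv => rw [map_smul]; exact Submodule.smul_mem _ _ hv

/-- In φ^{(a)}_j every term after the leading φ_j has a smaller index, so the corrections have the
same number of letters and smaller degree. -/
theorem foldr_phiA_sub_word_mem_lowerWords (L : List ℕ) :
    L.foldr (fun j v => phiA j v) vac - word (L.map Nat.cast) ∈ lowerWords L.sum L.length := by
  induction L with
  | nil => simp [word_nil]
  | cons j L ih =>
    rw [List.foldr_cons, List.map_cons, word_cons, phiA_eq_add, add_sub_right_comm, ← map_sub,
      List.sum_cons, List.length_cons, Nat.cast_add]
    refine add_mem (phiOp_mem_lowerWords le_rfl ih) (sum_mem fun i _ => Submodule.smul_mem _ _ ?_)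
    set w := L.foldr (fun j v => phiA j v) vac
    have e : phiOp ((j : ℤ) - (i + 1 : ℕ)) w =
        phiOp ((j : ℤ) - (i + 1 : ℕ)) (w - word (L.map Nat.cast)) +
          word (((j : ℤ) - (i + 1 : ℕ)) :: L.map Nat.cast) := by
      rw [map_sub, word_cons, sub_add_cancel]
    rw [e]
    refine add_mem (phiOp_mem_lowerWords (by omega) ih) (Submodule.subset_span ⟨_, ?_, ?_, rfl⟩)
    · rw [List.sum_cons, ← Nat.cast_list_sum]
      omega
    · simp

/-- Words of odd length have value zero; those of even length are integer combinations of strict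
words of even length and the same degree. -/
theorem vev_word_mem_span (l : List ℤ) : vev (word l) ∈
    Submodule.span CoeffRing (schurQ '' {nu | (nu.size : ℤ) = l.sum}) := by
  by_cases hl : l.length % 2 = 0
  · obtain ⟨M, hM⟩ := exists_word_mem_normalWords l
    rw [← vevLin_apply]
    generalize word l = w at hM
    induction hM using AddSubgroup.closure_induction with
    | mem w hw =>
      obtain ⟨l', h, h0, hsum, hp, rfl⟩ := hw
      obtain ⟨nu, rfl⟩ := exists_intParts_eq h (fun k hk => (h0 k hk).1) (by omega)
      rw [vevLin_apply, ← schurQ_eq_vev]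
      exact Submodule.subset_span ⟨nu, by rw [Set.mem_ofPred_eq, ← hsum, nu.sum_intParts], rfl⟩
    | zero => rw [map_zero]; exact zero_mem _
    | add v w _ _ hv hw => rw [map_add]; exact add_mem hv hw
    | neg v _ hv => rw [map_neg]; exact neg_mem hv
  · rw [vev_word_eq_zero_of_odd hl]
    exact zero_mem _

theorem factorialQ_sub_schurQ_mem_span (mu : StrictPartition) : factorialQ mu - schurQ mu ∈
    Submodule.span CoeffRing (schurQ '' {nu | nu.size < mu.size}) := by
  have h := foldr_phiA_sub_word_mem_lowerWords mu.evenParts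
  have hs : (mu.evenParts.sum : ℤ) = mu.size := by
    rw [← mu.sum_intParts, StrictPartition.intParts, Nat.cast_list_sum]
  rw [hs] at h
  rw [factorialQ_eq_vev, schurQ_eq_vev, ← vevLin_apply, ← vevLin_apply, ← map_sub]
  change vevLin (mu.evenParts.foldr (fun j v => phiA j v) vac - word (mu.evenParts.map Nat.cast)) ∈ _
  generalize mu.evenParts.foldr (fun j v => phiA j v) vac - word (mu.evenParts.map Nat.cast) = w
    at h ⊢
  induction h using Submodule.span_induction with
  | mem v hv =>
    obtain ⟨l, hl, -, rfl⟩ := hv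
    refine Submodule.span_mono (Set.image_mono fun nu hnu => ?_) (vev_word_mem_span l)
    rw [Set.mem_ofPred_eq] at hnu ⊢
    omega
  | zero => rw [map_zero]; exact zero_mem _
  | add v w _ _ hv hw => rw [map_add]; exact add_mem hv hw
  | smul c v _ hv => rw [map_smul]; exact Submodule.smul_mem _ _ hv

theorem mem_span_schurQ_of_mem_Gam {g : Series} (hg : g ∈ Gam) :
    g ∈ Submodule.span CoeffRing (Set.range schurQ) := by
  obtain ⟨v, rfl⟩ := exists_vev_eq_of_mem_Gam hg
  have hv : v ∈ Submodule.span CoeffRing (Set.range word) := by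
    rw [span_word_eq_top]; trivial
  rw [← vevLin_apply]
  clear hg
  induction hv using Submodule.span_induction with
  | mem v hv =>
    obtain ⟨l, rfl⟩ := hv
    exact Submodule.span_mono (Set.image_subset_range _ _) (vev_word_mem_span l)
  | zero => rw [map_zero]; exact zero_mem _
  | add v w _ _ hv hw => rw [map_add]; exact add_mem hv hw
  | smul c v _ hv => rw [map_smul]; exact Submodule.smul_mem _ _ hv

theorem coeff_schurQ_eq_zero {nu : StrictPartition} {d : ℕ →₀ ℕ} (h : nu.size ≠ d.degree) :
    MvPowerSeries.coeff d (schurQ nu) = 0 := by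
  rw [schurQ_eq_vev]
  by_contra hne
  have := (vev_word_mem_homogFixed _).1 d hne
  rw [nu.sum_intParts] at this
  exact h (by exact_mod_cast this.symm)

/-! ### Linear independence of the `Q`-functions -/

theorem intParts_eq (lam : StrictPartition) : word lam.intParts =
    lam.parts.foldr (fun (j : ℕ) v => phiOp (j : ℤ) v) (parityVac lam) := by
  have h : ∀ (L : List ℕ), word (L.map Nat.cast) = L.foldr (fun (j : ℕ) v => phiOp (j : ℤ) v) vac := by
    intro L
    induction L with
    | nil => rfl
    | cons j L ih => rw [List.map_cons, word_cons, ih, List.foldr_cons]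
  rw [StrictPartition.intParts, h, StrictPartition.evenParts, parityVac, StrictPartition.length]
  split_ifs
  · rfl
  · rw [List.foldr_append, List.foldr_cons, List.foldr_nil, Nat.cast_zero]

theorem vevK_word_intParts {K : Type} [Field K] [Algebra CoeffRing K] {n : ℕ} {x : Fin n → K}
    (hx : Function.Injective x) (lam : StrictPartition) :
    vevK (psums x Finset.univ) (word lam.intParts) =
      symSum x (fun j k => 2 * x k ^ j) lam.parts Finset.univ := by
  have hA : ∀ {ψ : K ⊗[CoeffRing] Fock →ₗ[K] K} (_ : ∀ n z, 0 < n → ψ (phiK K n z) = 0)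
      (X : Finset (Fin n)) {j : ℕ} (_ : 0 < j) (v : Fock),
      ψ (expHamK (psums x X) (1 ⊗ₜ phiOp (j : ℤ) v)) = ∑ k ∈ X, 2 * x k ^ j * residue x X k *
        ψ (phiK K 0 (expHamK (psums x (X.erase k)) (1 ⊗ₜ v))) :=
    fun hψ X j hj v => apply_expHamK_phiK hx hψ X hj (1 ⊗ₜ v)
  rw [vevK, intParts_eq, apply_expHamK_foldr (A := fun j => phiOp (j : ℤ)) hA
    (expHamK_parityVac lam) lam.parts braK_vacBra_phiK _ lam.pos]
  have := braK_phiK_zero_pow_parityVac (K := K) lam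
  rw [StrictPartition.length] at this
  rw [this, mul_one]

/-- Each factor is -(x_j^2 - x_i^2)/(x_j - x_i)^2, so the product is, up to a fixed sign, the
Vandermonde determinant of the squares over the squared Vandermonde determinant. A permutation acts
on the numerator by its sign and leaves the denominator alone. -/
theorem prod_add_div_sub_perm {K : Type} [Field K] {n : ℕ} {x : Fin n → K}
    (hx : Function.Injective x) (hx2 : Function.Injective fun i => x i ^ 2) :
    ∃ D : K, D ≠ 0 ∧ ∀ w : Equiv.Perm (Fin n),
      ∏ i : Fin n, ∏ j ∈ Finset.univ.filter (fun j : Fin n => i < j),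
        (x (w i) + x (w j)) / (x (w i) - x (w j)) = (Equiv.Perm.sign w : ℤ) * D := by
  have hdet : ∀ (y : Fin n → K) (w : Equiv.Perm (Fin n)),
      (Matrix.vandermonde fun i => y (w i)).det =
        (Equiv.Perm.sign w : ℤ) * (Matrix.vandermonde y).det := fun y w => by
    rw [← Matrix.det_permute]
    rfl
  set ε : K := ∏ i : Fin n, ∏ j ∈ Finset.univ.filter (fun j : Fin n => i < j), (-1 : K) with hε
  have hε0 : ε ≠ 0 := Finset.prod_ne_zero_iff.2 fun i _ => Finset.prod_ne_zero_iff.2 fun j _ => by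
    simp
  have h0 : (Matrix.vandermonde x).det ≠ 0 := Matrix.det_vandermonde_ne_zero_iff.2 hx
  have h20 : (Matrix.vandermonde fun i => x i ^ 2).det ≠ 0 :=
    Matrix.det_vandermonde_ne_zero_iff.2 hx2
  refine ⟨ε * ((Matrix.vandermonde fun i => x i ^ 2).det / (Matrix.vandermonde x).det ^ 2),
    mul_ne_zero hε0 (div_ne_zero h20 (pow_ne_zero 2 h0)), fun w => ?_⟩
  have hterm : ∀ i j : Fin n, i < j → (x (w i) + x (w j)) / (x (w i) - x (w j)) =
      -1 * ((x (w j) ^ 2 - x (w i) ^ 2) / (x (w j) - x (w i)) ^ 2) := by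
    intro i j hij
    have h1 : x (w j) - x (w i) ≠ 0 := sub_ne_zero.2 fun h =>
      hij.ne' (w.injective (hx h))
    have h2 : x (w i) - x (w j) = -(x (w j) - x (w i)) := by ring
    rw [h2, div_neg]
    field_simp
    ring
  have hIoi : ∀ i : Fin n, Finset.univ.filter (fun j : Fin n => i < j) = Finset.Ioi i := fun i => by
    ext j
    simp
  have hs : ((Equiv.Perm.sign w : ℤ) : K) ^ 2 = 1 := by
    rcases Int.units_eq_one_or (Equiv.Perm.sign w) with h | h <;> simp [h]
  calc _ = ε * ((Matrix.vandermonde fun i => x (w i) ^ 2).det /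
        (Matrix.vandermonde fun i => x (w i)).det ^ 2) := by
        rw [hε, Matrix.det_vandermonde, Matrix.det_vandermonde, ← Finset.prod_pow,
          ← Finset.prod_div_distrib, ← Finset.prod_mul_distrib]
        refine Finset.prod_congr rfl fun i _ => ?_
        rw [← Finset.prod_pow, hIoi, ← Finset.prod_div_distrib, ← Finset.prod_mul_distrib]
        exact Finset.prod_congr rfl fun j hj => hterm i j (Finset.mem_Ioi.1 hj)
    _ = _ := by
        rw [hdet x w, hdet (fun i => x i ^ 2) w, mul_pow, hs, one_mul]
        ring

/-- The exponent `(λ_1, …, λ_n)`, where `n = ℓ(λ)`. -/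
def StrictPartition.exponent (lam : StrictPartition) {n : ℕ} (h : lam.length = n) : Fin n →₀ ℕ :=
  Finsupp.equivFunOnFinite.symm fun i => lam.parts.get (i.cast h.symm)

theorem StrictPartition.strictAnti_get (lam : StrictPartition) {n : ℕ} (h : lam.length = n) :
    StrictAnti fun i : Fin n => lam.parts.get (i.cast h.symm) := fun i j hij =>
  List.pairwise_iff_get.1 lam.strict _ _ (show (i : ℕ) < j from hij)

theorem symSum_eq_alternant {K : Type} [Field K] (L : List ℕ) {x : Fin L.length → K} {D : K}
    (hw : ∀ w : Equiv.Perm (Fin L.length),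
      ∏ i, ∏ j ∈ Finset.univ.filter (fun j : Fin L.length => i < j),
        (x (w i) + x (w j)) / (x (w i) - x (w j)) = (Equiv.Perm.sign w : ℤ) * D) :
    symSum x (fun j k => 2 * x k ^ j) L Finset.univ = 2 ^ L.length * D *
      ∑ w : Equiv.Perm (Fin L.length), (Equiv.Perm.sign w : ℤ) * ∏ i, x (w i) ^ L.get i := by
  have hs := sum_perm_eq_symSum x (fun j k => 2 * x k ^ j) L le_rfl
  rw [Nat.sub_self, Nat.factorial_zero, Nat.cast_one, one_mul] at hs
  rw [← hs, Finset.mul_sum]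
  refine Finset.sum_congr rfl fun w _ => ?_
  refine (congrArg _ (hw w)).trans ?_
  rw [Finset.prod_mul_distrib, Finset.prod_const, Finset.card_univ, Fintype.card_fin]
  change 2 ^ L.length * (∏ i, x (w i) ^ L.get i) * _ = _
  ring

/-- With exactly ℓ(λ) variables the symmetrization is an alternant in the parts of λ, times a factor
that is the same for all λ of that length. -/
theorem vevK_word_eq_alternant (n : ℕ) : ∃ D : RatFun n, D ≠ 0 ∧ ∀ (lam : StrictPartition)
    (h : lam.length = n), vevK (psums xvar Finset.univ) (word lam.intParts) = D *
      algebraMap (MvPolynomial (Fin n) CoeffRing) (RatFun n)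
        (∑ w : Equiv.Perm (Fin n), (Equiv.Perm.sign w : ℤ) •
          ∏ i, MvPolynomial.X (w i) ^ lam.parts.get (i.cast h.symm)) := by
  have hx2 : Function.Injective fun i : Fin n => (xvar i : RatFun n) ^ 2 := by
    intro i j hij
    simp only [xvar, ← map_pow] at hij
    have h := IsFractionRing.injective (MvPolynomial (Fin n) CoeffRing) (RatFun n) hij
    by_contra hne
    have h2 := congrArg (MvPolynomial.coeff (Finsupp.single i 2)) h
    rw [MvPolynomial.coeff_X_pow, MvPolynomial.coeff_X_pow, if_pos rfl, if_neg] at h2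
    · exact one_ne_zero h2
    · intro h3
      exact hne ((Finsupp.single_left_inj two_ne_zero).1 h3).symm
  obtain ⟨D, hD, hw⟩ := prod_add_div_sub_perm (xvar_injective n) hx2
  refine ⟨2 ^ n * D, mul_ne_zero (pow_ne_zero _ two_ne_zero) hD, fun lam h => ?_⟩
  subst h
  refine (vevK_word_intParts (xvar_injective _) _).trans
    ((symSum_eq_alternant lam.parts hw).trans ?_)
  rw [map_sum]
  refine congrArg (2 ^ lam.length * D * ·) (Finset.sum_congr rfl fun w _ => ?_)
  rw [map_zsmul, map_prod, zsmul_eq_mul]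
  simp only [map_pow]
  rfl

open Classical in
theorem coeff_alternant {lam mu : StrictPartition} {n : ℕ} (hl : lam.length = n)
    (hm : mu.length = n) : MvPolynomial.coeff (mu.exponent hm)
      (∑ w : Equiv.Perm (Fin n), (Equiv.Perm.sign w : ℤ) •
        ∏ i, (MvPolynomial.X (w i) : MvPolynomial (Fin n) CoeffRing) ^
          lam.parts.get (i.cast hl.symm)) = if lam = mu then 1 else 0 := by
  classical
  have hmon : ∀ w : Equiv.Perm (Fin n),
      ∏ i, (MvPolynomial.X (w i) : MvPolynomial (Fin n) CoeffRing) ^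
        lam.parts.get (i.cast hl.symm) =
      MvPolynomial.monomial (Finsupp.equivFunOnFinite.symm fun k =>
        lam.parts.get ((w⁻¹ k).cast hl.symm)) 1 := by
    intro w
    rw [MvPolynomial.monomial_eq, map_one, one_mul, Finsupp.prod_fintype _ _ fun i => pow_zero _]
    exact Fintype.prod_equiv w _ _ fun i => by simp
  have hcoeff : ∀ w : Equiv.Perm (Fin n), MvPolynomial.coeff (mu.exponent hm)
      ((Equiv.Perm.sign w : ℤ) • ∏ i, (MvPolynomial.X (w i) : MvPolynomial (Fin n) CoeffRing) ^
          lam.parts.get (i.cast hl.symm)) = if w = 1 ∧ lam = mu then 1 else 0 := by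
    intro w
    rw [hmon, MvPolynomial.coeff_smul, MvPolynomial.coeff_monomial]
    have hiff : (Finsupp.equivFunOnFinite.symm fun k => lam.parts.get ((w⁻¹ k).cast hl.symm)) =
        mu.exponent hm ↔ w = 1 ∧ lam = mu := by
      rw [StrictPartition.exponent, EmbeddingLike.apply_eq_iff_eq]
      constructor
      · intro he
        -- Both sequences of parts decrease strictly, so a permutation matching them is increasing,
        -- hence the identity.
        have hmono : StrictMono (w⁻¹ : Equiv.Perm (Fin n)) := by
          intro i j hij
          have h1 := mu.strictAnti_get hm hij
          have h2 := congrFun he i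
          have h3 := congrFun he j
          dsimp only at h1 h2 h3
          rw [← h2, ← h3] at h1
          exact (lam.strictAnti_get hl).lt_iff_gt.1 h1
        have hw : w = 1 := by
          have : (w⁻¹ : Equiv.Perm (Fin n)) = 1 := by
            ext1 i
            exact congrFun ((hmono.range_inj strictMono_id).1
              (by rw [Equiv.range_eq_univ, Set.range_id])) i
          exact inv_eq_one.1 this
        refine ⟨hw, StrictPartition.ext_parts (List.ext_get (hl.trans hm.symm) fun k h1 h2 => ?_)⟩
        have := congrFun he ⟨k, h1.trans_eq hl⟩
        rw [hw] at this
        exact this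
      · rintro ⟨rfl, rfl⟩
        rfl
    by_cases h : w = 1 ∧ lam = mu
    · rw [if_pos h, if_pos (hiff.2 h), h.1]
      simp
    · rw [if_neg h, if_neg (mt hiff.1 h), smul_zero]
  rw [MvPolynomial.coeff_sum, Finset.sum_congr rfl fun w _ => hcoeff w]
  by_cases h : lam = mu
  · simp [h]
  · simp [h]

/-- In a relation whose shortest partition has length n, pass to n variables: longer partitions
contribute zero, and those of length n give distinct alternants times a common nonzero factor. The
leading exponent isolates each coefficient. -/
theorem linearIndependent_schurQ : LinearIndependent CoeffRing schurQ := by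
  classical
  rw [linearIndependent_iff]
  intro c hc
  by_contra hne
  obtain ⟨mu, hmu, hmin⟩ := Finset.exists_min_image c.support StrictPartition.length
    (Finsupp.support_nonempty_iff.2 hne)
  set n := mu.length with hn
  have h1 : vev (Finsupp.linearCombination CoeffRing (fun nu : StrictPartition => word nu.intParts) c) =
      0 := by
    rw [← hc, ← vevLin_apply, Finsupp.apply_linearCombination]
    congr 2
    funext nu
    exact (schurQ_eq_vev nu).symm
  have h2 : vevK (psums xvar Finset.univ) (Finsupp.linearCombination CoeffRing
      (fun nu : StrictPartition => word nu.intParts) c) = (0 : RatFun n) := by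
    have h3 := killCompl_vev n (Finsupp.linearCombination CoeffRing
      (fun nu : StrictPartition => word nu.intParts) c)
    rw [h1, map_zero] at h3
    have h4 : vevK (polyPsum n) (Finsupp.linearCombination CoeffRing
        (fun nu : StrictPartition => word nu.intParts) c) = 0 := by
      apply MvPolynomial.coe_injective (σ := Fin n) (R := CoeffRing)
      rw [← h3, MvPolynomial.coe_zero]
    rw [← algebraMap_vevK_polyPsum, h4, map_zero]
  obtain ⟨D, hD, halt⟩ := vevK_word_eq_alternant n
  have hterm : ∀ nu ∈ c.support, vevK (psums xvar Finset.univ) (word nu.intParts) = D *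
      algebraMap (MvPolynomial (Fin n) CoeffRing) (RatFun n) (if h : nu.length = n then
        ∑ w : Equiv.Perm (Fin n), (Equiv.Perm.sign w : ℤ) •
          ∏ i, MvPolynomial.X (w i) ^ nu.parts.get (i.cast h.symm) else 0) := by
    intro nu hnu
    split_ifs with h
    · exact halt nu h
    · rw [map_zero, mul_zero, vevK_word_intParts (xvar_injective n), symSum_eq_zero]
      exact lt_of_le_of_ne (hmin nu hnu) (Ne.symm h)
  have hlin : ∀ s : Finset StrictPartition, vevK (psums xvar Finset.univ)
      (∑ nu ∈ s, c nu • word nu.intParts) =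
        ∑ nu ∈ s, c nu • (vevK (psums xvar Finset.univ) (word nu.intParts) : RatFun n) := by
    intro s
    induction s using Finset.induction_on with
    | empty => simp [vevK]
    | insert nu s hs ih => rw [Finset.sum_insert hs, Finset.sum_insert hs, vevK_add, vevK_smul, ih]
  rw [Finsupp.linearCombination_apply, Finsupp.sum, hlin,
    Finset.sum_congr rfl fun nu hnu => by rw [hterm nu hnu, mul_comm, ← smul_mul_assoc],
    ← Finset.sum_mul] at h2
  have h5 := (mul_eq_zero.1 h2).resolve_right hD
  have h6 : algebraMap (MvPolynomial (Fin n) CoeffRing) (RatFun n) (∑ nu ∈ c.support, c nu •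
      if h : nu.length = n then ∑ w : Equiv.Perm (Fin n), (Equiv.Perm.sign w : ℤ) •
          ∏ i, MvPolynomial.X (w i) ^ nu.parts.get (i.cast h.symm) else 0) = 0 := by
    rw [map_sum, ← h5]
    exact Finset.sum_congr rfl fun nu _ => map_smul
      (IsScalarTower.toAlgHom CoeffRing (MvPolynomial (Fin n) CoeffRing) (RatFun n)) _ _
  have h7 := congrArg (MvPolynomial.coeff (mu.exponent hn.symm))
    (IsFractionRing.injective _ _ (h6.trans (map_zero _).symm))
  rw [MvPolynomial.coeff_sum, MvPolynomial.coeff_zero, Finset.sum_eq_single mu] at h7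
  · rw [MvPolynomial.coeff_smul, dif_pos hn.symm, coeff_alternant hn.symm hn.symm, if_pos rfl, smul_eq_mul,
      mul_one] at h7
    exact Finsupp.mem_support_iff.1 hmu h7
  · intro nu _ hne
    rw [MvPolynomial.coeff_smul]
    split_ifs with h
    · rw [coeff_alternant h hn.symm, if_neg hne, smul_zero]
    · rw [MvPolynomial.coeff_zero, smul_zero]
  · exact fun h => absurd hmu h

/-! ### Elementary and complete symmetric polynomials -/

/-- The parameter `a_{t+1}`. -/
abbrev param (t : ℕ) : CoeffRing := MvPolynomial.X (Nat.succPNat t)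

theorem homog_eq_sum (p n : ℕ) : homog p n =
    ∑ l ∈ Finset.finsuppAntidiag (Finset.univ : Finset (Fin p)) n, ∏ k : Fin p, param k ^ l k := by
  classical
  have h : ∀ s : Sym (Fin p) n,
      (MvPolynomial.aeval fun k : Fin p => (param k : CoeffRing))
        ((s.1.map MvPolynomial.X).prod : MvPolynomial (Fin p) ℂ) =
      ∏ k : Fin p, param k ^ ((Sym.equivNatSum (Fin p) n s : Fin p →₀ ℕ) k) := fun s => by
    rw [map_multiset_prod, Multiset.map_map, Finset.prod_multiset_map_count]
    simp only [Function.comp_apply, MvPolynomial.aeval_X, Sym.coe_equivNatSum_apply_apply]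
    refine Finset.prod_subset (Finset.subset_univ _) fun k _ hk => ?_
    rw [Multiset.count_eq_zero_of_notMem (by simpa using hk), pow_zero]
  rw [homog, MvPolynomial.hsymm, map_sum, Finset.sum_congr rfl fun s _ => h s]
  have hmem : ∀ l : Fin p →₀ ℕ, l ∈ Finset.finsuppAntidiag (Finset.univ : Finset (Fin p)) n ↔
      (l.sum fun _ => id) = n := fun l => by
    rw [Finset.mem_finsuppAntidiag]
    simp [Finsupp.sum_fintype]
  refine Finset.sum_bij (fun s _ => (Sym.equivNatSum (Fin p) n s : Fin p →₀ ℕ))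
    (fun s _ => (hmem _).2 (Sym.equivNatSum (Fin p) n s).2)
    (fun s _ t _ h => (Sym.equivNatSum (Fin p) n).injective (Subtype.ext h))
    (fun l hl => ⟨(Sym.equivNatSum (Fin p) n).symm ⟨l, (hmem l).1 hl⟩, Finset.mem_univ _, ?_⟩)
    fun _ _ => rfl
  rw [Equiv.apply_symm_apply]

theorem mk_pow_mul_one_sub (c : CoeffRing) :
    (PowerSeries.mk fun n => c ^ n) * (1 - PowerSeries.C c * PowerSeries.X) = 1 := by
  ext n
  rw [mul_sub, mul_one, mul_left_comm, map_sub, PowerSeries.coeff_C_mul]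
  cases n with
  | zero => simp
  | succ n =>
    rw [PowerSeries.coeff_succ_mul_X, PowerSeries.coeff_mk, PowerSeries.coeff_mk, pow_succ']
    simp

/-- The generating function of the h_i is a product of geometric series. -/
theorem mk_homog_mul_prod (p : ℕ) : PowerSeries.mk (homog p) *
    ∏ k ∈ Finset.range p, (1 - PowerSeries.C (param k) * PowerSeries.X) = 1 := by
  classical
  have h : PowerSeries.mk (homog p) = ∏ k : Fin p, PowerSeries.mk fun n => param k ^ n := by
    ext n
    rw [PowerSeries.coeff_mk, homog_eq_sum, PowerSeries.coeff_prod]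
    simp only [PowerSeries.coeff_mk]
  rw [h, ← Fin.prod_univ_eq_prod_range fun k =>
    (1 - PowerSeries.C (param k) * PowerSeries.X : PowerSeries CoeffRing),
    ← Finset.prod_mul_distrib]
  exact Finset.prod_eq_one fun k _ => mk_pow_mul_one_sub _

theorem elem_eq_zero {p i : ℕ} (h : p < i) : elem p i = 0 := by
  rw [elem, MvPolynomial.esymm, Finset.powersetCard_eq_empty.2 (by simpa using h),
    Finset.sum_empty, map_zero]

theorem mk_elem_eq_prod (p : ℕ) : (PowerSeries.mk fun i => (-1) ^ i * elem p i) =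
    ∏ k ∈ Finset.range p, (1 - PowerSeries.C (param k) * PowerSeries.X) := by
  classical
  rw [← Fin.prod_univ_eq_prod_range fun k =>
    (1 - PowerSeries.C (param k) * PowerSeries.X : PowerSeries CoeffRing)]
  simp only [sub_eq_add_neg]
  rw [Finset.prod_one_add]
  ext1 i
  have h : ∀ t : Finset (Fin p), PowerSeries.coeff i
      (∏ k ∈ t, -(PowerSeries.C (param k) * PowerSeries.X) : PowerSeries CoeffRing) =
        if t.card = i then (-1) ^ i * ∏ k ∈ t, param (k : ℕ) else 0 := fun t => by
    rw [Finset.prod_neg, Finset.prod_mul_distrib, Finset.prod_const, ← map_prod, ← mul_assoc,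
      PowerSeries.coeff_mul_X_pow']
    split_ifs with h1 h2 h2
    · rw [h2, Nat.sub_self]
      rw [show ((-1 : PowerSeries CoeffRing)) ^ i = PowerSeries.C ((-1) ^ i) by simp, ← map_mul]
      simp
    · rw [show ((-1 : PowerSeries CoeffRing)) ^ t.card = PowerSeries.C ((-1) ^ t.card) by simp,
        ← map_mul, PowerSeries.coeff_C, if_neg (by omega)]
    · omega
    · rfl
  rw [map_sum, PowerSeries.coeff_mk]
  rw [Finset.sum_congr (Finset.powerset_univ (α := Fin p)) fun t _ => h t,
    ← Finset.sum_filter,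
    Finset.univ_filter_card_eq, elem, MvPolynomial.esymm, map_sum, Finset.mul_sum]
  refine Finset.sum_congr rfl fun t _ => ?_
  rw [map_prod]
  simp

theorem coeff_prod_one_sub_eq_zero (s : Finset ℕ) {n : ℕ} (h : s.card < n) :
    PowerSeries.coeff n
      (∏ k ∈ s, (1 - PowerSeries.C (param k) * PowerSeries.X) : PowerSeries CoeffRing) = 0 := by
  classical
  induction s using Finset.induction_on generalizing n with
  | empty =>
    rw [Finset.prod_empty, PowerSeries.coeff_one, if_neg (by simp at h; omega)]
  | insert k s hk ih =>
    rw [Finset.card_insert_of_notMem hk] at h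
    obtain ⟨n, rfl⟩ := Nat.exists_eq_add_of_le' (by omega : 1 ≤ n)
    rw [Finset.prod_insert hk, sub_mul, one_mul, mul_assoc, mul_comm PowerSeries.X, map_sub,
      PowerSeries.coeff_C_mul, PowerSeries.coeff_succ_mul_X, ih (by omega), ih (by omega), mul_zero,
      sub_zero]

/-- `∑ h_i(a_1, …, a_j) (-1)^l e_l(a_1, …, a_{k-1}) = δ_{n,0}` over `i + l = n = k - j`. -/
theorem sum_homog_mul_elem {j k n : ℕ} (h : k = j + n) (hk : 0 < k) :
    ∑ q ∈ Finset.HasAntidiagonal.antidiagonal n, homog j q.1 * ((-1) ^ q.2 * elem (k - 1) q.2) =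
      if n = 0 then 1 else 0 := by
  split_ifs with hn
  · subst hn
    simp [homog, elem]
  -- For n > 0 one has j ≤ k - 1, so the generating function of the h's cancels the first j factors.
  -- The k - 1 - j = n - 1 factors left form a polynomial of degree less than n.
  · have e : ∏ t ∈ Finset.range (k - 1),
        (1 - PowerSeries.C (param t) * PowerSeries.X : PowerSeries CoeffRing) =
      (∏ t ∈ Finset.range j, (1 - PowerSeries.C (param t) * PowerSeries.X)) *
        ∏ t ∈ Finset.Ico j (k - 1), (1 - PowerSeries.C (param t) * PowerSeries.X) :=
      (Finset.prod_range_mul_prod_Ico _ (by omega)).symm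
    have h2 := congrArg (fun f => PowerSeries.coeff n (PowerSeries.mk (homog j) * f))
      ((mk_elem_eq_prod (k - 1)).trans e)
    simp only [← mul_assoc, mk_homog_mul_prod, one_mul] at h2
    rw [PowerSeries.coeff_mul, coeff_prod_one_sub_eq_zero _ (by rw [Nat.card_Ico]; omega)] at h2
    simpa only [PowerSeries.coeff_mk] using h2

theorem homog_zero_succ (i : ℕ) : homog 0 (i + 1) = 0 := by
  rw [homog_eq_sum]
  refine Finset.sum_eq_zero fun l hl => ?_
  simp at hl

theorem homog_zero_right (p : ℕ) : homog p 0 = 1 := by simp [homog]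

/-! ### The contravariant form -/

/-- The isometry `φ_n ↦ (-1)^n φ_{-n}`. -/
def flipMap : (ℤ →₀ CoeffRing) →ₗ[CoeffRing] (ℤ →₀ CoeffRing) :=
  Finsupp.lsum CoeffRing fun n => sgn n • Finsupp.lsingle (-n)

theorem flipMap_single (n : ℤ) :
    flipMap (Finsupp.single n 1) = sgn n • Finsupp.single (-n) (1 : CoeffRing) := by
  simp [flipMap]

theorem symForm_flipMap (v w : ℤ →₀ CoeffRing) :
    symForm (flipMap v) (flipMap w) = symForm v w := by
  have h : symForm.compl₁₂ flipMap flipMap = symForm := by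
    refine Finsupp.lhom_ext' fun m => LinearMap.ext_ring ?_
    refine Finsupp.lhom_ext' fun n => LinearMap.ext_ring ?_
    simp only [LinearMap.comp_apply, Finsupp.lsingle_apply, LinearMap.compl₁₂_apply,
      flipMap_single, map_smul, LinearMap.smul_apply, symForm, formOf_single, smul_eq_mul, sgn_neg]
    by_cases h : m + n = 0
    · obtain rfl : n = -m := by omega
      rw [if_pos (by omega), if_pos h, sgn_neg, ← mul_assoc, sgn_mul_self, one_mul]
    · rw [if_neg (by omega), if_neg h, mul_zero, mul_zero]
  exact congrArg (fun B => B v w) h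

/-- The anti-automorphism `φ_n ↦ (-1)^n φ_{-n}` of the algebra of fermions. -/
def adj : Fermions →ₗ[CoeffRing] Fermions :=
  CliffordAlgebra.reverse ∘ₗ
    (CliffordAlgebra.map (⟨flipMap, fun v => symForm_flipMap v v⟩ :
      fermionForm →qᵢ fermionForm)).toLinearMap

theorem adj_one : adj 1 = 1 := by simp [adj]

theorem adj_mul (x y : Fermions) : adj (x * y) = adj y * adj x := by
  simp [adj]

theorem adj_phi (n : ℤ) : adj (phi n) = sgn n • phi (-n) := by
  simp only [adj, phi, LinearMap.comp_apply, AlgHom.toLinearMap_apply,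
    CliffordAlgebra.map_apply_ι]
  change CliffordAlgebra.reverse (CliffordAlgebra.ι fermionForm (flipMap _)) = _
  rw [CliffordAlgebra.reverse_ι, flipMap_single, map_smul]

/-- `x ↦ (w ↦ ⟨vac| x^* w)`. -/
def formAux : Fermions →ₗ[CoeffRing] Fock →ₗ[CoeffRing] CoeffRing :=
  LinearMap.compRight CoeffRing vacBra ∘ₗ
    (Algebra.lsmul CoeffRing CoeffRing Fock).toLinearMap ∘ₗ adj

theorem formAux_apply (x : Fermions) (w : Fock) : formAux x w = vacBra (adj x • w) := rfl

/-- The adjoint of φ_{-n} is a multiple of φ_n, which ⟨vac| kills for n > 0; so the form descends to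
the Fock space. -/
theorem formAux_eq_zero_of_mem {x : Fermions} (hx : x ∈ vacIdeal) : formAux x = 0 := by
  ext1 w
  rw [formAux_apply, LinearMap.zero_apply]
  induction hx using Submodule.span_induction generalizing w with
  | mem x hx =>
    obtain ⟨n, rfl⟩ := hx
    dsimp only
    rw [adj_phi, smul_assoc, map_smul, ← phiOp_apply, vacBra_phiOp (by omega), smul_zero]
  | zero => simp
  | add x y _ _ hx hy => rw [map_add, add_smul, map_add, hx, hy, add_zero]
  | smul c x _ hx => rw [smul_eq_mul, adj_mul, ← smul_smul]; exact hx _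

/-- The contravariant form on the Fock space, `(x |vac⟩, w) ↦ ⟨vac| x^* w`. -/
def form : Fock →ₗ[CoeffRing] Fock →ₗ[CoeffRing] CoeffRing :=
  (((vacIdeal.restrictScalars CoeffRing).liftQ formAux
      (fun _ hx => LinearMap.mem_ker.2 (formAux_eq_zero_of_mem hx)) ∘ₗ
    (Submodule.Quotient.restrictScalarsEquiv CoeffRing vacIdeal).symm.toLinearMap :
      (Fermions ⧸ vacIdeal) →ₗ[CoeffRing] Fock →ₗ[CoeffRing] CoeffRing) :)

theorem form_smul_vac (x : Fermions) (w : Fock) : form (x • vac) w = vacBra (adj x • w) := by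
  rw [← toFock_eq]
  rfl

theorem form_vac (w : Fock) : form vac w = vacBra w := by
  rw [← one_smul Fermions vac, form_smul_vac, adj_one, one_smul]

theorem form_phiOp (n : ℤ) (v w : Fock) :
    form (phiOp n v) w = sgn n * form v (phiOp (-n) w) := by
  obtain ⟨x, rfl⟩ := exists_smul_vac v
  rw [phiOp_apply, smul_smul, form_smul_vac, form_smul_vac, adj_mul, adj_phi, mul_smul_comm,
    smul_assoc, map_smul, smul_eq_mul, phiOp_apply, smul_smul]

/-- Letters of the first word cross over with opposite degree, which reduces the claim to the vacuum
value of a word of nonzero degree or odd length. -/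
theorem form_word_word_eq_zero (l' l : List ℤ)
    (h : ¬ (l'.sum = l.sum ∧ l'.length % 2 = l.length % 2)) : form (word l') (word l) = 0 := by
  induction l' generalizing l with
  | nil =>
    rw [word_nil, form_vac, vacBra_word_eq_zero]
    intro h2
    exact h ⟨by simp [h2.1], by simp [h2.2]⟩
  | cons n l' ih =>
    rw [word_cons, form_phiOp, ← word_cons, ih, mul_zero]
    simp only [List.sum_cons, List.length_cons] at h ⊢
    omega

theorem form_word_eq_zero {d : ℤ} {v : Fock} (hv : v ∈ fockDeg d) {l : List ℤ} (h : d ≠ l.sum) :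
    form v (word l) = 0 := by
  induction hv using Submodule.span_induction with
  | mem v hv =>
    obtain ⟨l', rfl, rfl⟩ := hv
    exact form_word_word_eq_zero l' l fun h' => h h'.1
  | zero => rw [map_zero, LinearMap.zero_apply]
  | add v w _ _ hv hw => rw [map_add, LinearMap.add_apply, hv, hw, add_zero]
  | smul c v _ hv => rw [map_smul, LinearMap.smul_apply, hv, smul_zero]

/-! ### Dual vectors -/

/-- The functional `w ↦ ⟨vac| A_{j_r} ⋯ A_{j_1} w` for `(j_1, …, j_r)`. -/
def foldBra (A : ℕ → Fock →ₗ[CoeffRing] Fock) : List ℕ → Fock →ₗ[CoeffRing] CoeffRing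
  | [] => vacBra
  | j :: L => foldBra A L ∘ₗ A j

theorem foldBra_nil (A : ℕ → Fock →ₗ[CoeffRing] Fock) (w : Fock) :
    foldBra A [] w = vacBra w := rfl

theorem foldBra_cons (A : ℕ → Fock →ₗ[CoeffRing] Fock) (j : ℕ) (L : List ℕ) (w : Fock) :
    foldBra A (j :: L) w = foldBra A L (A j w) := rfl

/-- Operators `A_j`, `C_k` (`j, k < N`) with `{A_j, C_k} = 2 δ_{jk}` unless `j = k = 0`, with
`A_0 = C_0 = φ_0`, where the `A_j` annihilate `|vac⟩` and the `C_k` annihilate `⟨vac|`. -/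
structure IsDualPair (N : ℕ) (A C : ℕ → Fock →ₗ[CoeffRing] Fock) : Prop where
  anticomm : ∀ j k, k < N → 0 < j ∨ 0 < k → ∀ v,
    A j (C k v) + C k (A j v) = (if j = k then 2 else 0 : CoeffRing) • v
  vac_eq_zero : ∀ j, 0 < j → A j vac = 0
  vacBra_eq_zero : ∀ k v, 0 < k → vacBra (C k v) = 0
  left_zero : ∀ v, A 0 v = phiOp 0 v
  right_zero : ∀ v, C 0 v = phiOp 0 v

section DualPair

variable {N : ℕ} {A C : ℕ → Fock →ₗ[CoeffRing] Fock}

theorem IsDualPair.foldr_eq_zero (h : IsDualPair N A C) {j : ℕ} (hj : 0 < j) (L : List ℕ)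
    (hN : ∀ k ∈ L, k < N) (hL : j ∉ L) : A j (L.foldr (fun k v => C k v) vac) = 0 := by
  induction L with
  | nil => exact h.vac_eq_zero j hj
  | cons k L ih =>
    simp only [List.mem_cons, not_or, forall_eq_or_imp] at hN hL
    have := h.anticomm j k hN.1 (Or.inl hj) (L.foldr (fun k v => C k v) vac)
    rwa [ih hN.2 hL.2, map_zero, add_zero, if_neg hL.1, zero_smul] at this

theorem IsDualPair.foldBra_eq_zero (h : IsDualPair N A C) {k : ℕ} (hk : 0 < k) (hN : k < N)
    (L : List ℕ) (hL : k ∉ L) (v : Fock) : foldBra A L (C k v) = 0 := by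
  induction L generalizing v with
  | nil => exact h.vacBra_eq_zero k v hk
  | cons j L ih =>
    simp only [List.mem_cons, not_or] at hL
    have := h.anticomm j k hN (Or.inr hk) v
    rw [if_neg (Ne.symm hL.1), zero_smul, add_eq_zero_iff_eq_neg] at this
    rw [foldBra_cons, this, map_neg, ih hL.2, neg_zero]

theorem eq_nil_of_pairwise_zero {L : List ℕ} (h : (0 :: L).Pairwise (· > ·)) : L = [] :=
  List.eq_nil_iff_forall_not_mem.2 fun k hk => Nat.not_lt_zero _ ((List.pairwise_cons.1 h).1 k hk)

/-- The first letters decide. If they differ, the larger one meets no partner: as A it moves right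
and kills |vac⟩, as C it moves left and is killed by ⟨vac|. If they are equal and positive they
contract to 2; two zeros give φ_0^2 = 1. -/
theorem IsDualPair.foldBra_foldr (h : IsDualPair N A C) (K L : List ℕ)
    (hK : K.Pairwise (· > ·)) (hL : L.Pairwise (· > ·)) (hN : ∀ k ∈ L, k < N) :
    foldBra A K (L.foldr (fun k v => C k v) vac) =
      if K = L then 2 ^ (K.filter (fun k => 0 < k)).length else 0 := by
  induction K generalizing L with
  | nil =>
    cases L with
    | nil => simp [foldBra_nil, vacBra_vac]
    | cons m L =>
      rw [if_neg (by simp), List.foldr_cons, foldBra_nil]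
      rcases Nat.eq_zero_or_pos m with rfl | hm
      · rw [eq_nil_of_pairwise_zero hL, List.foldr_nil, h.right_zero, vacBra_phiOp_vac]
      · exact h.vacBra_eq_zero m _ hm
  | cons j K ih =>
    have hK' := List.pairwise_cons.1 hK
    cases L with
    | nil =>
      rw [if_neg (by simp), List.foldr_nil, foldBra_cons]
      rcases Nat.eq_zero_or_pos j with rfl | hj
      · rw [eq_nil_of_pairwise_zero hK, foldBra_nil, h.left_zero, vacBra_phiOp_vac]
      · rw [h.vac_eq_zero j hj, map_zero]
    | cons m L =>
      have hL' := List.pairwise_cons.1 hL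
      rcases lt_trichotomy j m with hjm | rfl | hjm
      · rw [if_neg (by simp [hjm.ne]), List.foldr_cons]
        refine h.foldBra_eq_zero (by omega) (hN m (by simp)) _ ?_ _
        intro hm
        rcases List.mem_cons.1 hm with rfl | hm
        · exact hjm.ne rfl
        · exact absurd (hK'.1 m hm) (by simp; omega)
      · rw [foldBra_cons, List.foldr_cons]
        rcases Nat.eq_zero_or_pos j with rfl | hj
        · rw [eq_nil_of_pairwise_zero hK, eq_nil_of_pairwise_zero hL, List.foldr_nil, h.left_zero,
            h.right_zero, phiOp_zero_phiOp_zero, foldBra_nil, vacBra_vac]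
          simp
        · have h0 := h.foldr_eq_zero hj L (fun k hk => hN k (by simp [hk]))
            (fun hm => absurd (hL'.1 j hm) (by simp))
          have h1 := h.anticomm j j (hN j (by simp)) (Or.inl hj) (L.foldr (fun k v => C k v) vac)
          rw [h0, map_zero, add_zero, if_pos rfl] at h1
          rw [h1, map_smul, ih L hK'.2 hL'.2 fun k hk => hN k (by simp [hk])]
          simp only [List.cons.injEq, true_and]
          split_ifs
          · rw [List.filter_cons_of_pos (by simpa using hj), List.length_cons, pow_succ',
              smul_eq_mul]
          · rw [smul_zero]
      · rw [if_neg (by simp [hjm.ne']), foldBra_cons, h.foldr_eq_zero (by omega) _ hN, map_zero]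
        intro hj
        rcases List.mem_cons.1 hj with rfl | hj
        · exact hjm.ne rfl
        · exact absurd (hL'.1 j hj) (by simp; omega)

end DualPair

/-- The adjoint of `φ_j`. -/
def phiAdj (j : ℕ) : Fock →ₗ[CoeffRing] Fock := sgn j • phiOp (-(j : ℤ))

theorem isDualPair_phi (N : ℕ) : IsDualPair N phiAdj fun k => phiOp k where
  anticomm j k _ hjk v := by
    simp only [phiAdj, LinearMap.smul_apply, map_smul]
    rw [← smul_add, phiOp_anticomm, smul_smul]
    by_cases h : j = k
    · rw [if_pos (by omega), if_pos h, sgn_neg, mul_left_comm, sgn_mul_self, mul_one]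
    · rw [if_neg (by omega), if_neg h, mul_zero]
  vac_eq_zero j hj := by rw [phiAdj, LinearMap.smul_apply, phiOp_vac (by omega), smul_zero]
  vacBra_eq_zero k v hk := vacBra_phiOp (by omega) v
  left_zero v := by simp [phiAdj, sgn]
  right_zero v := by simp

theorem form_word_natCast (L : List ℕ) (w : Fock) :
    form (word (L.map Nat.cast)) w = foldBra phiAdj L w := by
  induction L generalizing w with
  | nil => exact form_vac w
  | cons j L ih =>
    rw [List.map_cons, word_cons, form_phiOp, ih, foldBra_cons, phiAdj, LinearMap.smul_apply,
      map_smul, smul_eq_mul]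

open Classical in
theorem form_word_intParts (lam mu : StrictPartition) :
    form (word lam.intParts) (word mu.intParts) = if lam = mu then 2 ^ lam.length else 0 := by
  have hw : word mu.intParts = mu.evenParts.foldr (fun (k : ℕ) v => phiOp (k : ℤ) v) vac := by
    rw [StrictPartition.intParts, word, List.foldr_map]
  rw [hw, StrictPartition.intParts, form_word_natCast,
    (isDualPair_phi (mu.evenParts.sum + 1)).foldBra_foldr _ _ lam.evenParts_pairwise
      mu.evenParts_pairwise fun k hk => Nat.lt_succ_of_le (List.le_sum_of_mem hk),
    ← lam.parts_eq_filter]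
  by_cases h : lam = mu
  · rw [if_pos h, if_pos (by rw [h])]; rfl
  · rw [if_neg h, if_neg fun h' => h (StrictPartition.evenParts_injective h')]

/-- The adjoint of `\hat φ^{(a)}_j`, up to terms of degree at most `-N - j`. -/
def phiHatAdj (N j : ℕ) : Fock →ₗ[CoeffRing] Fock :=
  ∑ i ∈ Finset.range N, homog j i • phiAdj (j + i)

theorem phiHatAdj_apply (N j : ℕ) (v : Fock) :
    phiHatAdj N j v = ∑ i ∈ Finset.range N, homog j i • phiAdj (j + i) v := by
  simp [phiHatAdj]

/-- The contractions collect h_i (-1)^l e_l over i + l = k - j, which is the coefficient computed in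
`sum_homog_mul_elem`. Truncating at N loses nothing because k < N forces i < N. -/
theorem isDualPair_phiHatAdj (N : ℕ) (hN : 0 < N) : IsDualPair N (phiHatAdj N) phiA where
  anticomm j k hk hjk v := by
    rcases Nat.eq_zero_or_pos k with rfl | hk0
    · have hj : 0 < j := by omega
      have h0 : ∀ v, phiA 0 v = phiOp (0 : ℕ) v := fun v => by simp [phiA]
      rw [if_neg (by omega), zero_smul, h0, h0, phiHatAdj_apply, phiHatAdj_apply, map_sum,
        ← Finset.sum_add_distrib]
      refine Finset.sum_eq_zero fun i _ => ?_
      rw [map_smul, ← smul_add, (isDualPair_phi N).anticomm _ _ hN (Or.inl (by omega)),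
        if_neg (by omega), zero_smul, smul_zero]
    · have h1 : phiHatAdj N j (phiA k v) + phiA k (phiHatAdj N j v) =
          ∑ i ∈ Finset.range N, ∑ l ∈ Finset.range k,
            (homog j i * ((-1) ^ l * elem (k - 1) l) * if j + i + l = k then 2 else 0) • v := by
        have hA : ∀ v, phiA k v = ∑ l ∈ Finset.range k,
            ((-1) ^ l * elem (k - 1) l) • phiOp ((k - l : ℕ) : ℤ) v := fun v => by
          rw [phiA_eq_sum hk0, LinearMap.sum_apply]
          refine Finset.sum_congr rfl fun l hl => ?_
          rw [LinearMap.smul_apply, Nat.cast_sub (Finset.mem_range.1 hl).le]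
        simp only [phiHatAdj_apply, map_sum, map_smul]
        rw [← Finset.sum_add_distrib]
        refine Finset.sum_congr rfl fun i _ => ?_
        rw [hA, hA, map_sum, ← smul_add, ← Finset.sum_add_distrib, Finset.smul_sum]
        refine Finset.sum_congr rfl fun l hl => ?_
        rw [Finset.mem_range] at hl
        rw [map_smul, ← smul_add, (isDualPair_phi N).anticomm _ _ (by omega) (Or.inr (by omega)),
          smul_smul, smul_smul, ← mul_assoc]
        congr 2
        exact if_congr (by omega) rfl rfl
      rw [h1]
      simp only [← Finset.sum_smul]
      congr 1
      by_cases hjk : j ≤ k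
      · obtain ⟨n, rfl⟩ := Nat.exists_eq_add_of_le hjk
        have h2 := sum_homog_mul_elem (j := j) (k := j + n) (n := n) rfl hk0
        have h3 : ∀ i l, j + i + l = j + n ↔ i + l = n := fun i l => by omega
        simp only [h3, mul_ite, mul_zero]
        rw [← Finset.sum_product', ← Finset.sum_filter]
        rw [← mul_one (if j = j + n then (2 : CoeffRing) else 0)]
        have h4 : (if j = j + n then (2 : CoeffRing) else 0) * 1 = (if n = 0 then 1 else 0) * 2 := by
          by_cases hn : n = 0
          · rw [if_pos (by omega), if_pos hn]; ring
          · rw [if_neg (by omega), if_neg hn]; ring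
        rw [h4, ← h2, Finset.sum_mul]
        refine Finset.sum_subset (fun q hq => ?_) fun q hq hq' => ?_
        · rw [Finset.mem_filter] at hq
          exact Finset.HasAntidiagonal.mem_antidiagonal.2 hq.2
        · rw [Finset.HasAntidiagonal.mem_antidiagonal] at hq
          -- An index pair of the antidiagonal outside the box must have l ≥ k, and e_l of k - 1
          -- parameters is then zero.
          rw [elem_eq_zero, mul_zero, mul_zero, zero_mul]
          by_contra hlt
          refine hq' (Finset.mem_filter.2 ⟨Finset.mem_product.2 ⟨?_, ?_⟩, hq⟩) <;>
            rw [Finset.mem_range] <;> omega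
      · rw [if_neg (by omega)]
        refine Finset.sum_eq_zero fun i _ => Finset.sum_eq_zero fun l _ => ?_
        rw [if_neg (by omega), mul_zero]
  vac_eq_zero j hj := by
    rw [phiHatAdj_apply]
    exact Finset.sum_eq_zero fun i _ => by
      rw [(isDualPair_phi N).vac_eq_zero _ (by omega), smul_zero]
  vacBra_eq_zero k v hk := by
    rw [phiA_eq_sum hk, LinearMap.sum_apply, map_sum]
    refine Finset.sum_eq_zero fun l hl => ?_
    rw [Finset.mem_range] at hl
    rw [LinearMap.smul_apply, map_smul, vacBra_phiOp (by omega), smul_zero]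
  left_zero v := by
    rw [phiHatAdj_apply, Finset.sum_eq_single 0]
    · rw [homog_zero_right, one_smul, (isDualPair_phi N).left_zero]
    · intro i _ hi
      obtain ⟨i, rfl⟩ := Nat.exists_eq_succ_of_ne_zero hi
      rw [Nat.succ_eq_add_one, homog_zero_succ, zero_smul]
    · exact fun h => absurd (Finset.mem_range.2 hN) h
  right_zero v := by simp [phiA]

/-! ### Pairing the vectors `|λ⟩_H` and `|μ⟩_C` -/

/-- The functional `w ↦ ∑_{d < N} (v_d, w)`, for `v = ∑_d v_d` in the completed Fock space. -/
def formHat (N : ℕ) (v : FockHat) : Fock →ₗ[CoeffRing] CoeffRing :=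
  ∑ d ∈ Finset.range N, form (v.1 d)

theorem formHat_apply (N : ℕ) (v : FockHat) (w : Fock) :
    formHat N v w = ∑ d ∈ Finset.range N, form (v.1 d) w := by
  rw [formHat, LinearMap.sum_apply]

theorem formHat_word_intParts {N : ℕ} (v : FockHat) {nu : StrictPartition} (h : nu.size < N) :
    formHat N v (word nu.intParts) = form (v.1 nu.size) (word nu.intParts) := by
  rw [formHat_apply, Finset.sum_eq_single nu.size]
  · intro d _ hd
    refine form_word_eq_zero (v.2 d) ?_
    rw [nu.sum_intParts]
    exact_mod_cast hd
  · exact fun h' => absurd (Finset.mem_range.2 h) h'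

theorem phiHatAdj_mem_lowerWords {N p : ℕ} (j : ℕ) {w : Fock} (hw : w ∈ lowerWords N p) :
    phiHatAdj N j w ∈ lowerWords N (p + 1) := by
  rw [phiHatAdj_apply]
  refine sum_mem fun i _ => Submodule.smul_mem _ _ ?_
  rw [phiAdj, LinearMap.smul_apply]
  refine Submodule.smul_mem _ _ ?_
  have := phiOp_mem_lowerWords (n := -((j + i : ℕ) : ℤ)) (m := 0) (by omega) hw
  rwa [zero_add] at this

/-- On vectors of degree below N the truncated adjoint is exact: by degree, only terms with j + i +
e < N can pair nontrivially. -/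
theorem formHat_phiHat {N p : ℕ} (j : ℕ) (v : FockHat) {w : Fock} (hw : w ∈ lowerWords N p) :
    formHat N (phiHat j v) w = formHat N v (phiHatAdj N j w) := by
  induction hw using Submodule.span_induction with
  | mem w hw =>
    obtain ⟨l, hl, -, rfl⟩ := hw
    set T : ℕ × ℕ → CoeffRing := fun q => homog j q.1 * form (v.1 q.2) (phiAdj (j + q.1) (word l))
      with hT
    have hT0 : ∀ q : ℕ × ℕ, N ≤ j + q.1 + q.2 → T q = 0 := fun q hq => by
      simp only [hT]
      rw [phiAdj, LinearMap.smul_apply, ← word_cons, map_smul,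
        form_word_eq_zero (v.2 q.2), smul_zero, mul_zero]
      rw [List.sum_cons]
      omega
    have hleft : ∀ d ∈ Finset.range N, form ((phiHat j v).1 d) (word l) =
        ∑ q ∈ Finset.range N ×ˢ Finset.range N, if j + q.1 + q.2 = d then T q else 0 := by
      intro d hd
      rw [Finset.mem_range] at hd
      change form (if j ≤ d then _ else _) (word l) = _
      split_ifs with hj
      · rw [map_sum, LinearMap.sum_apply, ← Finset.sum_filter]
        refine Finset.sum_congr ?_ fun q _ => ?_
        · ext q
          simp only [Finset.HasAntidiagonal.mem_antidiagonal, Finset.mem_filter,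
            Finset.mem_product, Finset.mem_range]
          omega
        · rw [map_smul, LinearMap.smul_apply, form_phiOp, smul_eq_mul]
          simp only [hT, phiAdj, LinearMap.smul_apply, map_smul, smul_eq_mul]
          push_cast
          rfl
      · rw [map_zero, LinearMap.zero_apply]
        exact (Finset.sum_eq_zero fun q _ => if_neg (by omega)).symm
    rw [formHat_apply, formHat_apply, Finset.sum_congr rfl hleft, Finset.sum_comm]
    have hright : ∀ e, form (v.1 e) (phiHatAdj N j (word l)) =
        ∑ i ∈ Finset.range N, T (i, e) := fun e => by
      rw [phiHatAdj_apply, map_sum]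
      exact Finset.sum_congr rfl fun i _ => by rw [map_smul, smul_eq_mul]
    rw [Finset.sum_congr rfl fun e _ => hright e,
      ← Finset.sum_product_right' _ _ fun i e => T (i, e)]
    refine Finset.sum_congr rfl fun q _ => ?_
    rw [Finset.sum_ite_eq]
    split_ifs with h
    · rfl
    · exact (hT0 q (by simpa using h)).symm
  | zero => simp only [map_zero]
  | add v w _ _ hv hw => simp only [map_add, hv, hw]
  | smul c v _ hv => simp only [map_smul, hv]

theorem formHat_vacHat {N : ℕ} (hN : 0 < N) (w : Fock) : formHat N vacHat w = vacBra w := by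
  rw [formHat_apply, Finset.sum_eq_single 0]
  · change form (Pi.single (M := fun _ => Fock) 0 vac 0) w = _
    rw [Pi.single_eq_same, form_vac]
  · intro d _ hd
    change form (Pi.single (M := fun _ => Fock) 0 vac d) w = _
    rw [Pi.single_eq_of_ne hd, map_zero, LinearMap.zero_apply]
  · exact fun h => absurd (Finset.mem_range.2 hN) h

theorem formHat_foldr_phiHat {N : ℕ} (hN : 0 < N) (L : List ℕ) {p : ℕ} {w : Fock}
    (hw : w ∈ lowerWords N p) : formHat N (L.foldr (fun j v => phiHat j v) vacHat) w =
      foldBra (phiHatAdj N) L w := by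
  induction L generalizing p w with
  | nil => exact formHat_vacHat hN w
  | cons j L ih =>
    rw [List.foldr_cons, formHat_phiHat j _ hw, ih (phiHatAdj_mem_lowerWords j hw), foldBra_cons]

theorem size_eq_sum_evenParts (lam : StrictPartition) : lam.size = lam.evenParts.sum := by
  rw [StrictPartition.evenParts, StrictPartition.size]
  split_ifs <;> simp

theorem ketC_mem_lowerWords {mu : StrictPartition} {N : ℕ} (hN : mu.size < N) :
    ketC mu ∈ lowerWords N mu.evenParts.length := by
  have h := foldr_phiA_sub_word_mem_lowerWords mu.evenParts
  rw [← size_eq_sum_evenParts] at h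
  have h' : word (mu.evenParts.map Nat.cast) ∈ lowerWords N mu.evenParts.length := by
    refine Submodule.subset_span ⟨_, ?_, List.length_map _, rfl⟩
    rw [← Nat.cast_list_sum, ← size_eq_sum_evenParts]
    exact_mod_cast hN
  have hle : lowerWords mu.size mu.evenParts.length ≤ lowerWords N mu.evenParts.length := by
    refine Submodule.span_mono ?_
    rintro v ⟨l, h1, h2, h3⟩
    exact ⟨l, by omega, h2, h3⟩
  exact (sub_add_cancel (ketC mu) (word (mu.evenParts.map Nat.cast))) ▸ add_mem (hle h) h'

-- The creation operators of |λ⟩_H move across the form as their adjoints, and the dual pair with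
-- the deformed fermions gives orthogonality.
open Classical in
theorem formHat_ketH_ketC (lam : StrictPartition) {mu : StrictPartition} {N : ℕ}
    (hN : mu.size < N) : formHat N (ketH lam) (ketC mu) =
      if lam = mu then 2 ^ lam.length else 0 := by
  rw [ketH, formHat_foldr_phiHat (by omega) _ (ketC_mem_lowerWords hN), ketC,
    (isDualPair_phiHatAdj N (by omega)).foldBra_foldr _ _ lam.evenParts_pairwise
      mu.evenParts_pairwise fun k hk => ?_, ← lam.parts_eq_filter]
  · by_cases h : lam = mu
    · rw [if_pos h, if_pos (by rw [h])]; rfl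
    · rw [if_neg h, if_neg fun h' => h (StrictPartition.evenParts_injective h')]
  · rw [size_eq_sum_evenParts] at hN
    exact (List.le_sum_of_mem hk).trans_lt hN

/-! ### Expansions in strict words -/

theorem word_mem_span_of_even {l : List ℤ} (hl : l.length % 2 = 0) : word l ∈
    Submodule.span CoeffRing (Set.range fun nu : StrictPartition => word nu.intParts) := by
  obtain ⟨M, hM⟩ := exists_word_mem_normalWords l
  generalize word l = w at hM ⊢
  induction hM using AddSubgroup.closure_induction with
  | mem w hw =>
    obtain ⟨l', h, h0, -, hp, rfl⟩ := hw
    obtain ⟨nu, rfl⟩ := exists_intParts_eq h (fun k hk => (h0 k hk).1) (by omega)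
    exact Submodule.subset_span ⟨nu, rfl⟩
  | zero => exact zero_mem _
  | add v w _ _ hv hw => exact add_mem hv hw
  | neg v _ hv => exact neg_mem hv

theorem mem_span_of_mem_lowerWords {d : ℤ} {p : ℕ} (hp : p % 2 = 0) {v : Fock}
    (hv : v ∈ lowerWords d p) : v ∈
      Submodule.span CoeffRing (Set.range fun nu : StrictPartition => word nu.intParts) := by
  refine Submodule.span_le.2 ?_ hv
  rintro _ ⟨l, -, hl, rfl⟩
  exact word_mem_span_of_even (by omega)

/-- The part of v of odd length is invisible both to ⟨vac| e^H and to the form against strict words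
of even length. -/
theorem exists_eq_linearCombination_add (v : Fock) : ∃ (c : StrictPartition →₀ CoeffRing) (o : Fock),
    v = Finsupp.linearCombination CoeffRing (fun nu : StrictPartition => word nu.intParts) c + o ∧
      vev o = 0 ∧ ∀ nu : StrictPartition, form o (word nu.intParts) = 0 := by
  set O : Submodule CoeffRing Fock := LinearMap.ker vevLin ⊓
    ⨅ nu : StrictPartition, LinearMap.ker (form.flip (word nu.intParts)) with hO
  have h : v ∈ Submodule.span CoeffRing
      (Set.range fun nu : StrictPartition => word nu.intParts) ⊔ O := by
    have hv : v ∈ Submodule.span CoeffRing (Set.range word) := by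
      rw [span_word_eq_top]; trivial
    refine Submodule.span_le.2 ?_ hv
    rintro _ ⟨l, rfl⟩
    by_cases hl : l.length % 2 = 0
    · exact Submodule.mem_sup_left (word_mem_span_of_even hl)
    · refine Submodule.mem_sup_right ⟨vev_word_eq_zero_of_odd hl, ?_⟩
      refine (Submodule.mem_iInf _).2 fun nu => ?_
      rw [LinearMap.mem_ker, LinearMap.flip_apply]
      refine form_word_word_eq_zero _ _ fun h => hl ?_
      rw [h.2, nu.length_intParts]
  obtain ⟨e, he, o, ho, rfl⟩ := Submodule.mem_sup.1 h
  obtain ⟨c, rfl⟩ := (Finsupp.mem_span_range_iff_exists_finsupp).1 he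
  exact ⟨c, o, rfl, ho.1, fun nu => (Submodule.mem_iInf _).1 ho.2 nu⟩

theorem form_linearCombination (c : StrictPartition →₀ CoeffRing) (nu : StrictPartition) :
    form (Finsupp.linearCombination CoeffRing (fun mu : StrictPartition => word mu.intParts) c)
      (word nu.intParts) = c nu * 2 ^ nu.length := by
  classical
  rw [← LinearMap.flip_apply, Finsupp.apply_linearCombination, Finsupp.linearCombination_apply,
    Finsupp.sum, Finset.sum_eq_single nu]
  · simp [form_word_intParts]
  · intro mu _ hmu
    simp [form_word_intParts, hmu]
  · intro h
    rw [Finsupp.notMem_support_iff.1 h, zero_smul]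

theorem vev_linearCombination (c : StrictPartition →₀ CoeffRing) :
    vev (Finsupp.linearCombination CoeffRing (fun mu : StrictPartition => word mu.intParts) c) =
      c.sum fun nu r => r • schurQ nu := by
  rw [← vevLin_apply, Finsupp.apply_linearCombination, Finsupp.linearCombination_apply]
  simp only [Function.comp_apply, vevLin_apply, ← schurQ_eq_vev]

theorem coeff_schurP (nu : StrictPartition) (d : ℕ →₀ ℕ) : MvPowerSeries.coeff d (schurP nu) =
    cst ((2 : ℂ)⁻¹ ^ nu.length) * MvPowerSeries.coeff d (schurQ nu) := by
  rw [schurP, MvPowerSeries.coeff_smul]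

theorem cst_inv_two_pow_mul (n : ℕ) : cst ((2 : ℂ)⁻¹ ^ n) * 2 ^ n = 1 := by
  have : (2 : CoeffRing) = cst 2 := (map_ofNat MvPolynomial.C _).symm
  rw [this, ← map_pow, ← map_mul, ← mul_pow, inv_mul_cancel₀ two_ne_zero, one_pow, map_one]

/-- The coefficient of `P_ν` in `⟨vac| e^{H(y)} |v⟩` is `(v, φ_{ν_1} ⋯ φ_{ν_r} |vac⟩)`. -/
theorem isPExpansion_vevHat (v : FockHat) :
    IsPExpansion (fun nu => form (v.1 nu.size) (word nu.intParts)) (vevHat v) := by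
  intro d
  obtain ⟨c, o, hv, ho, ho'⟩ := exists_eq_linearCombination_add (v.1 d.degree)
  have hvev : vev (v.1 d.degree) = c.sum fun nu r => r • schurQ nu := by
    rw [hv, ← vevLin_apply, map_add, vevLin_apply, vevLin_apply, ho, add_zero,
      vev_linearCombination]
  have hform : ∀ nu, form (v.1 d.degree) (word nu.intParts) = c nu * 2 ^ nu.length := fun nu => by
    rw [hv, map_add, LinearMap.add_apply, ho', add_zero, form_linearCombination]
  -- The norm 2^{ℓ(ν)} of the word is cancelled by the factor between P_ν and Q_ν; in other degrees
  -- both sides vanish.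
  have hterm : ∀ nu : StrictPartition, form (v.1 nu.size) (word nu.intParts) *
      MvPowerSeries.coeff d (schurP nu) = c nu * MvPowerSeries.coeff d (schurQ nu) := by
    intro nu
    rw [coeff_schurP]
    by_cases h : nu.size = d.degree
    · rw [h, hform, mul_assoc, ← mul_assoc (2 ^ _), mul_comm (2 ^ _), cst_inv_two_pow_mul, one_mul]
    · rw [coeff_schurQ_eq_zero h, mul_zero, mul_zero, mul_zero]
  rw [coeff_vevHat, hvev, finsum_congr hterm, Finsupp.sum, map_sum,
    finsum_eq_sum_of_support_subset (s := c.support)]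
  · simp only [MvPowerSeries.coeff_smul]
  · intro nu hnu
    rw [Finset.mem_coe, Finsupp.mem_support_iff]
    exact left_ne_zero_of_mul hnu

/-! ### Uniqueness of expansions -/

theorem StrictPartition.finite_size_eq (k : ℕ) : {nu : StrictPartition | nu.size = k}.Finite := by
  refine Set.Finite.of_finite_image (f := fun nu => (nu.parts : Multiset ℕ)) ?_ ?_
  · refine (Set.finite_range fun p : Nat.Partition k => p.parts).subset ?_
    rintro _ ⟨nu, rfl, rfl⟩
    exact ⟨⟨nu.parts, fun {i} hi => nu.pos i (by simpa using hi), by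
      rw [Multiset.sum_coe]; rfl⟩, rfl⟩
  · intro nu _ mu _ h
    exact ext_parts ((Multiset.coe_eq_coe.1 h).eq_of_pairwise
      (fun a b _ _ h1 h2 => absurd h1 (by simp; omega)) nu.strict mu.strict)

/-- The strict partitions of `k`. -/
def strictPartitions (k : ℕ) : Finset StrictPartition :=
  (StrictPartition.finite_size_eq k).toFinset

theorem mem_strictPartitions {k : ℕ} {nu : StrictPartition} :
    nu ∈ strictPartitions k ↔ nu.size = k := by
  simp [strictPartitions]

theorem component_schurQ (k : ℕ) (nu : StrictPartition) :
    component k (schurQ nu) = if nu.size = k then schurQ nu else 0 := by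
  ext1 d
  rw [coeff_component]
  split_ifs with h1 h2 h2
  · rfl
  · rw [coeff_schurQ_eq_zero (by omega), map_zero]
  · rw [coeff_schurQ_eq_zero (by omega)]
  · rw [map_zero]

/-- Taking homogeneous components, as a linear map. -/
def componentLin (k : ℕ) : Series →ₗ[CoeffRing] Series where
  toFun := component k
  map_add' f g := by
    ext1 d
    simp only [map_add, coeff_component]
    split_ifs <;> simp
  map_smul' c f := by
    ext1 d
    simp only [MvPowerSeries.coeff_smul, coeff_component, RingHom.id_apply]
    split_ifs <;> simp

theorem componentLin_apply (k : ℕ) (f : Series) : componentLin k f = component k f := rfl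

theorem component_linearCombination (k : ℕ) (c : StrictPartition →₀ CoeffRing) :
    component k (Finsupp.linearCombination CoeffRing schurQ c) =
      ∑ nu ∈ strictPartitions k, c nu • schurQ nu := by
  classical
  rw [← componentLin_apply, Finsupp.linearCombination_apply, Finsupp.sum, map_sum]
  simp only [map_smul, componentLin_apply, component_schurQ, smul_ite, smul_zero]
  rw [← Finset.sum_filter]
  refine Finset.sum_subset (fun nu hnu => ?_) fun nu hnu hnu' => ?_
  · exact mem_strictPartitions.2 (Finset.mem_filter.1 hnu).2
  · rw [Finset.mem_filter, not_and'] at hnu'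
    rw [Finsupp.notMem_support_iff.1 (hnu' (mem_strictPartitions.1 hnu)), zero_smul]

/-- By homogeneity the infinite expansion is a family of finite ones, one in each degree, to which
independence and spanning of the Q_ν apply. -/
theorem isPExpansion_iff {u : StrictPartition → CoeffRing} {f : Series} : IsPExpansion u f ↔
    ∀ k, component k f =
      ∑ nu ∈ strictPartitions k, (u nu * cst ((2 : ℂ)⁻¹ ^ nu.length)) • schurQ nu := by
  have h : ∀ d : ℕ →₀ ℕ, ∑ᶠ nu : StrictPartition, u nu * MvPowerSeries.coeff d (schurP nu) =
      MvPowerSeries.coeff d (∑ nu ∈ strictPartitions d.degree,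
        (u nu * cst ((2 : ℂ)⁻¹ ^ nu.length)) • schurQ nu) := by
    intro d
    rw [finsum_eq_sum_of_support_subset (s := strictPartitions d.degree), map_sum]
    · simp only [coeff_schurP, MvPowerSeries.coeff_smul, mul_assoc]
    · intro nu hnu
      rw [Finset.mem_coe, mem_strictPartitions]
      by_contra hne
      exact hnu (show u nu * _ = 0 by rw [coeff_schurP, coeff_schurQ_eq_zero hne, mul_zero, mul_zero])
  constructor
  · intro hu k
    ext1 d
    rw [coeff_component]
    split_ifs with hd
    · rw [hu d, h d, hd]
    · rw [map_sum, Finset.sum_eq_zero fun nu hnu => ?_]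
      rw [MvPowerSeries.coeff_smul, coeff_schurQ_eq_zero, mul_zero]
      rw [mem_strictPartitions.1 hnu]
      exact Ne.symm hd
  · intro hf d
    rw [h d, ← hf, coeff_component, if_pos rfl]

theorem IsPExpansion.eq_of_eq {u : StrictPartition → CoeffRing} {f g : Series}
    (hf : IsPExpansion u f) (hg : IsPExpansion u g) : f = g := by
  ext1 d
  rw [hf d, hg d]

theorem IsPExpansion.unique {u u' : StrictPartition → CoeffRing} {f : Series}
    (h : IsPExpansion u f) (h' : IsPExpansion u' f) : u = u' := by
  funext nu
  have e := (isPExpansion_iff.1 h nu.size).symm.trans (isPExpansion_iff.1 h' nu.size)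
  rw [← sub_eq_zero, ← Finset.sum_sub_distrib] at e
  simp only [← sub_smul, ← sub_mul] at e
  have := linearIndependent_iff'.1 linearIndependent_schurQ _ _ e nu (mem_strictPartitions.2 rfl)
  exact sub_eq_zero.1 ((mul_eq_zero.1 this).resolve_right
    (left_ne_zero_of_mul_eq_one (cst_inv_two_pow_mul nu.length)))

theorem IsInGamHat.exists_isPExpansion {f : Series} (hf : IsInGamHat f) :
    ∃ u, IsPExpansion u f := by
  have h : ∀ k, ∃ c : StrictPartition →₀ CoeffRing,
      Finsupp.linearCombination CoeffRing schurQ c = component k f := fun k =>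
    Finsupp.mem_span_range_iff_exists_finsupp.1 (mem_span_schurQ_of_mem_Gam (hf k))
  choose c hc using h
  refine ⟨fun nu => c nu.size nu * 2 ^ nu.length, isPExpansion_iff.2 fun k => ?_⟩
  have hk : component k (component k f) = component k f := by
    ext1 d
    rw [coeff_component, coeff_component]
    split_ifs <;> rfl
  rw [← hk, ← hc, component_linearCombination]
  refine Finset.sum_congr rfl fun nu hnu => ?_
  rw [mem_strictPartitions.1 hnu, mul_assoc, mul_comm (2 ^ _), cst_inv_two_pow_mul, mul_one]

theorem pCoeffs_eq {u : StrictPartition → CoeffRing} {f : Series} (h : IsPExpansion u f) :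
    pCoeffs f = u := by
  have h' : ∃ u, IsPExpansion u f := ⟨u, h⟩
  rw [pCoeffs, dif_pos h']
  exact h'.choose_spec.unique h

theorem qCoeffs_eq {v : StrictPartition →₀ CoeffRing} {g : Series} (h : IsQExpansion v g) :
    qCoeffs g = v := by
  have h' : ∃ v, IsQExpansion v g := ⟨v, h⟩
  rw [qCoeffs, dif_pos h']
  have e : Finsupp.linearCombination CoeffRing schurQ h'.choose =
      Finsupp.linearCombination CoeffRing schurQ v := h'.choose_spec.symm.trans h
  exact linearIndependent_schurQ e

theorem pairing_eq {u : StrictPartition → CoeffRing} {v : StrictPartition →₀ CoeffRing}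
    {f g : Series} (hf : IsPExpansion u f) (hg : IsQExpansion v g) :
    pairing f g = Finsupp.linearCombination CoeffRing u v := by
  rw [pairing, pCoeffs_eq hf, qCoeffs_eq hg, Finsupp.linearCombination_apply]
  simp only [smul_eq_mul, mul_comm]

/-! ### Dual factorial `P`-functions -/

theorem exists_isQExpansion_factorialQ (mu : StrictPartition) : ∃ c : StrictPartition →₀ CoeffRing,
    (∀ nu ∈ c.support, nu.size < mu.size) ∧ IsQExpansion (Finsupp.single mu 1 + c) (factorialQ mu) := by
  obtain ⟨c, hc, hsum⟩ := (Finsupp.mem_span_image_iff_linearCombination CoeffRing).1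
    (factorialQ_sub_schurQ_mem_span mu)
  refine ⟨c, fun nu hnu => (Finsupp.mem_supported CoeffRing c).1 hc hnu, ?_⟩
  rw [IsQExpansion, ← Finsupp.linearCombination_apply, map_add, hsum, Finsupp.linearCombination_single, one_smul, add_sub_cancel]

/-- Q_μ(x|a) is Q_μ plus terms of smaller size, so the conditions determine the coefficient at P_μ
recursively in |μ|. -/
theorem IsDualFactorialP.unique {lam : StrictPartition} {f g : Series}
    (hf : IsDualFactorialP lam f) (hg : IsDualFactorialP lam g) : f = g := by
  obtain ⟨u, hu⟩ := hf.1.exists_isPExpansion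
  obtain ⟨u', hu'⟩ := hg.1.exists_isPExpansion
  suffices h : ∀ n, ∀ mu : StrictPartition, mu.size = n → u mu = u' mu by
    have : u = u' := funext fun mu => h _ mu rfl
    exact hu.eq_of_eq (this ▸ hu')
  intro n
  induction n using Nat.strong_induction_on with
  | _ n ih =>
    rintro mu rfl
    obtain ⟨c, hc, he⟩ := exists_isQExpansion_factorialQ mu
    have e := (hf.2 mu).trans (hg.2 mu).symm
    rw [pairing_eq hu he, pairing_eq hu' he, map_add, map_add, Finsupp.linearCombination_single,
      Finsupp.linearCombination_single, one_smul, one_smul] at e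
    have hcc : Finsupp.linearCombination CoeffRing u c =
        Finsupp.linearCombination CoeffRing u' c := by
      rw [Finsupp.linearCombination_apply, Finsupp.linearCombination_apply]
      exact Finset.sum_congr rfl fun nu hnu => congrArg (c nu • ·) (ih _ (hc nu hnu) nu rfl)
    rw [hcc] at e
    exact add_right_cancel e

theorem isDualFactorialP_ketH (lam : StrictPartition) :
    IsDualFactorialP lam (cst ((2 : ℂ)⁻¹ ^ lam.length) • vevHat (ketH lam)) := by
  constructor
  · intro k
    rw [← componentLin_apply, map_smul]
    exact Subalgebra.smul_mem _ (isInGamHat_vevHat _ k) _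
  · intro mu
    have hu : IsPExpansion (fun nu => cst ((2 : ℂ)⁻¹ ^ lam.length) *
        form ((ketH lam).1 nu.size) (word nu.intParts))
        (cst ((2 : ℂ)⁻¹ ^ lam.length) • vevHat (ketH lam)) := by
      refine isPExpansion_iff.2 fun k => ?_
      rw [← componentLin_apply, map_smul, componentLin_apply,
        isPExpansion_iff.1 (isPExpansion_vevHat (ketH lam)) k, Finset.smul_sum]
      simp only [smul_smul, mul_assoc]
    -- The coefficients c of |μ⟩_C in strict words are also those of Q_μ(x|a) in the Q_ν, which
    -- turns the pairing into the form of |λ⟩_H and |μ⟩_C.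
    obtain ⟨c, hc⟩ := Finsupp.mem_span_range_iff_exists_finsupp.1
      (mem_span_of_mem_lowerWords (Nat.even_iff.1 mu.even_length_evenParts)
        (ketC_mem_lowerWords (Nat.lt_succ_self mu.size)))
    have hq : IsQExpansion c (factorialQ mu) := by
      rw [IsQExpansion, factorialQ_eq_vev, ← hc]
      exact vev_linearCombination c
    -- The cutoff has to exceed both |μ| and the size of every ν occurring in c.
    set N := mu.size + 1 + c.support.sup StrictPartition.size with hN
    have hsize : ∀ nu ∈ c.support, nu.size < N := fun nu hnu => by
      have := Finset.le_sup (f := StrictPartition.size) hnu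
      omega
    have hpair := formHat_ketH_ketC lam (mu := mu) (N := N) (by omega)
    rw [← hc, Finsupp.sum, map_sum] at hpair
    rw [pairing_eq hu hq, Finsupp.linearCombination_apply, Finsupp.sum]
    have hterm : ∀ nu ∈ c.support, c nu • (cst ((2 : ℂ)⁻¹ ^ lam.length) *
        form ((ketH lam).1 nu.size) (word nu.intParts)) = cst ((2 : ℂ)⁻¹ ^ lam.length) *
          formHat N (ketH lam) (c nu • word nu.intParts) := fun nu hnu => by
      rw [map_smul, formHat_word_intParts _ (hsize nu hnu), smul_eq_mul, smul_eq_mul,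
        mul_left_comm]
    rw [Finset.sum_congr rfl hterm, ← Finset.mul_sum, hpair]
    split_ifs
    · exact cst_inv_two_pow_mul _
    · exact mul_zero _

theorem existsUnique_isDualFactorialP (lam : StrictPartition) :
    ∃! f : Series, IsDualFactorialP lam f :=
  ⟨_, isDualFactorialP_ketH lam, fun _ hg => hg.unique (isDualFactorialP_ketH lam)⟩

theorem dualFactorialP_eq (lam : StrictPartition) :
    dualFactorialP lam = cst ((2 : ℂ)⁻¹ ^ lam.length) • vevHat (ketH lam) :=
  (Classical.epsilon_spec (⟨_, isDualFactorialP_ketH lam⟩ :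
    ∃ f, IsDualFactorialP lam f)).unique (isDualFactorialP_ketH lam)

end NeutralFermion

end

open NeutralFermion
theorem mainTheorem10 :
    (∀ lam : StrictPartition,
      (∃! f : Series, IsDualFactorialP lam f) ∧
        dualFactorialP lam = cst ((2 : ℂ)⁻¹ ^ lam.length) • vevHat (ketH lam)) ∧
    (∀ lam : StrictPartition, factorialQ lam = vev (ketC lam)) := by
  exact ⟨fun lam => ⟨existsUnique_isDualFactorialP lam, dualFactorialP_eq lam⟩, factorialQ_eq_vev⟩
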